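/- Notation. For a set $X\subset\mathbb P^n(\mathbb C)$ let $I(X)\subset\mathbb C[x_0,\dots,x_n]$ be its homogeneous ideal. For a projective algebraic set $V\subset\mathbb P^n(\mathbb C)$ let $H_m$ be the space of homogeneous polynomials of degree $m$, $I_m(V)=H_m/(I(V)\cap H_m)$ and $H_V(m)=\dim_{\mathbb C} I_m(V)$. Let $D_j=\{Q_j=0\}$ $(1\le j\le q)$ be hypersurfaces, $Q_j$ homogeneous of degree $\deg D_j\ge 1$, with $\dim (D_j\cap V)<\dim V$ for every $j$ (if $V$ is irreducible this means $V\not\subset D_j$). Their distributive constant with respect to $V$ is $$\Delta=\max_{\varnothing\ne\Gamma\subset\{1,\dots,q\}}\frac{\#\Gamma}{\dim V-\dim\bigl(\bigcap_{j\in\Gamma}D_j\cap V\bigr)},\qquad \dim\varnothing=-\infty$$ (so a $\Gamma$ with empty intersection contributes $0$). Let $f:\mathbb C\to V$ be a holomorphic map with reduced representation $\tilde f=(f_0,\dots,f_n)$, i.e. the $f_i$ are entire without common zeros and $f=[f_0:\dots:f_n]$. Say that $f$ is nondegenerate over $I_d(V)$ if there is no $[Q]\in I_d(V)\setminus\{0\}$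 with $Q(\tilde f)\equiv0$. Put $$T_f(r)=\int_0^{2\pi}\log\Bigl(\sum_{i=0}^n|f_i(re^{i\theta})|^2\Bigr)^{1/2}\frac{d\theta}{2\pi},$$ $$N_f^{[M]}(r,D_j)=\int_1^r\frac{n(t)-n(0)}{t}\,dt+n(0)\log r,\qquad n(t)=\sum_{|z|<t}\min\{M,\nu_j(z)\},\quad n(0)=\min\{M,\nu_j(0)\},$$ where $\nu_j(z)$ is the order of vanishing of $Q_j(\tilde f)$ at $z$. Theorem 1.1. Let $V\subset\mathbb P^n(\mathbb C)$ be a projective algebraic set and let $D_1,\dots,D_q$ be hypersurfaces as above, with distributive constant $\Delta$ with respect to $V$. Put $d=\operatorname{lcm}(\deg D_1,\dots,\deg D_q)$ and $M=H_V(d)-1$. Let $f:\mathbb C\to V$ be a holomorphic map that is nondegenerate over $I_d(V)$, with reduced representation $\tilde f$. Then for all $\varepsilon>0$ and $\delta>0$ there are a set $E$ of finite Lebesgue measure and a constant $C$ such that for all $r\in(0,\infty)\setminus E$ $$\bigl(q-\Delta(M+1+\varepsilon)\bigr)T_f(r)\le\sum_{j=1}^q\frac1{\deg D_j}N_f^{[M]}(r,D_j)+\Delta\,\delta\log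 r+C .$$ -/

import Mathlib

open scoped LinearAlgebra.Projectivization

noncomputable section

namespace Nevanlinna

/-- Complex projective space of dimension `n`. -/
abbrev PSpace (n : ℕ) : Type := ℙ ℂ (Fin (n + 1) → ℂ)

/-- The ring of polynomials in the homogeneous coordinates `x₀, …, xₙ`. -/
abbrev Poly (n : ℕ) : Type := MvPolynomial (Fin (n + 1)) ℂ

/-! ### Projective algebraic sets, their ideals, dimensions and Hilbert functions -/

/-- The zero set in projective space of a polynomial. It is used for homogeneous polynomials only,
whose vanishing at a point does not depend on the choice of homogeneous coordinates. -/
def zeroSet {n : ℕ} (P : Poly n) : Set (PSpace n) :=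
  {x | MvPolynomial.eval x.rep P = 0}

/-- `V` is a projective algebraic set: the set of common zeros of a family of homogeneous
polynomials. It need not be irreducible. -/
def IsProjectiveAlgebraic {n : ℕ} (V : Set (PSpace n)) : Prop :=
  ∃ S : Set (Poly n), (∀ P ∈ S, ∃ m : ℕ, P.IsHomogeneous m) ∧ V = ⋂ P ∈ S, zeroSet P

/-- The affine cone over `X`, without its vertex. -/
def cone {n : ℕ} (X : Set (PSpace n)) : Set (Fin (n + 1) → ℂ) :=
  {v | ∃ hv : v ≠ 0, Projectivization.mk ℂ v hv ∈ X}

/-- The homogeneous ideal `I(X)` of `X`: all polynomials that vanish on the cone over `X`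
(equivalently, all sums of homogeneous polynomials that vanish on `X`). For empty `X` it is the
unit ideal. -/
def idealOf {n : ℕ} (X : Set (PSpace n)) : Ideal (Poly n) :=
  MvPolynomial.vanishingIdeal ℂ (cone X)

/-- The dimension of a projective algebraic set: the Krull dimension of the homogeneous coordinate
ring `ℂ[x₀, …, xₙ] / I(X)` minus one. The dimension of the empty set is `-∞`, written `⊥`. -/
def projDim {n : ℕ} (X : Set (PSpace n)) : WithBot ℕ :=
  open Classical in
  if X = ∅ then ⊥ else
    (((ringKrullDim (Poly n ⧸ idealOf X)).unbotD 0).toNat - 1 : ℕ)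

/-- The subspace `I(V) ∩ H_d` of the space `H_d` of homogeneous polynomials of degree `d`. -/
def idealPart {n : ℕ} (V : Set (PSpace n)) (d : ℕ) :
    Submodule ℂ (MvPolynomial.homogeneousSubmodule (Fin (n + 1)) ℂ d) :=
  ((idealOf V).restrictScalars ℂ).submoduleOf
    (MvPolynomial.homogeneousSubmodule (Fin (n + 1)) ℂ d)

/-- The complex vector space `I_d(V) = H_d / (I(V) ∩ H_d)`. -/
abbrev IdSpace {n : ℕ} (V : Set (PSpace n)) (d : ℕ) : Type :=
  MvPolynomial.homogeneousSubmodule (Fin (n + 1)) ℂ d ⧸ idealPart V d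

/-- The Hilbert function `H_V(d) = dim I_d(V)`. -/
def hilbertFun {n : ℕ} (V : Set (PSpace n)) (d : ℕ) : ℕ :=
  Module.finrank ℂ (IdSpace V d)

/-! ### The distributive constant -/

/-- The quotient `#Γ / (dim V - dim ((⋂_{j ∈ Γ} D_j) ∩ V))`, where `D_j` is the zero set of `Q j`.
If the intersection is empty, its dimension is `-∞` and the quotient is `0`. -/
def distributiveRatio {n q : ℕ} (V : Set (PSpace n)) (Q : Fin q → Poly n)
    (Γ : Finset (Fin q)) : ℝ :=
  match projDim ((⋂ j ∈ Γ, zeroSet (Q j)) ∩ V) with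
  | ⊥ => 0
  | (m : ℕ) => (Γ.card : ℝ) / (((projDim V).unbotD 0 : ℕ) - (m : ℝ))

/-- The distributive constant of the hypersurfaces `D_j = {Q j = 0}` with respect to `V`: the
maximum of the above quotients over the nonempty sets of indices. -/
def distributiveConstant {n q : ℕ} (V : Set (PSpace n)) (Q : Fin q → Poly n) : ℝ :=
  ⨆ Γ : {Γ : Finset (Fin q) // Γ.Nonempty}, distributiveRatio V Q Γ.1

/-! ### Holomorphic curves and Nevanlinna functions -/

/-- `F = (f₀, …, fₙ)` is a reduced representation of `f : ℂ → ℙⁿ(ℂ)`: the `fᵢ` are entire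
functions without common zeros and `f = [f₀ : … : fₙ]`. -/
def IsReducedRepresentation {n : ℕ} (F : ℂ → Fin (n + 1) → ℂ) (f : ℂ → PSpace n) : Prop :=
  (∀ i, Differentiable ℂ fun z => F z i) ∧
    ∀ z, ∃ hz : F z ≠ 0, f z = Projectivization.mk ℂ (F z) hz

/-- The curve with reduced representation `F` is nondegenerate over `I_d(V)`: there is no nonzero
class `[P]` in `I_d(V)` with `P(F) ≡ 0`. -/
def NondegenerateOver {n : ℕ} (V : Set (PSpace n)) (d : ℕ) (F : ℂ → Fin (n + 1) → ℂ) : Prop :=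
  ¬ ∃ P : MvPolynomial.homogeneousSubmodule (Fin (n + 1)) ℂ d,
    (Submodule.Quotient.mk P : IdSpace V d) ≠ 0 ∧
      ∀ z, MvPolynomial.eval (F z) (P : Poly n) = 0

/-- The characteristic function: the mean of `log (|f₀|² + ⋯ + |fₙ|²)^{1/2}` over the circle
`|z| = r`, with respect to `dθ / 2π`. -/
def characteristic {n : ℕ} (F : ℂ → Fin (n + 1) → ℂ) (r : ℝ) : ℝ :=
  Real.circleAverage (fun z => Real.log (√(∑ i, ‖F z i‖ ^ 2))) 0 r

/-- `min {M, ν(z)}`, where `ν(z)` is the order of vanishing of `g` at `z`. -/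
def truncatedOrder (g : ℂ → ℂ) (M : ℕ) (z : ℂ) : ℕ :=
  (min (M : ℕ∞) (analyticOrderAt g z)).toNat

/-- The number of zeros of `g` in `|z| < t`, with multiplicities truncated to level `M`. -/
def truncatedCount (g : ℂ → ℂ) (M : ℕ) (t : ℝ) : ℝ :=
  ((∑ᶠ z ∈ Metric.ball (0 : ℂ) t, truncatedOrder g M z : ℕ) : ℝ)

/-- The integrated counting function
`∫₁ʳ (n(t) - n(0)) / t dt + n(0) log r` of the zeros of `g`, truncated to level `M`; here `n(0)` is
the truncated multiplicity of the zero at the origin. -/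
def truncatedCounting (g : ℂ → ℂ) (M : ℕ) (r : ℝ) : ℝ :=
  (∫ t in (1 : ℝ)..r, (truncatedCount g M t - truncatedOrder g M 0) / t) +
    truncatedOrder g M 0 * Real.log r

/-- The counting function `N_f^{[M]}(r, D)` of the curve with reduced representation `F`, for the
hypersurface `D = {Q = 0}`. -/
def countingFunction {n : ℕ} (F : ℂ → Fin (n + 1) → ℂ) (Q : Poly n) (M : ℕ) (r : ℝ) : ℝ :=
  truncatedCounting (fun z => MvPolynomial.eval (F z) Q) M r

end Nevanlinna

end

/-! The proof is Cartan's method, with a greedy choice of basis in place of general position.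
Evaluation along `F` sends forms of degree d to entire functions. Nondegeneracy and f(ℂ) ⊆ V make
its kernel exactly I(V) ∩ H_d (`ker_evalAlong`), so the image has dimension H_V(d) = M + 1. The
powers Q_j^(d / deg j) give members g_j of this image, bounded by a multiple Φ of the d-th power of
the norm of `F`.

The distributive constant enters through a rank inequality (`card_le_mul_finrank_span`): if the D_j
with j ∈ Γ have a common point on V, then #Γ is at most Δ times the rank of the g_j, j ∈ Γ. A
maximal independent subfamily B cuts out the same subset of V, because a linear relation among the
g_j is a relation among forms modulo I(V). Moreover #B hypersurfaces lower the dimension by at most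
#B, even for reducible V, by Krull's height theorem at the vertex of the cone
(`ringKrullDim_idealOf_le`). By compactness, the g_j that are small relative to Φ at a point do have
a common zero on V (`exists_pos_forall_nonempty`).

Given the rank inequality for all subsets of a set, the greedy algorithm
(`exists_linearIndepOn_sum_sub_le`) bounds the sum of nonnegative weights over the set by Δ times
the sum over some independent subset. It is used twice. With the weights log(Φ/|g_j|) it gives a
basis b whose contribution is (M + 1) log Φ - log|W| + log|W_b/∏ g_b| up to a constant, where W is
the Wronskian of a fixed basis and W_b that of b. With the weights max(ν_j - M, 0) at a point it
bounds the excess multiplicities by Δ times the order of W. After Jensen's formula the two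
contributions of W cancel and truncated counting functions remain (`exists_second_main_inequality`).

The term with W_b/∏ g_b is controlled by the lemma on the logarithmic derivative, derived from the
Poisson integral and Borel's growth lemma (`isSmallError_proximity_iteratedDeriv_logDeriv`). Since
the factor of log r has to be arbitrarily small, an error O(log r) would not suffice;
`zeroPoleCount_dichotomy` handles this. -/

noncomputable section

/-! ### Heights of maximal ideals in the coordinate ring of a cone -/

namespace Nevanlinna

attribute [local instance] MvPolynomial.gradedAlgebra

open MvPolynomial in
/-- Homogenizing with respect to a coordinate that is invertible modulo a prime. -/
lemma exists_isHomogeneous_map_eq {σ : Type*} {S : Type*} [CommRing S]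
    (φ : MvPolynomial σ ℂ →+* S) (i : σ) (c : ℂ) (hc : φ (C c * X i) = 1) (g : MvPolynomial σ ℂ) :
    ∃ g' : MvPolynomial σ ℂ, (∃ N, g'.IsHomogeneous N) ∧ φ g' = φ g := by
  refine ⟨∑ j ∈ Finset.range (g.totalDegree + 1),
    homogeneousComponent j g * (C c * X i) ^ (g.totalDegree - j), ⟨g.totalDegree, ?_⟩, ?_⟩
  · refine IsHomogeneous.sum _ _ _ fun j hj => ?_
    have h1 := (homogeneousComponent_isHomogeneous j g).mul
      (((isHomogeneous_C σ c).mul (isHomogeneous_X ℂ i)).pow (g.totalDegree - j))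
    have : j + (0 + 1) * (g.totalDegree - j) = g.totalDegree := by
      have := Finset.mem_range.1 hj
      omega
    rwa [this] at h1
  · conv_rhs => rw [← sum_homogeneousComponent g]
    simp only [map_sum, map_mul φ, map_pow φ]
    refine Finset.sum_congr rfl fun j _ => ?_
    rw [← map_mul φ, hc]
    simp

-- `S` is the coordinate ring of a subscheme of the cone lying in the hyperplane c·x_i = 1. Taking
-- the homogeneous core of the preimage of a prime of `S` is strictly monotone, since
-- dehomogenization recovers the prime from the homogeneous elements. So chains lift to chains of
-- homogeneous primes, and one more step leads to the vertex: the core lies in the ideal of the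
-- vertex but does not contain x_i.
open MvPolynomial in
lemma height_add_one_le_height_vertex {σ : Type*} (I : Ideal (MvPolynomial σ ℂ))
    (hI : I.IsHomogeneous (homogeneousSubmodule σ ℂ)) {S : Type*} [CommRing S]
    (φ : MvPolynomial σ ℂ →+* S) (hφs : Function.Surjective φ) (hIφ : I ≤ RingHom.ker φ)
    (i : σ) (c : ℂ) (hφ1 : φ (C c * X i) = 1) (q' : PrimeSpectrum S) :
    q'.asIdeal.height + 1 ≤
      ((vanishingIdeal ℂ {(0 : σ → ℂ)}).map (Ideal.Quotient.mk I)).height := by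
  classical
  set π := Ideal.Quotient.mk I with hπ
  set 𝒜 := homogeneousSubmodule σ ℂ
  let core : PrimeSpectrum S → Ideal (MvPolynomial σ ℂ) :=
    fun q => ((q.asIdeal.comap φ).homogeneousCore 𝒜).toIdeal
  have hcore_prime : ∀ q, (core q).IsPrime := fun q =>
    Ideal.IsPrime.homogeneousCore (Ideal.IsPrime.comap φ)
  have hIq : ∀ q : PrimeSpectrum S, I ≤ q.asIdeal.comap φ := by
    intro q x hx
    have : φ x = 0 := hIφ hx
    simp [Ideal.mem_comap, this]
  have hIcore : ∀ q, I ≤ core q := by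
    intro q
    have := Ideal.homogeneousCore_mono 𝒜 (hIq q)
    change (I.homogeneousCore 𝒜).toIdeal ≤ core q at this
    rwa [hI.toIdeal_homogeneousCore_eq_self] at this
  have hmapcomap : ∀ q, ((core q).map π).comap π = core q := by
    intro q
    rw [Ideal.comap_map_of_surjective' π Ideal.Quotient.mk_surjective, hπ, Ideal.mk_ker]
    exact sup_eq_left.2 (hIcore q)
  let f : PrimeSpectrum S → PrimeSpectrum (MvPolynomial σ ℂ ⧸ I) :=
    fun q => ⟨(core q).map π, by
      have := hcore_prime q
      exact Ideal.isPrime_map_quotientMk_of_isPrime (hIcore q)⟩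
  have hcore_mono : Monotone core := fun q₁ q₂ h =>
    Ideal.homogeneousCore_mono 𝒜 (Ideal.comap_mono h)
  have hf : StrictMono f := by
    intro q₁ q₂ hq
    refine lt_of_le_of_ne (Ideal.map_mono (hcore_mono hq.le)) fun heq => hq.not_ge ?_
    have hc : core q₁ = core q₂ := by
      rw [← hmapcomap q₁, ← hmapcomap q₂]
      exact congrArg (fun p : PrimeSpectrum (MvPolynomial σ ℂ ⧸ I) => p.asIdeal.comap π) heq
    intro x hx
    obtain ⟨g, rfl⟩ := hφs x
    obtain ⟨g', ⟨N, hN⟩, hg'⟩ := exists_isHomogeneous_map_eq φ i _ hφ1 g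
    have : g' ∈ core q₂ := Ideal.mem_homogeneousCore_of_homogeneous_of_mem ⟨N, hN⟩
      (by rw [Ideal.mem_comap, hg']; exact hx)
    rw [← hc] at this
    have := Ideal.toIdeal_homogeneousCore_le 𝒜 _ this
    rwa [Ideal.mem_comap, hg'] at this
  have h2 := Order.height_le_height_apply_of_strictMono f hf q'
  rw [← PrimeSpectrum.height_eq_orderHeight, ← PrimeSpectrum.height_eq_orderHeight] at h2
  set m := vanishingIdeal ℂ {(0 : σ → ℂ)} with hm
  -- A proper homogeneous ideal contains no nonzero constants, so all its elements have zero
  -- constant term.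
  have hcm : core q' ≤ m := by
    intro g hg
    rw [hm, mem_vanishingIdeal_singleton_iff]
    have h0 : homogeneousComponent 0 g ∈ core q' := by
      exact homogeneousComponent_mem_of_mem ((q'.asIdeal.comap φ).homogeneousCore 𝒜).isHomogeneous
        hg 0
    rw [homogeneousComponent_zero] at h0
    by_contra hne
    refine (hcore_prime q').ne_top (Ideal.eq_top_of_isUnit_mem _ h0 ?_)
    have hne' : coeff 0 g ≠ 0 := by
      intro h
      apply hne
      have : aeval (0 : σ → ℂ) g = constantCoeff g := by simp
      rw [this, constantCoeff_eq, h]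
    exact (isUnit_iff_ne_zero.2 hne').map C
  have hXm : (X i : MvPolynomial σ ℂ) ∈ m := by
    rw [hm, mem_vanishingIdeal_singleton_iff]; simp
  have hXc : (X i : MvPolynomial σ ℂ) ∉ core q' := by
    intro h
    have h3 := Ideal.toIdeal_homogeneousCore_le 𝒜 _ h
    rw [Ideal.mem_comap] at h3
    have h4 : (1 : S) ∈ q'.asIdeal := by
      rw [← hφ1, map_mul]; exact Ideal.mul_mem_left _ _ h3
    exact q'.isPrime.ne_top ((Ideal.eq_top_iff_one _).2 h4)
  have hmI : I ≤ m := (hIcore q').trans hcm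
  have hmp : m.IsPrime := by rw [hm]; infer_instance
  have hmapm : (m.map π).IsPrime := Ideal.isPrime_map_quotientMk_of_isPrime hmI
  have hlt : (f q').asIdeal < m.map π := by
    refine lt_of_le_of_ne (Ideal.map_mono hcm) fun heq => hXc ?_
    rw [← hmapcomap q']
    change X i ∈ ((f q').asIdeal).comap π
    rw [heq]
    exact Ideal.mem_map_of_mem π hXm
  have := (f q').isPrime
  calc q'.asIdeal.height + 1 ≤ (f q').asIdeal.height + 1 := by gcongr
    _ ≤ (m.map π).height := Ideal.height_add_one_le_of_lt_of_isPrime hlt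

open MvPolynomial in
/-- In the coordinate ring of a cone every maximal ideal has at most the height of the ideal of
the vertex. -/
lemma height_maximal_le_height_vertex {σ : Type*} [Finite σ] (I : Ideal (MvPolynomial σ ℂ))
    (hI : I.IsHomogeneous (homogeneousSubmodule σ ℂ)) (n : Ideal (MvPolynomial σ ℂ ⧸ I))
    [hn : n.IsMaximal] :
    n.height ≤ ((vanishingIdeal ℂ {(0 : σ → ℂ)}).map (Ideal.Quotient.mk I)).height := by
  have hnm : (n.comap (Ideal.Quotient.mk I)).IsMaximal :=
    Ideal.comap_isMaximal_of_surjective _ Ideal.Quotient.mk_surjective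
  obtain ⟨v, hv⟩ := isMaximal_iff_eq_vanishingIdeal_singleton.1 hnm
  have hmapn : (n.comap (Ideal.Quotient.mk I)).map (Ideal.Quotient.mk I) = n :=
    Ideal.map_comap_of_surjective _ Ideal.Quotient.mk_surjective n
  by_cases hv0 : v = 0
  · rw [← hv0, ← hv, hmapn]
  obtain ⟨i, hi⟩ : ∃ i, v i ≠ 0 := by
    by_contra h
    push Not at h
    exact hv0 (funext h)
  -- The hyperplane x_i = v_i passes through `v` and misses the vertex. Restricting to it lowers the
  -- height of `n` by at most one, and the step from the slice to the vertex makes up for that.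
  obtain ⟨r, hr⟩ : ∃ r, r = Ideal.Quotient.mk I (C (v i)⁻¹ * X i - 1) := ⟨_, rfl⟩
  have hrn : r ∈ n := by
    rw [hr]
    change C (v i)⁻¹ * X i - 1 ∈ n.comap (Ideal.Quotient.mk I)
    rw [hv, mem_vanishingIdeal_singleton_iff]
    simp [hi]
  have hp : (n.map (Ideal.Quotient.mk (Ideal.span {r}))).IsPrime :=
    Ideal.isPrime_map_quotientMk_of_isPrime (by simpa [Ideal.span_le] using hrn)
  refine (Ideal.height_le_height_add_one_of_mem hrn).trans ?_
  refine height_add_one_le_height_vertex I hI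
    ((Ideal.Quotient.mk (Ideal.span {r})).comp (Ideal.Quotient.mk I))
    (Ideal.Quotient.mk_surjective.comp Ideal.Quotient.mk_surjective) ?_ i (v i)⁻¹ ?_ ⟨_, hp⟩
  · intro x hx
    rw [RingHom.mem_ker, RingHom.comp_apply, Ideal.Quotient.eq_zero_iff_mem.2 hx, map_zero]
  · rw [← sub_eq_zero, ← map_one ((Ideal.Quotient.mk (Ideal.span {r})).comp (Ideal.Quotient.mk I)),
      ← map_sub, RingHom.comp_apply, ← hr, Ideal.Quotient.eq_zero_iff_mem]
    exact Ideal.mem_span_singleton_self r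

end Nevanlinna

end

/-! ### Dimensions of hypersurface sections and the distributive constant -/

noncomputable section

namespace Nevanlinna

attribute [local instance] MvPolynomial.gradedAlgebra

open MvPolynomial

/-- Primes of `T` pull back to primes over the kernel, which contain its radical and hence `J`. This
compares the ideal generated by equations with the full vanishing ideal of their zeros. -/
lemma ringKrullDim_le_of_le_radical_ker {R T : Type*} [CommRing R] [CommRing T] (φ : R →+* T)
    (hφ : Function.Surjective φ) (J : Ideal R) (hJ : J ≤ (RingHom.ker φ).radical) :
    ringKrullDim T ≤ ringKrullDim (R ⧸ J) := by
  rw [ringKrullDim_quotient]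
  let f : PrimeSpectrum T → PrimeSpectrum.zeroLocus (R := R) J := fun q =>
    ⟨PrimeSpectrum.comap φ q, by
      refine hJ.trans ?_
      refine (Ideal.radical_mono (J := q.asIdeal.comap φ) ?_).trans
        (Ideal.IsPrime.comap φ (hK := q.2)).radical.le
      intro x hx
      rw [Ideal.mem_comap, (RingHom.mem_ker).1 hx]
      exact zero_mem _⟩
  refine Order.krullDim_le_of_strictMono f fun q₁ q₂ h => ?_
  refine lt_of_le_of_ne (Ideal.comap_mono (f := φ) h.le) fun heq => h.ne ?_
  have : q₁.asIdeal.comap φ = q₂.asIdeal.comap φ := congrArg (fun p => p.1.asIdeal) heq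
  exact PrimeSpectrum.ext (Ideal.comap_injective_of_surjective φ hφ this)

lemma eval_smul_of_isHomogeneous {σ : Type*} {P : MvPolynomial σ ℂ} {m : ℕ}
    (hP : P.IsHomogeneous m) (c : ℂ) (v : σ → ℂ) : eval (c • v) P = c ^ m * eval v P := by
  rw [eval_eq, eval_eq, Finset.mul_sum]
  refine Finset.sum_congr rfl fun d hd => ?_
  have hdeg : ∑ i ∈ d.support, d i = m := by
    have := hP (mem_support_iff.1 hd)
    have h : d.degree = m := by
      rw [Finsupp.degree_eq_weight_one]; exact this
    exact h
  simp only [Pi.smul_apply, smul_eq_mul, mul_pow, Finset.prod_mul_distrib]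
  rw [Finset.prod_pow_eq_pow_sum, hdeg]
  ring

variable {n : ℕ}

lemma mk_mem_zeroSet {P : Poly n} {m : ℕ} (hP : P.IsHomogeneous m) {v : Fin (n + 1) → ℂ}
    (hv : v ≠ 0) : Projectivization.mk ℂ v hv ∈ zeroSet P ↔ eval v P = 0 := by
  obtain ⟨a, ha⟩ := Projectivization.exists_smul_eq_mk_rep ℂ v hv
  change eval (Projectivization.mk ℂ v hv).rep P = 0 ↔ _
  rw [← ha, Units.smul_def, eval_smul_of_isHomogeneous hP]
  simp

lemma mem_idealOf {X : Set (PSpace n)} {P : Poly n} :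
    P ∈ idealOf X ↔ ∀ (v : Fin (n + 1) → ℂ) (hv : v ≠ 0),
      Projectivization.mk ℂ v hv ∈ X → eval v P = 0 := by
  simp [idealOf, mem_vanishingIdeal_iff, cone, aeval_eq_eval]

lemma idealOf_anti {X Y : Set (PSpace n)} (h : X ⊆ Y) : idealOf Y ≤ idealOf X := by
  intro P hP
  rw [mem_idealOf] at *
  exact fun v hv hX => hP v hv (h hX)

/-- The values of the components at `v` are the coefficients of the one-variable polynomial c ↦
P(c·v), which has infinitely many roots. -/
lemma homogeneousComponent_eval_eq_zero {σ : Type*} {P : MvPolynomial σ ℂ} {v : σ → ℂ}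
    (h : ∀ c : ℂ, c ≠ 0 → eval (c • v) P = 0) (i : ℕ) :
    eval v (homogeneousComponent i P) = 0 := by
  set p : Polynomial ℂ := ∑ j ∈ Finset.range (P.totalDegree + 1),
    Polynomial.monomial j (eval v (homogeneousComponent j P)) with hp
  have hpe : ∀ c, p.eval c = eval (c • v) P := by
    intro c
    conv_rhs => rw [← sum_homogeneousComponent P]
    rw [hp, Polynomial.eval_finsetSum, map_sum]
    refine Finset.sum_congr rfl fun j _ => ?_
    rw [Polynomial.eval_monomial,
      eval_smul_of_isHomogeneous (homogeneousComponent_isHomogeneous j P), mul_comm]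
  have hp0 : p = 0 := by
    refine Polynomial.eq_zero_of_infinite_isRoot p (Set.Infinite.mono (s := {0}ᶜ) ?_ ?_)
    · intro c hc
      exact (hpe c).trans (h c hc)
    · exact (Set.finite_singleton _).infinite_compl
  by_cases hi : i ≤ P.totalDegree
  · have : p.coeff i = eval v (homogeneousComponent i P) := by
      rw [hp, Polynomial.finsetSum_coeff]
      simp only [Polynomial.coeff_monomial]
      rw [Finset.sum_ite_eq_of_mem']
      simpa using Nat.lt_succ_of_le hi
    rw [← this, hp0, Polynomial.coeff_zero]
  · rw [homogeneousComponent_eq_zero _ _ (by omega), map_zero]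

lemma mk_smul_mem {X : Set (PSpace n)} {v : Fin (n + 1) → ℂ} (hv : v ≠ 0)
    (hX : Projectivization.mk ℂ v hv ∈ X) {c : ℂ} (hc : c ≠ 0) :
    Projectivization.mk ℂ (c • v) (smul_ne_zero hc hv) ∈ X := by
  have : Projectivization.mk ℂ (c • v) (smul_ne_zero hc hv) = Projectivization.mk ℂ v hv := by
    rw [Projectivization.mk_eq_mk_iff']
    exact ⟨c, rfl⟩
  rwa [this]

lemma eval_homogeneousComponent_of_mem_idealOf {X : Set (PSpace n)} {P : Poly n}
    (hP : P ∈ idealOf X) (i : ℕ) {v : Fin (n + 1) → ℂ} (hv : v ≠ 0)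
    (hX : Projectivization.mk ℂ v hv ∈ X) : eval v (homogeneousComponent i P) = 0 :=
  homogeneousComponent_eval_eq_zero
    (fun _ hc => mem_idealOf.1 hP _ (smul_ne_zero hc hv) (mk_smul_mem hv hX hc)) i

lemma isHomogeneous_idealOf (X : Set (PSpace n)) :
    (idealOf X).IsHomogeneous (homogeneousSubmodule (Fin (n + 1)) ℂ) := by
  intro i P hP
  have : ((DirectSum.decompose (homogeneousSubmodule (Fin (n + 1)) ℂ) P) i : Poly n)
      = homogeneousComponent i P := decomposition.decompose'_apply P i
  rw [this, mem_idealOf]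
  exact fun v hv hX => eval_homogeneousComponent_of_mem_idealOf hP i hv hX

lemma eval_zero_of_mem_idealOf {X : Set (PSpace n)} (hX : X.Nonempty) {P : Poly n}
    (hP : P ∈ idealOf X) : eval 0 P = 0 := by
  obtain ⟨x, hx⟩ := hX
  have h1 := eval_homogeneousComponent_of_mem_idealOf hP 0 x.rep_nonzero (by rwa [x.mk_rep])
  rw [homogeneousComponent_zero, eval_C] at h1
  rw [← h1, ← constantCoeff_eq, ← eval_zero]

lemma IsProjectiveAlgebraic.mk_mem {V : Set (PSpace n)} (hV : IsProjectiveAlgebraic V)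
    {v : Fin (n + 1) → ℂ} (hv : v ≠ 0) (h : ∀ P ∈ idealOf V, eval v P = 0) :
    Projectivization.mk ℂ v hv ∈ V := by
  obtain ⟨S, hS, rfl⟩ := hV
  simp only [Set.mem_iInter]
  intro P hP
  obtain ⟨m, hm⟩ := hS P hP
  rw [mk_mem_zeroSet hm]
  refine h P (mem_idealOf.2 fun w hw hwV => ?_)
  rw [← mk_mem_zeroSet hm hw]
  exact Set.mem_iInter₂.1 hwV P hP

/-- The dimension of the coordinate ring of the cone is the height of the vertex, and every form of
positive degree vanishes there. So Krull's height theorem applies at this one prime, and no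
irreducibility of `V` is needed. The Nullstellensatz then passes to the vanishing ideal of the
section. -/
lemma ringKrullDim_idealOf_le {V : Set (PSpace n)} (hV : IsProjectiveAlgebraic V)
    {ι : Type*} (Γ : Finset ι) (Q : ι → Poly n) {deg : ι → ℕ} (hdeg : ∀ j ∈ Γ, 0 < deg j)
    (hQ : ∀ j ∈ Γ, (Q j).IsHomogeneous (deg j))
    (hne : ((⋂ j ∈ Γ, zeroSet (Q j)) ∩ V).Nonempty) :
    ringKrullDim (Poly n ⧸ idealOf V) ≤
      ringKrullDim (Poly n ⧸ idealOf ((⋂ j ∈ Γ, zeroSet (Q j)) ∩ V)) + Γ.card := by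
  classical
  have hVne : V.Nonempty := hne.mono Set.inter_subset_right
  set s : Set (Poly n ⧸ idealOf V) := (fun j => Ideal.Quotient.mk (idealOf V) (Q j)) '' Γ with hs
  set m := vanishingIdeal ℂ {(0 : Fin (n + 1) → ℂ)} with hm
  have hmp : m.IsPrime := by rw [hm]; infer_instance
  have hIm : idealOf V ≤ m := by
    intro P hP
    rw [hm, mem_vanishingIdeal_singleton_iff, aeval_eq_eval]
    exact eval_zero_of_mem_idealOf hVne hP
  have hmapm : (m.map (Ideal.Quotient.mk (idealOf V))).IsPrime :=
    Ideal.isPrime_map_quotientMk_of_isPrime hIm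
  have h1 : ringKrullDim (Poly n ⧸ idealOf V) ≤
      (m.map (Ideal.Quotient.mk (idealOf V))).height := by
    rw [ringKrullDim_le_iff_isMaximal_height_le]
    intro N hN
    exact_mod_cast height_maximal_le_height_vertex _ (isHomogeneous_idealOf V) N
  have hsm : s ⊆ m.map (Ideal.Quotient.mk (idealOf V)) := by
    rintro _ ⟨j, hj, rfl⟩
    refine Ideal.mem_map_of_mem _ ?_
    rw [hm, mem_vanishingIdeal_singleton_iff, aeval_eq_eval]
    have := eval_smul_of_isHomogeneous (hQ j hj) 0 0
    simpa [(hdeg j hj).ne'] using this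
  have h2 := Ideal.height_le_ringKrullDim_quotient_add_encard s hsm
  have h3 : s.encard ≤ Γ.card := by
    rw [hs]
    refine (Set.encard_image_le _ _).trans ?_
    simp
  have h4 : ringKrullDim ((Poly n ⧸ idealOf V) ⧸ Ideal.span s) ≤
      ringKrullDim (Poly n ⧸ idealOf ((⋂ j ∈ Γ, zeroSet (Q j)) ∩ V)) := by
    obtain ⟨φ, hφ⟩ : ∃ φ : Poly n →+* ((Poly n ⧸ idealOf V) ⧸ Ideal.span s),
      ∀ P, φ P = Ideal.Quotient.mk (Ideal.span s) (Ideal.Quotient.mk (idealOf V) P) :=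
      ⟨(Ideal.Quotient.mk (Ideal.span s)).comp (Ideal.Quotient.mk (idealOf V)), fun _ => rfl⟩
    have hφs : Function.Surjective φ := by
      intro y
      obtain ⟨x, rfl⟩ := Ideal.Quotient.mk_surjective y
      obtain ⟨P, rfl⟩ := Ideal.Quotient.mk_surjective x
      exact ⟨P, hφ P⟩
    refine ringKrullDim_le_of_le_radical_ker (R := Poly n)
      (T := (Poly n ⧸ idealOf V) ⧸ Ideal.span s) φ hφs _ ?_
    rw [← vanishingIdeal_zeroLocus_eq_radical (K := ℂ)]
    intro g hg
    rw [mem_vanishingIdeal_iff]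
    intro v hv
    rw [mem_zeroLocus_iff] at hv
    simp only [aeval_eq_eval] at hv ⊢
    -- The vertex is always an affine zero of the equations; polynomials in the ideal of the section
    -- vanish there because the section is nonempty.
    by_cases hv0 : v = 0
    · rw [hv0]; exact eval_zero_of_mem_idealOf hne hg
    refine mem_idealOf.1 hg v hv0 ⟨?_, ?_⟩
    · refine Set.mem_iInter₂.2 fun j hj => ?_
      rw [mk_mem_zeroSet (hQ j hj)]
      refine hv _ ?_
      rw [RingHom.mem_ker, hφ, Ideal.Quotient.eq_zero_iff_mem]
      exact Ideal.subset_span ⟨j, hj, rfl⟩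
    · refine hV.mk_mem hv0 fun P hP => hv P ?_
      rw [RingHom.mem_ker, hφ, Ideal.Quotient.eq_zero_iff_mem.2 hP, map_zero]
  refine h1.trans (h2.trans ?_)
  refine add_le_add h4 ?_
  exact_mod_cast h3

lemma ringKrullDim_ne_top_of_quotient (I : Ideal (Poly n)) : ringKrullDim (Poly n ⧸ I) ≠ ⊤ := by
  have h := ringKrullDim_quotient_le I
  rw [MvPolynomial.ringKrullDim_of_isNoetherianRing, ringKrullDim_eq_zero_of_field] at h
  refine (h.trans_lt ?_).ne
  rw [zero_add]
  exact WithBot.coe_lt_coe.2 (ENat.natCast_lt_top _)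

lemma toNat_unbotD_le_add {a b : WithBot ℕ∞} {c : ℕ} (hb : b ≠ ⊤) (h : a ≤ b + c) :
    (a.unbotD 0).toNat ≤ (b.unbotD 0).toNat + c := by
  induction a using WithBot.recBotCoe with
  | bot => simp
  | coe a =>
    induction b using WithBot.recBotCoe with
    | bot => simp at h
    | coe b =>
      have hb' : b ≠ ⊤ := fun h => hb (by rw [h]; rfl)
      lift b to ℕ using hb'
      have h' : a ≤ ((b + c : ℕ) : ℕ∞) := by
        push_cast
        exact_mod_cast h
      simp only [WithBot.unbotD_coe, ENat.toNat_natCast]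
      exact ENat.toNat_le_of_le_natCast h'

lemma projDim_eq {X : Set (PSpace n)} (hX : X.Nonempty) :
    projDim X = (((ringKrullDim (Poly n ⧸ idealOf X)).unbotD 0).toNat - 1 : ℕ) := by
  rw [projDim, if_neg hX.ne_empty]

lemma projDim_mono {X Y : Set (PSpace n)} (h : X ⊆ Y) : projDim X ≤ projDim Y := by
  rcases X.eq_empty_or_nonempty with rfl | hX
  · simp [projDim]
  rw [projDim_eq hX, projDim_eq (hX.mono h)]
  refine WithBot.coe_le_coe.2 (Nat.sub_le_sub_right ?_ 1)
  refine toNat_unbotD_le_add (c := 0) (ringKrullDim_ne_top_of_quotient _) ?_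
  rw [Nat.cast_zero, add_zero]
  exact ringKrullDim_le_of_surjective (Ideal.Quotient.factor (idealOf_anti h))
    (Ideal.Quotient.factor_surjective _)

lemma distributiveRatio_nonneg {q : ℕ} (V : Set (PSpace n)) (Q : Fin q → Poly n)
    (Γ : Finset (Fin q)) : 0 ≤ distributiveRatio V Q Γ := by
  unfold distributiveRatio
  have h := projDim_mono (Set.inter_subset_right : (⋂ j ∈ Γ, zeroSet (Q j)) ∩ V ⊆ V)
  split
  · exact le_rfl
  · rename_i m hm
    rw [hm] at h
    refine div_nonneg (Nat.cast_nonneg _) (sub_nonneg.2 (Nat.cast_le.2 ?_))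
    exact (WithBot.le_unbotD_iff (ne_bot_of_le_ne_bot WithBot.coe_ne_bot h)).2 h

lemma distributiveConstant_nonneg {q : ℕ} (V : Set (PSpace n)) (Q : Fin q → Poly n) :
    0 ≤ distributiveConstant V Q :=
  Real.iSup_nonneg fun Γ => distributiveRatio_nonneg V Q Γ.1

/-- If some of the hypersurfaces `D_j`, `j ∈ Γ`, have a common point on `V` and their intersection
with `V` is cut out by those with `j ∈ B`, then `#Γ ≤ Δ · #B`. -/
lemma card_le_distributiveConstant_mul {q : ℕ} {V : Set (PSpace n)}
    (hV : IsProjectiveAlgebraic V) {Q : Fin q → Poly n} {deg : Fin q → ℕ}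
    (hdeg : ∀ j, 0 < deg j) (hQ : ∀ j, (Q j).IsHomogeneous (deg j))
    (hVQ : ∀ j, projDim (zeroSet (Q j) ∩ V) < projDim V) (Γ B : Finset (Fin q))
    (hne : ((⋂ j ∈ Γ, zeroSet (Q j)) ∩ V).Nonempty)
    (hB : (⋂ j ∈ B, zeroSet (Q j)) ∩ V = (⋂ j ∈ Γ, zeroSet (Q j)) ∩ V) :
    (Γ.card : ℝ) ≤ distributiveConstant V Q * B.card := by
  rcases Γ.eq_empty_or_nonempty with rfl | hΓ
  · simpa using mul_nonneg (distributiveConstant_nonneg V Q) (Nat.cast_nonneg B.card)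
  have hV0 : V.Nonempty := hne.mono Set.inter_subset_right
  set X := (⋂ j ∈ Γ, zeroSet (Q j)) ∩ V with hX
  have h1 := ringKrullDim_idealOf_le hV B Q (fun j _ => hdeg j) (fun j _ => hQ j)
    (by rw [hB]; exact hne)
  rw [hB] at h1
  have h2 := toNat_unbotD_le_add (ringKrullDim_ne_top_of_quotient _) h1
  obtain ⟨j, hj⟩ := hΓ
  have h3 : projDim X < projDim V :=
    (projDim_mono (Set.inter_subset_inter_left _ (Set.biInter_subset_of_mem hj))).trans_lt (hVQ j)
  have h4 : distributiveRatio V Q Γ ≤ distributiveConstant V Q :=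
    le_ciSup (f := fun Γ : {Γ : Finset (Fin q) // Γ.Nonempty} => distributiveRatio V Q Γ.1)
      (Set.finite_range _).bddAbove ⟨Γ, ⟨j, hj⟩⟩
  obtain ⟨a, ha⟩ : ∃ a : ℕ, a = ((ringKrullDim (Poly n ⧸ idealOf V)).unbotD 0).toNat := ⟨_, rfl⟩
  obtain ⟨b, hb⟩ : ∃ b : ℕ, b = ((ringKrullDim (Poly n ⧸ idealOf X)).unbotD 0).toNat := ⟨_, rfl⟩
  have hpV : projDim V = ((a - 1 : ℕ) : WithBot ℕ) := by rw [projDim_eq hV0, ha]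
  have hpX : projDim X = ((b - 1 : ℕ) : WithBot ℕ) := by rw [projDim_eq hne, hb]
  rw [← ha, ← hb] at h2
  rw [hpV, hpX] at h3
  have h3' : b - 1 < a - 1 := by exact_mod_cast h3
  have h5 : distributiveRatio V Q Γ = (Γ.card : ℝ) / (((a - 1 : ℕ) : ℝ) - ((b - 1 : ℕ) : ℝ)) := by
    unfold distributiveRatio
    rw [← hX, hpX, hpV]
    rfl
  -- The denominator is positive because a single D_j already lowers the dimension.
  have h6 : (0 : ℝ) < ((a - 1 : ℕ) : ℝ) - ((b - 1 : ℕ) : ℝ) := by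
    rw [sub_pos]; exact_mod_cast h3'
  have h7 : ((a - 1 : ℕ) : ℝ) - ((b - 1 : ℕ) : ℝ) ≤ B.card := by
    rw [sub_le_iff_le_add']
    exact_mod_cast (by omega : a - 1 ≤ (b - 1) + B.card)
  rw [h5, div_le_iff₀ h6] at h4
  exact h4.trans (mul_le_mul_of_nonneg_left h7 (distributiveConstant_nonneg V Q))

end Nevanlinna

end

/-! ### The greedy choice of an independent subset -/

noncomputable section

namespace Nevanlinna

lemma finrank_span_image_eq_card {ι L : Type*} [AddCommGroup L] [Module ℂ L] {v : ι → L}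
    {B : Finset ι} (hB : LinearIndepOn ℂ v (B : Set ι)) :
    Module.finrank ℂ (Submodule.span ℂ (v '' B)) = B.card := by
  have h := finrank_span_eq_card (R := ℂ) (b := fun x : (B : Set ι) => v x) hB
  rw [Set.image_eq_range]
  simpa using h

/-- The greedy algorithm: a sum of weights is bounded by a multiple of the sum over an independent
subset, if the cardinalities are bounded by the same multiple of the ranks. -/
lemma exists_linearIndepOn_sum_sub_le {ι L : Type*} [AddCommGroup L] [Module ℂ L]
    (v : ι → L) (a : ι → ℝ) {Δ : ℝ} (S : Finset ι)
    (hS : ∀ Γ ⊆ S, (Γ.card : ℝ) ≤ Δ * Module.finrank ℂ (Submodule.span ℂ (v '' Γ))) :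
    ∀ t : ℝ, (∀ j ∈ S, t ≤ a j) → ∃ B ⊆ S, LinearIndepOn ℂ v (B : Set ι) ∧
      Submodule.span ℂ (v '' B) = Submodule.span ℂ (v '' S) ∧
      ∑ j ∈ S, (a j - t) ≤ Δ * ∑ j ∈ B, (a j - t) := by
  classical
  -- Elements are added in order of decreasing weight. The new element `j` has the least weight,
  -- which serves as the threshold in the induction hypothesis.
  induction S using Finset.induction_on_min_value a with
  | empty => exact fun t _ => ⟨∅, le_rfl, by simp, rfl, by simp⟩
  | insert j S hj hmin ih =>
    intro t ht
    obtain ⟨B, hBS, hBi, hBs, hsum⟩ := ih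
      (fun Γ hΓ => hS Γ (hΓ.trans (Finset.subset_insert j S))) (a j) hmin
    have hcard := hS S (Finset.subset_insert j S)
    rw [← hBs, finrank_span_image_eq_card hBi] at hcard
    have hkey : ∑ i ∈ insert j S, (a i - a j) ≤ Δ * ∑ i ∈ B, (a i - a j) := by
      rw [Finset.sum_insert hj]; simpa using hsum
    -- pass from the threshold `a j` to the threshold `t`
    have main : ∀ B' : Finset ι, LinearIndepOn ℂ v (B' : Set ι) →
        Submodule.span ℂ (v '' B') = Submodule.span ℂ (v '' (insert j S : Finset ι)) →
        ∑ i ∈ B', (a i - a j) = ∑ i ∈ B, (a i - a j) →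
        ∑ i ∈ insert j S, (a i - t) ≤ Δ * ∑ i ∈ B', (a i - t) := by
      intro B' hi hs he
      have hc := hS (insert j S) le_rfl
      rw [← hs, finrank_span_image_eq_card hi] at hc
      have e1 : ∑ i ∈ insert j S, (a i - t) =
          ∑ i ∈ insert j S, (a i - a j) + (insert j S).card * (a j - t) := by
        rw [← nsmul_eq_mul, ← Finset.sum_const, ← Finset.sum_add_distrib]
        exact Finset.sum_congr rfl fun i _ => by ring
      have e2 : ∑ i ∈ B', (a i - t) = ∑ i ∈ B', (a i - a j) + B'.card * (a j - t) := by
        rw [← nsmul_eq_mul, ← Finset.sum_const, ← Finset.sum_add_distrib]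
        exact Finset.sum_congr rfl fun i _ => by ring
      have h0 : 0 ≤ a j - t := sub_nonneg.2 (ht j (Finset.mem_insert_self j S))
      rw [e1, e2, he]
      nlinarith [mul_le_mul_of_nonneg_right hc h0]
    -- The vector of `j` joins the basis only if it enlarges the span. Either way it contributes
    -- nothing to the sums at threshold `a j`.
    by_cases hmem : v j ∈ Submodule.span ℂ (v '' (S : Set ι))
    · have hs : Submodule.span ℂ (v '' B) = Submodule.span ℂ (v '' (insert j S : Finset ι)) := by
        rw [hBs, Finset.coe_insert, Set.image_insert_eq, Submodule.span_insert_eq_span hmem]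
      exact ⟨B, hBS.trans (Finset.subset_insert j S), hBi, hs, main B hBi hs rfl⟩
    · have hjB : j ∉ B := fun h => hj (hBS h)
      have hi : LinearIndepOn ℂ v ((insert j B : Finset ι) : Set ι) := by
        rw [Finset.coe_insert]
        exact hBi.insert (by rw [hBs]; exact hmem)
      have hs : Submodule.span ℂ (v '' (insert j B : Finset ι)) =
          Submodule.span ℂ (v '' (insert j S : Finset ι)) := by
        rw [Finset.coe_insert, Finset.coe_insert, Set.image_insert_eq, Set.image_insert_eq,
          Submodule.span_insert, Submodule.span_insert, hBs]
      refine ⟨insert j B, Finset.insert_subset_insert j hBS, hi, hs, main _ hi hs ?_⟩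
      rw [Finset.sum_insert hjB, sub_self, zero_add]

lemma exists_linearIndepOn_sum_le {ι L : Type*} [AddCommGroup L] [Module ℂ L]
    (v : ι → L) (a : ι → ℝ) {Δ : ℝ} (S : Finset ι)
    (hS : ∀ Γ ⊆ S, (Γ.card : ℝ) ≤ Δ * Module.finrank ℂ (Submodule.span ℂ (v '' Γ)))
    (ha : ∀ j ∈ S, 0 ≤ a j) :
    ∃ B ⊆ S, LinearIndepOn ℂ v (B : Set ι) ∧ ∑ j ∈ S, a j ≤ Δ * ∑ j ∈ B, a j := by
  obtain ⟨B, h1, h2, -, h3⟩ := exists_linearIndepOn_sum_sub_le v a S hS 0 ha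
  exact ⟨B, h1, h2, by simpa using h3⟩

end Nevanlinna

end

/-! ### The logarithmic derivative of a zero-free function in a disc -/

noncomputable section

namespace Nevanlinna

open Complex Metric Set InnerProductSpace

lemma norm_circleAverage_le {f : ℂ → ℂ} {b : ℂ → ℝ} {c : ℂ} {R : ℝ}
    (hb : CircleIntegrable b c R) (h : ∀ z ∈ sphere c |R|, ‖f z‖ ≤ b z) :
    ‖Real.circleAverage f c R‖ ≤ Real.circleAverage b c R := by
  rw [Real.circleAverage_def, Real.circleAverage_def, norm_smul, smul_eq_mul, Real.norm_eq_abs,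
    abs_of_pos (inv_pos.2 Real.two_pi_pos)]
  refine mul_le_mul_of_nonneg_left ?_ (inv_pos.2 Real.two_pi_pos).le
  exact intervalIntegral.norm_integral_le_of_norm_le Real.two_pi_pos.le
    (Filter.Eventually.of_forall fun θ _ => h _ (circleMap_mem_sphere' c R θ)) hb

/-- The integral of a function on a circle against the Herglotz-Riesz kernel. -/
def herglotz (u : ℂ → ℝ) (R : ℝ) (w : ℂ) : ℂ :=
  Real.circleAverage (fun ζ => herglotzRieszKernel 0 w ζ • (u ζ : ℂ)) 0 R

lemma _root_.CircleIntegrable.complex_ofReal {u : ℂ → ℝ} {R : ℝ} (hu : CircleIntegrable u 0 R) :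
    CircleIntegrable (fun ζ => (u ζ : ℂ)) 0 R := by
  unfold CircleIntegrable at *
  rw [intervalIntegrable_iff] at *
  exact hu.ofReal

lemma hasDerivAt_herglotz {u : ℂ → ℝ} {R : ℝ} {w : ℂ} (hu : CircleIntegrable u 0 R)
    (hw : w ∈ ball 0 R) : HasDerivAt (herglotz u R)
      (Real.circleAverage (fun ζ => (2 * ζ / (ζ - w) ^ 2) • (u ζ : ℂ)) 0 R) w :=
  hasDerivAt_circleAverage_herglotzRieszKernel_smul hu.complex_ofReal hw

lemma herglotz_zero {u : ℂ → ℝ} {R : ℝ} (hR : 0 < R) (hu : CircleIntegrable u 0 R) :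
    (herglotz u R 0).re = Real.circleAverage u 0 R := by
  rw [herglotz, re_circleAverage_herglotzRieszKernel_smul hu (mem_ball_self hR)]
  refine Real.circleAverage_congr_sphere fun z hz => ?_
  have hz0 : z ≠ 0 := by
    rintro rfl
    simp [abs_of_pos hR, hR.ne] at hz
  simp [herglotzRieszKernel_def, hz0]

lemma re_herglotz_log_norm {g : ℂ → ℂ} {R : ℝ} (hg : AnalyticOnNhd ℂ g (closedBall 0 R))
    (hg0 : ∀ z ∈ closedBall 0 R, g z ≠ 0) {w : ℂ} (hw : w ∈ ball 0 R) :
    (herglotz (fun ζ => Real.log ‖g ζ‖) R w).re = Real.log ‖g w‖ := by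
  have hR : 0 < R := pos_of_mem_ball hw
  have hh : HarmonicOnNhd (fun ζ => Real.log ‖g ζ‖) (closedBall 0 R) :=
    fun z hz => (hg z hz).harmonicAt_log_norm (hg0 z hz)
  have hu : CircleIntegrable (fun ζ => Real.log ‖g ζ‖) 0 R := by
    refine ContinuousOn.circleIntegrable hR.le fun z hz => ?_
    have hz' := sphere_subset_closedBall hz
    exact ((hg z hz').continuousAt.norm.log (norm_ne_zero_iff.2 (hg0 z hz'))).continuousWithinAt
  rw [herglotz, re_circleAverage_herglotzRieszKernel_smul hu hw]
  exact HarmonicOnNhd.circleAverage_re_herglotzRieszKernel_smul hh hw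

/-- By Poisson's formula the Herglotz integral Φ of log|g| has real part log|g|. So g·exp(-Φ) has
modulus one, is constant by the maximum principle, and differentiation gives g'/g = Φ'. -/
lemma logDeriv_eq_deriv_herglotz {g : ℂ → ℂ} {R : ℝ} (hg : AnalyticOnNhd ℂ g (closedBall 0 R))
    (hg0 : ∀ z ∈ closedBall 0 R, g z ≠ 0) {w : ℂ} (hw : w ∈ ball 0 R) :
    logDeriv g w = deriv (herglotz (fun ζ => Real.log ‖g ζ‖) R) w := by
  have hR : 0 < R := pos_of_mem_ball hw
  set u : ℂ → ℝ := fun ζ => Real.log ‖g ζ‖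
  set Φ := herglotz u R with hΦ
  have hu : CircleIntegrable u 0 R := by
    refine ContinuousOn.circleIntegrable hR.le fun z hz => ?_
    have hz' := sphere_subset_closedBall hz
    exact ((hg z hz').continuousAt.norm.log (norm_ne_zero_iff.2 (hg0 z hz'))).continuousWithinAt
  have hΦd : ∀ z ∈ ball (0 : ℂ) R, DifferentiableAt ℂ Φ z :=
    fun z hz => (hasDerivAt_herglotz hu hz).differentiableAt
  have hgd : ∀ z ∈ ball (0 : ℂ) R, DifferentiableAt ℂ g z :=
    fun z hz => (hg z (ball_subset_closedBall hz)).differentiableAt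
  have hnorm : ∀ z ∈ ball (0 : ℂ) R, ‖g z * exp (-Φ z)‖ = 1 := by
    intro z hz
    have h0 := norm_pos_iff.2 (hg0 z (ball_subset_closedBall hz))
    rw [norm_mul, norm_exp, neg_re, hΦ, re_herglotz_log_norm hg hg0 hz, Real.exp_neg,
      Real.exp_log h0, mul_inv_cancel₀ h0.ne']
  have hconst : EqOn (fun z => g z * exp (-Φ z)) (Function.const ℂ (g w * exp (-Φ w))) (ball 0 R) := by
    refine eqOn_of_isPreconnected_of_isMaxOn_norm (f := fun z => g z * exp (-Φ z))
      (convex_ball _ _).isPreconnected isOpen_ball (fun z hz => ?_) hw fun z hz => ?_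
    · exact ((hgd z hz).mul (hΦd z hz).neg.cexp).differentiableWithinAt
    · change ‖g z * exp (-Φ z)‖ ≤ ‖g w * exp (-Φ w)‖
      rw [hnorm z hz, hnorm w hw]
  have hev : (fun z => g z * exp (-Φ z)) =ᶠ[nhds w] fun _ => g w * exp (-Φ w) :=
    Filter.eventually_of_mem (isOpen_ball.mem_nhds hw) hconst
  have h1 := hev.deriv_eq
  have h2 : HasDerivAt (fun z => g z * exp (-Φ z))
      (deriv g w * exp (-Φ w) + g w * (exp (-Φ w) * (-deriv Φ w))) w :=
    (hgd w hw).hasDerivAt.mul (hΦd w hw).hasDerivAt.neg.cexp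
  rw [h2.deriv, deriv_const] at h1
  have h3 : exp (-Φ w) * (deriv g w - g w * deriv Φ w) = 0 := by linear_combination h1
  have h4 := (mul_eq_zero.1 h3).resolve_left (exp_ne_zero _)
  rw [logDeriv_apply, div_eq_iff (hg0 w (ball_subset_closedBall hw)), sub_eq_zero.1 h4, mul_comm]

/-- Both sides equal the real part of the Herglotz integral at the centre, by the mean value
property. -/
lemma circleAverage_re_herglotz {u : ℂ → ℝ} {r R : ℝ} (hr : 0 < r) (hrR : r < R)
    (hu : CircleIntegrable u 0 R) :
    Real.circleAverage (fun w => (herglotz u R w).re) 0 r = Real.circleAverage u 0 R := by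
  have hsub : closedBall (0 : ℂ) |r| ⊆ ball 0 R := by
    rw [abs_of_pos hr]
    exact closedBall_subset_ball hrR
  have hΨd : DifferentiableOn ℂ (herglotz u R) (closedBall 0 |r|) :=
    fun z hz => (hasDerivAt_herglotz hu (hsub hz)).differentiableAt.differentiableWithinAt
  have hΨI : CircleIntegrable (herglotz u R) 0 r :=
    ContinuousOn.circleIntegrable' (hΨd.continuousOn.mono sphere_subset_closedBall)
  have h1 : Real.circleAverage (fun w => (herglotz u R w).re) 0 r =
      (Real.circleAverage (herglotz u R) 0 r).re := reCLM.circleAverage_comp_comm hΨI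
  have h2 : Real.circleAverage (herglotz u R) 0 r = herglotz u R 0 :=
    circleAverage_of_differentiable_on_off_countable (s := ∅) Set.countable_empty hΨd.continuousOn
      fun z hz => (hasDerivAt_herglotz hu (hsub (ball_subset_closedBall hz.1))).differentiableAt
  rw [h1, h2, herglotz_zero (hr.trans hrR) hu]

/-- A mean value bound for the derivatives of the logarithmic derivative of a function without
zeros in a disc. -/
lemma exists_bound_iteratedDeriv_logDeriv {g : ℂ → ℂ} {r R : ℝ} (hr : 0 < r) (hrR : r < R)
    (hg : AnalyticOnNhd ℂ g (closedBall 0 R)) (hg0 : ∀ z ∈ closedBall 0 R, g z ≠ 0) :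
    ∃ J : ℂ → ℝ, CircleIntegrable J 0 r ∧
      Real.circleAverage J 0 r = Real.circleAverage (fun z => |Real.log ‖g z‖|) 0 R ∧
      (∀ w ∈ sphere (0 : ℂ) r, 0 ≤ J w) ∧
      ∀ i : ℕ, ∀ w ∈ sphere (0 : ℂ) r, ‖iteratedDeriv i (logDeriv g) w‖ ≤
        i.factorial * (8 / (R - r) * J w) / ((R - r) / 2) ^ i := by
  have hR : 0 < R := hr.trans hrR
  set u : ℂ → ℝ := fun ζ => Real.log ‖g ζ‖ with hudef
  have hucont : ContinuousOn u (sphere 0 R) := fun z hz => by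
    have hz' := sphere_subset_closedBall hz
    exact ((hg z hz').continuousAt.norm.log (norm_ne_zero_iff.2 (hg0 z hz'))).continuousWithinAt
  have hu : CircleIntegrable u 0 R := hucont.circleIntegrable hR.le
  have hua : CircleIntegrable (fun z => |u z|) 0 R := hucont.abs.circleIntegrable hR.le
  have hsub : ∀ w ∈ sphere (0 : ℂ) r, w ∈ ball (0 : ℂ) R := fun w hw => by
    rw [mem_sphere_zero_iff_norm] at hw
    rw [mem_ball_zero_iff, hw]; exact hrR
  -- The majorant is the Poisson integral of |log|g||, whose mean over the smaller circle is known
  -- exactly.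
  set Ψ := herglotz (fun z => |u z|) R with hΨ
  have hΨd : ∀ z ∈ ball (0 : ℂ) R, DifferentiableAt ℂ Ψ z :=
    fun z hz => (hasDerivAt_herglotz hua hz).differentiableAt
  have hΨc : ContinuousOn Ψ (sphere 0 r) := fun z hz =>
    (hΨd z (hsub z hz)).continuousAt.continuousWithinAt
  have hre : ∀ w ∈ sphere (0 : ℂ) r, (Ψ w).re =
      Real.circleAverage (fun ζ => (R ^ 2 - r ^ 2) / ‖ζ - w‖ ^ 2 * |u ζ|) 0 R := by
    intro w hw
    rw [hΨ, herglotz, re_circleAverage_herglotzRieszKernel_smul hua (hsub w hw),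
      ← poissonKernel_eq_re_herglotzRieszKernel]
    refine Real.circleAverage_congr_sphere fun ζ hζ => ?_
    rw [abs_of_pos hR, mem_sphere_zero_iff_norm] at hζ
    rw [mem_sphere_zero_iff_norm] at hw
    simp [poissonKernel_def, hζ, hw]
  refine ⟨fun w => (Ψ w).re, ?_, ?_, ?_, ?_⟩
  · exact (continuous_re.comp_continuousOn hΨc).circleIntegrable hr.le
  · exact circleAverage_re_herglotz hr hrR hua
  · intro w hw
    change 0 ≤ (Ψ w).re
    rw [hre w hw]
    refine Real.circleAverage_nonneg_of_nonneg fun ζ _ => ?_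
    have : 0 ≤ R ^ 2 - r ^ 2 := by nlinarith
    positivity
  · intro i w hw
    -- Cauchy's estimate is used on the circle of radius `s` about `w`. There |ζ - z| ≥ |ζ - w|/2,
    -- so the derivative of the Herglotz kernel at `z` is at most 8/(R - r) times the Poisson kernel
    -- at `w`.
    set s := (R - r) / 2 with hs
    have hs0 : 0 < s := by rw [hs]; linarith
    have hwn : ‖w‖ = r := by simpa using hw
    have hsubs : closedBall w s ⊆ ball 0 R := by
      intro z hz
      rw [mem_closedBall, dist_eq_norm] at hz
      rw [mem_ball_zero_iff]
      calc ‖z‖ = ‖(z - w) + w‖ := by ring_nf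
        _ ≤ ‖z - w‖ + ‖w‖ := norm_add_le _ _
        _ < R := by rw [hwn]; linarith
    refine norm_iteratedDeriv_le_of_forall_mem_sphere_norm_le i hs0 ?_ ?_
    · refine DifferentiableOn.diffContOnCl ?_
      rw [closure_ball _ hs0.ne']
      intro z hz
      have hz' := ball_subset_closedBall (hsubs hz)
      have ha := hg z hz'
      exact (ha.deriv.div ha (hg0 z hz')).differentiableAt.differentiableWithinAt
    · intro z hz
      have hzR := hsubs (sphere_subset_closedBall hz)
      rw [logDeriv_eq_deriv_herglotz hg hg0 hzR, (hasDerivAt_herglotz hu hzR).deriv]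
      have hr2 : 0 < R ^ 2 - r ^ 2 := by nlinarith
      have hζw : ∀ ζ ∈ sphere (0 : ℂ) R, R - r ≤ ‖ζ - w‖ := by
        intro ζ hζ
        have h1 := norm_sub_norm_le ζ w
        rw [mem_sphere_zero_iff_norm] at hζ
        rw [hζ, hwn] at h1
        exact h1
      have hcontb : ContinuousOn (fun ζ => (R ^ 2 - r ^ 2) / ‖ζ - w‖ ^ 2 * |u ζ|) (sphere 0 R) := by
        refine ContinuousOn.mul (ContinuousOn.div (by fun_prop) (by fun_prop) fun ζ hζ => ?_)
          hucont.abs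
        have := hζw ζ hζ
        have : 0 < ‖ζ - w‖ := by linarith
        positivity
      have hb : CircleIntegrable
          (fun ζ => (8 / (R - r)) • ((R ^ 2 - r ^ 2) / ‖ζ - w‖ ^ 2 * |u ζ|)) 0 R :=
        (hcontb.const_smul (8 / (R - r))).circleIntegrable hR.le
      refine (norm_circleAverage_le hb ?_).trans_eq ?_
      · intro ζ hζ
        rw [abs_of_pos hR] at hζ
        have h1 := hζw ζ hζ
        have hζn : ‖ζ‖ = R := by simpa using hζ
        have h2 : ‖ζ - w‖ / 2 ≤ ‖ζ - z‖ := by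
          have h3 : ‖ζ - w‖ ≤ ‖ζ - z‖ + ‖z - w‖ := norm_sub_le_norm_sub_add_norm_sub _ _ _
          have h4 : ‖z - w‖ = s := by simpa [dist_eq_norm] using hz
          rw [h4] at h3
          linarith
        have h5 : 0 < ‖ζ - w‖ := by linarith
        have h6 : 0 < ‖ζ - z‖ := by linarith
        rw [norm_smul, norm_div, norm_mul, norm_pow, hζn, norm_real, Real.norm_eq_abs,
          RCLike.norm_ofNat, smul_eq_mul, ← mul_assoc]
        refine mul_le_mul_of_nonneg_right ?_ (abs_nonneg _)
        have h7 : 2 * R / ‖ζ - z‖ ^ 2 ≤ 2 * R / (‖ζ - w‖ / 2) ^ 2 := by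
          gcongr
        refine h7.trans ?_
        have h8 : (0 : ℝ) < R - r := by linarith
        have e : 8 / (R - r) * ((R ^ 2 - r ^ 2) / ‖ζ - w‖ ^ 2) = 8 * (R + r) / ‖ζ - w‖ ^ 2 := by
          field_simp
          ring
        have e' : 2 * R / (‖ζ - w‖ / 2) ^ 2 = 8 * R / ‖ζ - w‖ ^ 2 := by
          field_simp
          ring
        rw [e, e']
        gcongr
        linarith
      · rw [Real.circleAverage_fun_smul, ← hre w hw, smul_eq_mul]

end Nevanlinna

end

/-! ### The contribution of zeros and poles to the logarithmic derivative -/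

noncomputable section

namespace Nevanlinna

open Complex Metric Set Filter Topology MeasureTheory

lemma intervalIntegrable_inv_sqrt_abs_sin (a b : ℝ) :
    IntervalIntegrable (fun x => (√|Real.sin x|)⁻¹) volume a b := by
  have hper : Function.Periodic (fun x => (√|Real.sin x|)⁻¹) Real.pi := fun x => by
    simp [Real.sin_add_pi]
  refine hper.intervalIntegrable Real.pi_ne_zero (t := -(Real.pi / 2)) ?_ a b
  have hpi := Real.pi_pos
  have e : -(Real.pi / 2) + Real.pi = Real.pi / 2 := by ring
  rw [e]
  have h1 : IntervalIntegrable (fun x : ℝ => x ^ (-(1 / 2) : ℝ)) volume (-(Real.pi / 2))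
      (Real.pi / 2) := intervalIntegral.intervalIntegrable_rpow' (by norm_num)
  have h2 : IntervalIntegrable (fun x : ℝ => (-x) ^ (-(1 / 2) : ℝ)) volume (-(Real.pi / 2))
      (Real.pi / 2) := by
    have := (intervalIntegral.intervalIntegrable_rpow' (a := Real.pi / 2) (b := -(Real.pi / 2))
      (r := -(1 / 2)) (by norm_num)).comp_sub_left 0
    simpa using this
  have h3 := ((h1.abs.add h2.abs).const_mul (√(2 / Real.pi))⁻¹)
  refine h3.mono_fun (Measurable.aestronglyMeasurable (by fun_prop)) ?_
  rw [EventuallyLE, ae_restrict_iff' measurableSet_uIoc]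
  refine Eventually.of_forall fun x hx => ?_
  rw [uIoc_of_le (by linarith)] at hx
  have habs : |x| ≤ Real.pi / 2 := abs_le.2 ⟨hx.1.le, hx.2⟩
  have hs := Real.mul_abs_le_abs_sin habs
  rw [Real.norm_of_nonneg (by positivity), Real.norm_of_nonneg (by positivity)]
  rcases eq_or_ne x 0 with rfl | hx0
  · simp only [Real.sin_zero, abs_zero, Real.sqrt_zero, inv_zero]; positivity
  have hxp : 0 < |x| := abs_pos.2 hx0
  calc (√|Real.sin x|)⁻¹ ≤ (√(2 / Real.pi * |x|))⁻¹ :=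
        inv_anti₀ (by positivity) (Real.sqrt_le_sqrt hs)
    _ = (√(2 / Real.pi))⁻¹ * |x| ^ (-(1 / 2) : ℝ) := by
        rw [Real.sqrt_mul (by positivity), mul_inv, Real.rpow_neg hxp.le,
          ← Real.sqrt_eq_rpow]
    _ ≤ _ := by
        refine mul_le_mul_of_nonneg_left ?_ (by positivity)
        rcases le_total 0 x with h | h
        · rw [abs_of_nonneg h]
          exact (le_abs_self _).trans (le_add_of_nonneg_right (abs_nonneg _))
        · rw [abs_of_nonpos h]
          exact (le_abs_self _).trans (le_add_of_nonneg_left (abs_nonneg _))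

/-- A bound for the means of `|z - a|^{-1/2}` over circles of radius at least one. -/
def kernelBound : ℝ := (2 * Real.pi)⁻¹ * ∫ x in (0 : ℝ)..(2 * Real.pi), (√|Real.sin x|)⁻¹

lemma kernelBound_nonneg : 0 ≤ kernelBound :=
  mul_nonneg (by positivity) (intervalIntegral.integral_nonneg (by positivity)
    fun x _ => by positivity)

/-- The distance to `a` is at least the distance to the line through 0 and `a`, which is r|sin(θ -
arg a)|. This makes the kernel bound uniform in `a` and `r`. -/
lemma abs_sin_le_norm_circleMap_sub {r : ℝ} (hr : 1 ≤ r) (a : ℂ) (θ : ℝ) :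
    |Real.sin (θ - a.arg)| ≤ ‖circleMap 0 r θ - a‖ := by
  have h1 : circleMap 0 r θ - a = exp (a.arg * I) * (r * exp ((θ - a.arg : ℝ) * I) - ‖a‖) := by
    rw [circleMap_zero, mul_sub, mul_left_comm, ← Complex.exp_add, mul_comm (exp _) (‖a‖ : ℂ),
      Complex.norm_mul_exp_arg_mul_I]
    congr 3
    push_cast; ring_nf
  have h2 : ‖circleMap 0 r θ - a‖ = ‖(r * exp ((θ - a.arg : ℝ) * I) - ‖a‖ : ℂ)‖ := by
    rw [h1, norm_mul, Complex.norm_exp_ofReal_mul_I, one_mul]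
  rw [h2]
  refine le_trans ?_ (Complex.abs_im_le_norm _)
  rw [Complex.sub_im, Complex.im_ofReal_mul,
    Complex.exp_ofReal_mul_I_im, Complex.ofReal_im, sub_zero, abs_mul]
  exact le_mul_of_one_le_left (abs_nonneg _) (hr.trans (le_abs_self r))

/-- Zeros of the sine are excluded, because there the convention `0⁻¹ = 0` makes the right side
vanish. -/
lemma inv_sqrt_norm_circleMap_sub_ae_le {r : ℝ} (hr : 1 ≤ r) (a : ℂ) :
    ∀ᵐ θ : ℝ, (√‖circleMap 0 r θ - a‖)⁻¹ ≤ (√|Real.sin (θ - a.arg)|)⁻¹ := by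
  have hc : (Set.range fun n : ℤ => (n : ℝ) * Real.pi + a.arg).Countable := countable_range _
  filter_upwards [hc.ae_notMem volume] with θ hθ
  have hs : Real.sin (θ - a.arg) ≠ 0 := fun h => by
    obtain ⟨n, hn⟩ := Real.sin_eq_zero_iff.1 h
    exact hθ ⟨n, by simp [hn]⟩
  exact inv_anti₀ (Real.sqrt_pos.2 (abs_pos.2 hs))
    (Real.sqrt_le_sqrt (abs_sin_le_norm_circleMap_sub hr a θ))

lemma circleIntegrable_inv_sqrt_norm_sub {r : ℝ} (hr : 1 ≤ r) (a : ℂ) :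
    CircleIntegrable (fun z => (√‖z - a‖)⁻¹) 0 r := by
  have h := (intervalIntegrable_inv_sqrt_abs_sin (0 - a.arg) (2 * Real.pi - a.arg)).comp_sub_right
    a.arg
  simp only [sub_add_cancel] at h
  refine h.mono_fun (Measurable.aestronglyMeasurable (by fun_prop)) ?_
  refine ae_restrict_of_ae ?_
  filter_upwards [inv_sqrt_norm_circleMap_sub_ae_le hr a] with θ hθ
  rwa [Real.norm_of_nonneg (by positivity), Real.norm_of_nonneg (by positivity)]

lemma circleAverage_inv_sqrt_norm_sub_le {r : ℝ} (hr : 1 ≤ r) (a : ℂ) :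
    Real.circleAverage (fun z => (√‖z - a‖)⁻¹) 0 r ≤ kernelBound := by
  rw [Real.circleAverage_def, smul_eq_mul, kernelBound]
  refine mul_le_mul_of_nonneg_left ?_ (by positivity)
  have h := (intervalIntegrable_inv_sqrt_abs_sin (0 - a.arg) (2 * Real.pi - a.arg)).comp_sub_right
    a.arg
  simp only [sub_add_cancel] at h
  refine (intervalIntegral.integral_mono_ae (by positivity)
    (circleIntegrable_inv_sqrt_norm_sub hr a) h (inv_sqrt_norm_circleMap_sub_ae_le hr a)).trans
    (le_of_eq ?_)
  have hper : Function.Periodic (fun x => (√|Real.sin x|)⁻¹) (2 * Real.pi) := fun x => by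
    simp [Real.sin_add_two_pi]
  rw [intervalIntegral.integral_comp_sub_right (fun x => (√|Real.sin x|)⁻¹) a.arg]
  have := hper.intervalIntegral_add_eq (0 - a.arg) 0
  rw [zero_add] at this
  rw [← this]
  congr 1; ring

lemma iteratedDeriv_inv_sub (i : ℕ) (a z : ℂ) :
    iteratedDeriv i (fun w => (w - a)⁻¹) z = (-1) ^ i * i.factorial / (z - a) ^ (i + 1) := by
  have := iteratedDeriv_comp_sub_const (n := i) (f := fun w : ℂ => w⁻¹) a
  rw [show (fun w : ℂ => (w - a)⁻¹) = fun w => (fun w : ℂ => w⁻¹) (w - a) from rfl, this]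
  simp only [iteratedDeriv_eq_iterate]
  rw [iter_deriv_inv]
  rw [div_eq_mul_inv, ← zpow_natCast (z - a), ← zpow_neg]
  congr 2
  push_cast; ring

/-- Near almost every point of the disc, the derivatives of the logarithmic derivative of a
function factored by its zeros and poles. -/
lemma iteratedDeriv_logDeriv_codiscrete {f g : ℂ → ℂ} {R : ℝ} {D : ℂ → ℤ} {s : Finset ℂ}
    (hs : ∀ u, u ∉ s → D u = 0)
    (hg : AnalyticOnNhd ℂ g (closedBall 0 R)) (hg0 : ∀ z ∈ closedBall 0 R, g z ≠ 0)
    (hfg : f =ᶠ[codiscreteWithin (closedBall 0 R)] (∏ᶠ u, (· - u) ^ D u) • g) (i : ℕ) {r : ℝ}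
    (hr : 0 ≤ r) (hrR : r < R) :
    iteratedDeriv i (logDeriv f) =ᶠ[codiscreteWithin (sphere 0 |r|)] fun z =>
      (∑ u ∈ s, (D u : ℂ) * ((-1) ^ i * i.factorial / (z - u) ^ (i + 1))) +
        iteratedDeriv i (logDeriv g) z := by
  have hprod : (∏ᶠ u, ((· - u) ^ D u : ℂ → ℂ)) = fun z => ∏ u ∈ s, (z - u) ^ D u := by
    rw [finprod_eq_prod_of_mulSupport_subset (s := s)]
    · ext z; simp
    · intro u hu
      by_contra hus
      simp [hs u hus] at hu
  rw [hprod] at hfg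
  rw [EventuallyEq, Filter.Eventually, mem_codiscreteWithin_iff_forall_mem_nhdsNE]
  intro x hx
  rw [abs_of_nonneg hr] at hx
  have hxR : x ∈ ball (0 : ℂ) R := by simp at hx ⊢; linarith
  have hball : ∀ᶠ y in 𝓝 x, y ∈ ball (0 : ℂ) R := isOpen_ball.mem_nhds hxR
  have h1 : ∀ᶠ y in 𝓝[≠] x, f y = (∏ u ∈ s, (y - u) ^ D u) * g y := by
    rw [EventuallyEq, Filter.Eventually, mem_codiscreteWithin_iff_forall_mem_nhdsNE] at hfg
    have := hfg x (ball_subset_closedBall hxR)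
    filter_upwards [this, hball.filter_mono nhdsWithin_le_nhds] with y hy hyR
    rcases hy with hy | hy
    · simpa using hy
    · exact absurd (ball_subset_closedBall hyR) hy
  have h2 : ∀ᶠ y in 𝓝[≠] x, ∀ u ∈ s, y ≠ u := by
    rw [Filter.eventually_all_finset]
    intro u _
    rcases eq_or_ne x u with rfl | hxu
    · exact eventually_mem_nhdsWithin
    · exact (isOpen_ne.eventually_mem hxu).filter_mono nhdsWithin_le_nhds
  -- The factorization must hold on a full neighbourhood of a point before it can be differentiated
  -- there.
  have h3 : ∀ᶠ y in 𝓝[≠] x, ∀ᶠ w in 𝓝 y, (f w = (∏ u ∈ s, (w - u) ^ D u) * g w) ∧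
      (∀ u ∈ s, w ≠ u) ∧ w ∈ ball (0 : ℂ) R := by
    have := eventually_eventually_nhdsWithin.2
      (h1.and (h2.and (hball.filter_mono nhdsWithin_le_nhds)))
    filter_upwards [this, eventually_mem_nhdsWithin] with y hy hyx
    rwa [isOpen_compl_singleton.nhdsWithin_eq hyx] at hy
  filter_upwards [h3] with y hy
  left
  have hev : logDeriv f =ᶠ[𝓝 y] fun w => (∑ u ∈ s, (D u : ℂ) * (w - u)⁻¹) + logDeriv g w := by
    filter_upwards [hy.eventually_nhds] with w hw
    have hw' := hw.self_of_nhds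
    have hfw : f =ᶠ[𝓝 w] fun w => (∏ u ∈ s, (w - u) ^ D u) * g w := hw.mono fun _ h => h.1
    have hwR := ball_subset_closedBall hw'.2.2
    have hd : ∀ u ∈ s, DifferentiableAt ℂ (fun w => (w - u) ^ D u) w := fun u hu =>
      DifferentiableAt.zpow (by fun_prop) (Or.inl (sub_ne_zero.2 (hw'.2.1 u hu)))
    have hne : ∀ u ∈ s, (w - u) ^ D u ≠ 0 := fun u hu =>
      zpow_ne_zero _ (sub_ne_zero.2 (hw'.2.1 u hu))
    rw [logDeriv_apply, hfw.deriv_eq, hfw.self_of_nhds]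
    have := logDeriv_mul (f := fun w => ∏ u ∈ s, (w - u) ^ D u) (g := g) w
      (Finset.prod_ne_zero_iff.2 hne) (hg0 w hwR)
      (by fun_prop (disch := assumption)) (hg w hwR).differentiableAt
    rw [logDeriv_apply] at this
    rw [this]
    congr 1
    rw [logDeriv_prod (f := fun u w => (w - u) ^ D u) hne hd]
    refine Finset.sum_congr rfl fun u hu => ?_
    rw [logDeriv_fun_zpow (by fun_prop), logDeriv_apply]
    simp [div_eq_mul_inv]
  have hy' := hy.self_of_nhds
  have hyR := ball_subset_closedBall hy'.2.2
  have hinv : ∀ u ∈ s, ContDiffAt ℂ i (fun w => (w - u)⁻¹) y := fun u hu =>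
    ContDiffAt.inv (by fun_prop) (sub_ne_zero.2 (hy'.2.1 u hu))
  have hlg : ContDiffAt ℂ i (logDeriv g) y := by
    have : AnalyticAt ℂ (logDeriv g) y := (hg y hyR).deriv.div (hg y hyR) (hg0 y hyR)
    exact this.contDiffAt
  show iteratedDeriv i (logDeriv f) y = _
  rw [hev.iteratedDeriv_eq, iteratedDeriv_fun_add
    (ContDiffAt.sum fun u hu => contDiffAt_const.mul (hinv u hu)) hlg,
    iteratedDeriv_fun_sum fun u hu => contDiffAt_const.mul (hinv u hu)]
  congr 1
  refine Finset.sum_congr rfl fun u hu => ?_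
  rw [iteratedDeriv_const_mul_field, iteratedDeriv_inv_sub]

end Nevanlinna

end

/-! ### The logarithmic derivative on a pair of circles -/

noncomputable section

namespace Nevanlinna

open Complex Metric Set Filter Topology MeasureTheory ValueDistribution Real

/-- This is the tangent line at `A` of a concave function. Averaged, it does the work of Jensen's
inequality: a mean at most `A` gives a mean of log(1 + ·) at most log(1 + A). -/
lemma log_one_add_le {x A : ℝ} (hx : 0 ≤ x) (hA : 0 ≤ A) :
    Real.log (1 + x) ≤ Real.log (1 + A) + (x - A) * (1 + A)⁻¹ := by
  have h1 : 0 < 1 + x := by linarith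
  have h2 : 0 < 1 + A := by linarith
  have h3 := Real.log_le_sub_one_of_pos (div_pos h1 h2)
  rw [Real.log_div h1.ne' h2.ne'] at h3
  have : (1 + x) / (1 + A) - 1 = (x - A) * (1 + A)⁻¹ := by field_simp; ring
  linarith

lemma posLog_add_le_log_one_add {x a b : ℝ} (hx : |x| ≤ a + b) (ha : 0 ≤ a) (hb : 0 ≤ b) :
    log⁺ x ≤ Real.log (1 + a) + Real.log (1 + b) := by
  rw [← Real.log_mul (by positivity) (by positivity), ← Real.posLog_abs, Real.posLog_eq_log_max_one (abs_nonneg x)]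
  refine Real.log_le_log (by positivity) (max_le ?_ ?_)
  · nlinarith [mul_nonneg ha hb]
  · nlinarith [mul_nonneg ha hb]

lemma circleAverage_log_one_add_le {u : ℂ → ℝ} {r A : ℝ} (hu : CircleIntegrable u 0 r)
    (h : Real.circleAverage u 0 r ≤ A) (hA : 0 ≤ A) :
    CircleIntegrable (fun z => Real.log (1 + A) + (1 + A)⁻¹ * (u z - A)) 0 r ∧
      Real.circleAverage (fun z => Real.log (1 + A) + (1 + A)⁻¹ * (u z - A)) 0 r ≤
        Real.log (1 + A) := by
  have h0 : CircleIntegrable (fun z => u z - A) 0 r := hu.sub (circleIntegrable_const A 0 r)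
  have h1 : CircleIntegrable (fun z => (1 + A)⁻¹ * (u z - A)) 0 r :=
    h0.const_smul (a := (1 + A)⁻¹)
  refine ⟨(circleIntegrable_const _ 0 r).add h1, ?_⟩
  rw [Real.circleAverage_fun_add (circleIntegrable_const _ 0 r) h1, Real.circleAverage_const]
  have h2 := Real.circleAverage_fun_smul (a := (1 + A)⁻¹) (f := fun z => u z - A) (c := 0) (R := r)
  simp only [smul_eq_mul] at h2
  have h3 : Real.circleAverage (fun z => u z - A) 0 r = Real.circleAverage u 0 r - A := by
    have := Real.circleAverage_fun_sub hu (circleIntegrable_const A 0 r)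
    rwa [Real.circleAverage_const] at this
  rw [h2, h3]
  have : (1 + A)⁻¹ * (Real.circleAverage u 0 r - A) ≤ 0 :=
    mul_nonpos_of_nonneg_of_nonpos (by positivity) (by linarith)
  linarith

lemma circleIntegrable_log_norm_sub (a : ℂ) (R : ℝ) :
    CircleIntegrable (fun z => Real.log ‖z - a‖) 0 R :=
  MeromorphicOn.circleIntegrable_log_norm fun z _ => by fun_prop

lemma circleIntegrable_posLog_norm_sub (a : ℂ) (R : ℝ) :
    CircleIntegrable (fun z => log⁺ ‖z - a‖) 0 R :=
  MeromorphicOn.circleIntegrable_posLog_norm fun z _ => by fun_prop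

lemma abs_log_eq (x : ℝ) : |Real.log x| = 2 * log⁺ x - Real.log x := by
  have := Real.half_mul_log_add_log_abs (x := x)
  linarith

/-- Use |log x| = 2 log⁺ x - log x. The mean of log|z - a| is exactly log R for `a` in the disc,
log⁺|z - a| is at most log(2R), and 2 log 2 < 2. -/
lemma circleAverage_abs_log_norm_sub_le {R : ℝ} (hR : 1 ≤ R) {a : ℂ}
    (ha : a ∈ closedBall (0 : ℂ) R) :
    Real.circleAverage (fun z => |Real.log ‖z - a‖|) 0 R ≤ Real.log R + 2 := by
  have hR0 : (0 : ℝ) < R := by linarith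
  have h1 : (fun z : ℂ => |Real.log ‖z - a‖|) = fun z => (2 : ℝ) • log⁺ ‖z - a‖ - Real.log ‖z - a‖ := by
    ext z; rw [abs_log_eq, smul_eq_mul]
  have hp := circleIntegrable_posLog_norm_sub a R
  have hp2 : CircleIntegrable (fun z => (2 : ℝ) • log⁺ ‖z - a‖) 0 R := hp.const_smul (a := (2:ℝ))
  rw [h1, Real.circleAverage_fun_sub hp2 (circleIntegrable_log_norm_sub a R),
    Real.circleAverage_fun_smul, circleAverage_log_norm_sub_const_of_mem_closedBall
      (by rwa [abs_of_pos hR0])]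
  have h2 : Real.circleAverage (fun z => log⁺ ‖z - a‖) 0 R ≤ Real.log (2 * R) := by
    refine Real.circleAverage_mono_on_of_le_circle hp fun z hz => ?_
    rw [abs_of_pos hR0] at hz
    have h3 : ‖z - a‖ ≤ 2 * R := by
      refine (norm_sub_le _ _).trans ?_
      simp at hz ha; linarith
    rw [Real.posLog_eq_log_max_one (norm_nonneg _)]
    exact Real.log_le_log (by positivity) (max_le (by linarith) h3)
  rw [Real.log_mul (by norm_num) hR0.ne'] at h2
  have := Real.log_two_lt_d9
  simp only [smul_eq_mul]
  linarith

/-- The number of zeros and poles of `f` in the closed disc of radius `R`. -/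
def zeroPoleCount (f : ℂ → ℂ) (R : ℝ) : ℝ :=
  ∑ᶠ u, |(MeromorphicOn.divisor f (closedBall 0 R) u : ℝ)|

lemma zeroPoleCount_eq_sum (f : ℂ → ℂ) (R : ℝ) :
    zeroPoleCount f R = ∑ u ∈ ((MeromorphicOn.divisor f (closedBall 0 R)).finiteSupport
      (isCompact_closedBall 0 R)).toFinset, |(MeromorphicOn.divisor f (closedBall 0 R) u : ℝ)| := by
  rw [zeroPoleCount, finsum_eq_sum_of_support_subset]
  intro u hu
  simpa using hu

lemma zeroPoleCount_nonneg (f : ℂ → ℂ) (R : ℝ) : 0 ≤ zeroPoleCount f R :=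
  finsum_nonneg fun _ => abs_nonneg _

/-- The lemma on the logarithmic derivative on a pair of circles. -/
theorem proximity_iteratedDeriv_logDeriv_le {f : ℂ → ℂ} (hf : Meromorphic f)
    (h : ∀ z, meromorphicOrderAt f z ≠ ⊤) {r R : ℝ} (hr : 1 ≤ r) (hrR : r < R) (i : ℕ) :
    proximity (iteratedDeriv i (logDeriv f)) ⊤ r ≤
      Real.log (1 + zeroPoleCount f R * i.factorial) +
      (2 * (i + 1)) * Real.log (1 + kernelBound * zeroPoleCount f R) +
      Real.log (1 + i.factorial * (8 / (R - r)) / ((R - r) / 2) ^ i *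
        (Real.circleAverage (fun z => |Real.log ‖f z‖|) 0 R +
          zeroPoleCount f R * (Real.log R + 2))) := by
  have hr0 : 0 < r := by linarith
  have hR0 : 0 < R := by linarith
  have hfU : MeromorphicOn f (closedBall 0 R) := fun z _ => hf z
  set D := MeromorphicOn.divisor f (closedBall 0 R) with hD
  have hfin := D.finiteSupport (isCompact_closedBall (0 : ℂ) R)
  obtain ⟨g, hg, hg0, hfg⟩ := hfU.extract_zeros_poles (fun u => h u) hfin
  have hg0' : ∀ z ∈ closedBall (0 : ℂ) R, g z ≠ 0 := fun z hz => hg0 ⟨z, hz⟩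
  set s := hfin.toFinset with hs
  have hsD : ∀ u, u ∉ s → D u = 0 := fun u hu => by simpa [hs] using hu
  have hsU : ∀ u ∈ s, u ∈ closedBall (0 : ℂ) R := fun u hu =>
    D.supportWithinDomain (by simpa [hs] using hu)
  set n := zeroPoleCount f R with hn
  have hns : n = ∑ u ∈ s, |(D u : ℝ)| := zeroPoleCount_eq_sum f R
  have hn0 : 0 ≤ n := zeroPoleCount_nonneg f R
  have hcard : (s.card : ℝ) ≤ n := by
    rw [hns, Finset.card_eq_sum_ones, Nat.cast_sum]
    refine Finset.sum_le_sum fun u hu => ?_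
    have : D u ≠ 0 := by simpa [hs] using hu
    have : 1 ≤ |D u| := Int.one_le_abs this
    exact_mod_cast this
  -- the mean of `|log |g||`
  have hgavg : Real.circleAverage (fun z => |Real.log ‖g z‖|) 0 R ≤
      Real.circleAverage (fun z => |Real.log ‖f z‖|) 0 R + n * (Real.log R + 2) := by
    have hlog := MeromorphicOn.extract_zeros_poles_log hg0 hfg
    rw [← hD] at hlog
    have hgi : CircleIntegrable (fun z => Real.log ‖g z‖) 0 R :=
      MeromorphicOn.circleIntegrable_log_norm fun z hz =>
        (hg z (by rw [abs_of_pos hR0] at hz; exact sphere_subset_closedBall hz)).meromorphicAt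
    have hfi : CircleIntegrable (fun z => Real.log ‖f z‖) 0 R :=
      MeromorphicOn.circleIntegrable_log_norm fun z hz => hf z
    have hsum : CircleIntegrable (fun z => ∑ u ∈ s, |(D u : ℝ)| * |Real.log ‖z - u‖|) 0 R := by
      have := CircleIntegrable.sum s (f := fun u z => |(D u : ℝ)| • |Real.log ‖z - u‖|) (c := 0)
        (R := R) fun u _ => (circleIntegrable_log_norm_sub u R).abs.const_smul
      convert this using 1
      ext z; simp
    have hle : Real.circleAverage (fun z => |Real.log ‖g z‖|) 0 R ≤
        Real.circleAverage (fun z => |Real.log ‖f z‖| +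
          ∑ u ∈ s, |(D u : ℝ)| * |Real.log ‖z - u‖|) 0 R := by
      have hlog' : (fun z => |Real.log ‖g z‖|) =ᶠ[codiscreteWithin (sphere 0 |R|)]
          fun z => |Real.log ‖f z‖ - ∑ u ∈ s, (D u : ℝ) * Real.log ‖z - u‖| := by
        have hsub : sphere (0 : ℂ) |R| ⊆ closedBall 0 R := by
          rw [abs_of_pos hR0]; exact sphere_subset_closedBall
        filter_upwards [Filter.codiscreteWithin_mono hsub hlog] with z hz
        simp only [Pi.add_apply] at hz
        rw [hz, finsum_eq_sum_of_support_subset (s := s)]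
        · simp
        · intro u hu
          by_contra hus
          apply hu
          ext z
          simp [hsD u (by simpa using hus)]
      rw [Real.circleAverage_congr_codiscreteWithin hlog' hR0.ne']
      refine Real.circleAverage_mono (hgi.abs.congr_codiscreteWithin hlog') (hfi.abs.add hsum)
        fun z hz => ?_
      refine (abs_sub _ _).trans (add_le_add le_rfl ?_)
      refine (Finset.abs_sum_le_sum_abs _ _).trans (le_of_eq ?_)
      exact Finset.sum_congr rfl fun u _ => abs_mul _ _
    refine hle.trans ?_
    rw [Real.circleAverage_fun_add (f₁ := fun z => |Real.log ‖f z‖|) hfi.abs hsum]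
    refine add_le_add le_rfl ?_
    have := Real.circleAverage_fun_sum (s := s) (f := fun u z => |(D u : ℝ)| • |Real.log ‖z - u‖|)
      (c := 0) (R := R) fun u _ => (circleIntegrable_log_norm_sub u R).abs.const_smul
    simp only [Real.circleAverage_fun_smul] at this
    simp only [smul_eq_mul] at this
    rw [this, hns, Finset.sum_mul]
    exact Finset.sum_le_sum fun u hu => mul_le_mul_of_nonneg_left
      (circleAverage_abs_log_norm_sub_le (by linarith) (hsU u hu)) (abs_nonneg _)
  obtain ⟨J, hJ, hJavg, hJ0, hJb⟩ := exists_bound_iteratedDeriv_logDeriv hr0 hrR hg hg0'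
  set b := (i.factorial : ℝ) * (8 / (R - r)) / ((R - r) / 2) ^ i with hb
  have hb0 : 0 ≤ b := by
    have : 0 < R - r := by linarith
    positivity
  -- The square root keeps the kernel integrable even when a zero or pole lies on the circle. Each
  -- |z - u|^(-(i+1)) is at most S^(2(i+1)), and the exponent becomes a mere factor after taking
  -- logarithms.
  set S : ℂ → ℝ := fun z => ∑ u ∈ s, (√‖z - u‖)⁻¹ with hS
  have hSi : CircleIntegrable S 0 r := by
    have := CircleIntegrable.sum s (f := fun u z => (√‖z - u‖)⁻¹) (c := 0)
        (R := r) fun u _ => circleIntegrable_inv_sqrt_norm_sub hr u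
    convert this using 1
    ext z; simp [hS]
  have hSavg : Real.circleAverage S 0 r ≤ kernelBound * n := by
    rw [hS, Real.circleAverage_fun_sum fun u _ => circleIntegrable_inv_sqrt_norm_sub hr u]
    refine (Finset.sum_le_sum fun u _ => circleAverage_inv_sqrt_norm_sub_le hr u).trans ?_
    rw [Finset.sum_const, nsmul_eq_mul, mul_comm]
    exact mul_le_mul_of_nonneg_left hcard kernelBound_nonneg
  have hSn : ∀ z, 0 ≤ S z := fun z => Finset.sum_nonneg fun u _ => by positivity
  have hKn : 0 ≤ kernelBound * n := mul_nonneg kernelBound_nonneg hn0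
  obtain ⟨hi1, ha1⟩ := circleAverage_log_one_add_le hSi hSavg hKn
  have hbJ : CircleIntegrable (fun z => b * J z) 0 r := hJ.const_smul (a := b)
  set B := b * (Real.circleAverage (fun z => |Real.log ‖f z‖|) 0 R + n * (Real.log R + 2)) with hB
  have hbJavg : Real.circleAverage (fun z => b * J z) 0 r ≤ B := by
    have := Real.circleAverage_fun_smul (a := b) (f := J) (c := 0) (R := r)
    simp only [smul_eq_mul] at this
    rw [this, hJavg]
    exact mul_le_mul_of_nonneg_left hgavg hb0
  have hB0 : 0 ≤ B := by
    refine le_trans ?_ hbJavg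
    refine Real.circleAverage_nonneg_of_nonneg fun z hz => ?_
    rw [abs_of_pos hr0] at hz
    exact mul_nonneg hb0 (hJ0 z hz)
  obtain ⟨hi2, ha2⟩ := circleAverage_log_one_add_le hbJ hbJavg hB0
  have hcod := iteratedDeriv_logDeriv_codiscrete hsD hg hg0' hfg i hr0.le hrR
  set H : ℂ → ℂ := fun z =>
      (∑ u ∈ s, (D u : ℂ) * ((-1) ^ i * i.factorial / (z - u) ^ (i + 1))) +
        iteratedDeriv i (logDeriv g) z with hH
  have hmero : Meromorphic (iteratedDeriv i (logDeriv f)) := by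
    rw [iteratedDeriv_eq_iterate]
    exact Meromorphic.iterated_deriv (hf.deriv.div hf)
  have hcod' : (fun z => log⁺ ‖iteratedDeriv i (logDeriv f) z‖) =ᶠ[codiscreteWithin (sphere 0 |r|)]
      fun z => log⁺ ‖H z‖ := hcod.mono fun z hz => by simp only [hz]
  have hHi : CircleIntegrable (fun z => log⁺ ‖H z‖) 0 r :=
    (MeromorphicOn.circleIntegrable_posLog_norm fun z _ => hmero z).congr_codiscreteWithin hcod'
  rw [proximity_top, Real.circleAverage_congr_codiscreteWithin hcod' hr0.ne']
  have hi1' : CircleIntegrable (fun z => (2 * ((i : ℝ) + 1)) *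
      (Real.log (1 + kernelBound * n) + (1 + kernelBound * n)⁻¹ * (S z - kernelBound * n))) 0 r :=
    hi1.const_smul (a := 2 * ((i : ℝ) + 1))
  have hc : CircleIntegrable (fun _ : ℂ => Real.log (1 + n * i.factorial)) 0 r :=
    circleIntegrable_const _ 0 r
  refine (Real.circleAverage_mono hHi ((hc.add hi1').add hi2) fun z hz => ?_).trans ?_
  · rw [abs_of_pos hr0] at hz
    have hX : ‖∑ u ∈ s, (D u : ℂ) * ((-1) ^ i * i.factorial / (z - u) ^ (i + 1))‖ ≤
        n * i.factorial * (S z) ^ (2 * (i + 1)) := by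
      refine (norm_sum_le _ _).trans ?_
      rw [hns, Finset.sum_mul, Finset.sum_mul]
      refine Finset.sum_le_sum fun u hu => ?_
      rw [norm_mul, norm_div, norm_mul, norm_pow, norm_neg, norm_one, one_pow, one_mul, norm_pow,
        Complex.norm_natCast, Complex.norm_intCast, mul_assoc]
      refine mul_le_mul_of_nonneg_left ?_ (abs_nonneg _)
      rw [div_eq_mul_inv]
      refine mul_le_mul_of_nonneg_left ?_ (by positivity)
      rw [pow_mul, ← inv_pow]
      refine pow_le_pow_left₀ (by positivity) ?_ _
      have h1 : (√‖z - u‖)⁻¹ ≤ S z :=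
        Finset.single_le_sum (f := fun u => (√‖z - u‖)⁻¹) (fun u _ => by positivity) hu
      calc ‖z - u‖⁻¹ = ((√‖z - u‖)⁻¹) ^ 2 := by
            rw [inv_pow, Real.sq_sqrt (norm_nonneg _)]
        _ ≤ _ := pow_le_pow_left₀ (by positivity) h1 2
    have hY : ‖iteratedDeriv i (logDeriv g) z‖ ≤ b * J z := by
      refine (hJb i z hz).trans (le_of_eq ?_)
      rw [hb]; ring
    have hS0 := hSn z
    have hni : 0 ≤ n * i.factorial := by positivity
    have h1 : log⁺ ‖H z‖ ≤ Real.log (1 + n * i.factorial * (S z) ^ (2 * (i + 1))) +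
        Real.log (1 + b * J z) := by
      refine posLog_add_le_log_one_add ?_ (by positivity) (mul_nonneg hb0 (hJ0 z hz))
      rw [abs_of_nonneg (norm_nonneg _)]
      exact (norm_add_le _ _).trans (add_le_add hX hY)
    have h2 : Real.log (1 + n * i.factorial * (S z) ^ (2 * (i + 1))) ≤
        Real.log (1 + n * i.factorial) + (2 * ((i : ℝ) + 1)) * Real.log (1 + S z) := by
      have e : (2 * ((i : ℝ) + 1)) * Real.log (1 + S z) = Real.log ((1 + S z) ^ (2 * (i + 1))) := by
        rw [Real.log_pow]; push_cast; ring
      rw [e, ← Real.log_mul (by positivity) (by positivity)]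
      refine Real.log_le_log (by positivity) ?_
      have h3 : (S z) ^ (2 * (i + 1)) ≤ (1 + S z) ^ (2 * (i + 1)) :=
        pow_le_pow_left₀ hS0 (by linarith) _
      have h4 : 1 ≤ (1 + S z) ^ (2 * (i + 1)) := one_le_pow₀ (by linarith)
      nlinarith [mul_le_mul_of_nonneg_left h3 hni]
    have h3 := log_one_add_le hS0 hKn
    have h4 := log_one_add_le (mul_nonneg hb0 (hJ0 z hz)) hB0
    have h5 := mul_le_mul_of_nonneg_left h3 (by positivity : 0 ≤ 2 * ((i : ℝ) + 1))
    simp only [Pi.add_apply]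
    rw [mul_comm (S z - _)] at h5
    rw [mul_comm (b * J z - _)] at h4
    linarith
  · have e1 := Real.circleAverage_add (hc.add hi1') hi2
    have e2 := Real.circleAverage_add hc hi1'
    have e3 := Real.circleAverage_fun_smul (a := 2 * ((i : ℝ) + 1)) (f := fun z => 
      (Real.log (1 + kernelBound * n) + (1 + kernelBound * n)⁻¹ * (S z - kernelBound * n)))
      (c := 0) (R := r)
    simp only [smul_eq_mul] at e3
    rw [e1, e2, e3, Real.circleAverage_const]
    have := mul_le_mul_of_nonneg_left ha1 (by positivity : 0 ≤ 2 * ((i : ℝ) + 1))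
    linarith

end Nevanlinna

end

/-! ### Counting functions, Borel's lemma and small error terms -/

noncomputable section

namespace Nevanlinna

open Complex Metric Set Filter Topology MeasureTheory ValueDistribution Real

/-- The weight of a zero at `u` in the integrated counting function. -/
def radialWeight (r : ℝ) (u : ℂ) : ℝ :=
  if u = 0 then Real.log r else Real.log (r * ‖u‖⁻¹)

lemma radialWeight_nonneg {r : ℝ} (hr : 1 ≤ r) {u : ℂ} (hu : ‖u‖ ≤ r) : 0 ≤ radialWeight r u := by
  unfold radialWeight
  split_ifs with h
  · exact Real.log_nonneg hr
  · have : 0 < ‖u‖ := norm_pos_iff.2 h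
    exact Real.log_nonneg (by rw [← div_eq_mul_inv, one_le_div this]; exact hu)

lemma log_div_le_radialWeight {r ρ : ℝ} (hρ : 1 ≤ ρ) (hr : 1 ≤ r) {u : ℂ} (hu : ‖u‖ ≤ ρ) :
    Real.log (r / ρ) ≤ radialWeight r u := by
  have h0 : 0 < ρ := by linarith
  unfold radialWeight
  split_ifs with h
  · exact Real.log_le_log (by positivity) (div_le_self (by linarith) hρ)
  · have : 0 < ‖u‖ := norm_pos_iff.2 h
    rw [div_eq_mul_inv]
    exact Real.log_le_log (by positivity) (by gcongr)

lemma logCounting_eq_sum (D : Function.locallyFinsupp ℂ ℤ) {r : ℝ} (hr : 0 ≤ r) {t : Finset ℂ}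
    (ht : ∀ u, ‖u‖ ≤ r → D u ≠ 0 → u ∈ t) (htr : ∀ u ∈ t, ‖u‖ ≤ r) :
    D.logCounting r = ∑ u ∈ t, (D u : ℝ) * radialWeight r u := by
  have hmem : ∀ u : ℂ, ‖u‖ ≤ r → u ∈ closedBall (0 : ℂ) |r| := fun u hu => by
    simpa [abs_of_nonneg hr] using hu
  have h1 : D.logCounting r =
      ∑ᶠ z, D.toClosedBall r z * Real.log (r * ‖z‖⁻¹) + (D 0) * Real.log r := rfl
  have h2 : ∑ᶠ z, (D.toClosedBall r z : ℝ) * Real.log (r * ‖z‖⁻¹) =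
      ∑ u ∈ t, (D u : ℝ) * Real.log (r * ‖u‖⁻¹) := by
    rw [finsum_eq_sum_of_support_subset (s := t)]
    · exact Finset.sum_congr rfl fun u hu => by
        rw [Function.locallyFinsuppWithin.toClosedBall_eval_within D (hmem u (htr u hu))]
    · intro u hu
      have hu' : D.toClosedBall r u ≠ 0 := fun h => hu (by simp [h])
      have hub := Function.locallyFinsuppWithin.toClosedBall_support_subset_closedBall D hu'
      rw [Function.locallyFinsuppWithin.toClosedBall_eval_within D hub] at hu'
      exact ht u (by simpa [abs_of_nonneg hr] using hub) hu'
  have h3 : (D 0 : ℝ) * Real.log r = ∑ u ∈ t, if u = 0 then (D u : ℝ) * Real.log r else 0 := by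
    rw [Finset.sum_ite_eq']
    split_ifs with h
    · rfl
    · by_cases hD : D 0 = 0
      · simp [hD]
      · exact absurd (ht 0 (by simpa using hr) hD) h
  rw [h1, h2, h3, ← Finset.sum_add_distrib]
  refine Finset.sum_congr rfl fun u _ => ?_
  unfold radialWeight
  split_ifs with h <;> simp [h]

/-- Each point of modulus at most `ρ` has weight at least log(r/ρ), and all other terms are
nonnegative. -/
lemma sum_mul_log_div_le_logCounting {D : Function.locallyFinsupp ℂ ℤ} (hD : 0 ≤ D) {r ρ : ℝ}
    (hρ : 1 ≤ ρ) (hρr : ρ ≤ r) {t : Finset ℂ} (ht : ∀ u ∈ t, ‖u‖ ≤ ρ) :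
    (∑ u ∈ t, (D u : ℝ)) * Real.log (r / ρ) ≤ D.logCounting r := by
  have hr0 : 0 ≤ r := by linarith
  have hfin : ((D.toClosedBall r).support).Finite :=
    Function.locallyFinsuppWithin.finiteSupport _ (isCompact_closedBall 0 |r|)
  have hmem : ∀ u : ℂ, ‖u‖ ≤ r → u ∈ closedBall (0 : ℂ) |r| := fun u hu => by
    simpa [abs_of_nonneg hr0] using hu
  classical
  rw [logCounting_eq_sum D hr0 (t := hfin.toFinset ∪ t)]
  · have hpos : ∀ u, (0 : ℝ) ≤ D u := fun u => by exact_mod_cast hD u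
    rw [Finset.sum_mul]
    refine (Finset.sum_le_sum fun u hu => mul_le_mul_of_nonneg_left
      (log_div_le_radialWeight hρ (hρ.trans hρr) (ht u hu)) (hpos u)).trans ?_
    refine Finset.sum_le_sum_of_subset_of_nonneg Finset.subset_union_right fun u hu _ => ?_
    refine mul_nonneg (hpos u) (radialWeight_nonneg (by linarith) ?_)
    rcases Finset.mem_union.1 hu with h | h
    · have := Function.locallyFinsuppWithin.toClosedBall_support_subset_closedBall D
        (hfin.mem_toFinset.1 h)
      simpa [abs_of_nonneg hr0] using this
    · exact (ht u h).trans hρr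
  · intro u hu hDu
    refine Finset.mem_union_left _ (hfin.mem_toFinset.2 ?_)
    show D.toClosedBall r u ≠ 0
    rwa [Function.locallyFinsuppWithin.toClosedBall_eval_within D (hmem u hu)]
  · intro u hu
    rcases Finset.mem_union.1 hu with h | h
    · have := Function.locallyFinsuppWithin.toClosedBall_support_subset_closedBall D
        (hfin.mem_toFinset.1 h)
      simpa [abs_of_nonneg hr0] using this
    · exact (ht u h).trans hρr

/-- The divisor of zeros and poles, both counted positively. -/
def zeroPoleDivisor (f : ℂ → ℂ) : Function.locallyFinsupp ℂ ℤ :=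
  (MeromorphicOn.divisor f univ)⁺ + (MeromorphicOn.divisor f univ)⁻

lemma zeroPoleDivisor_apply (f : ℂ → ℂ) (u : ℂ) :
    zeroPoleDivisor f u = |MeromorphicOn.divisor f univ u| := by
  exact posPart_add_negPart (MeromorphicOn.divisor f univ u)

lemma zeroPoleDivisor_nonneg (f : ℂ → ℂ) : 0 ≤ zeroPoleDivisor f := fun u => by
  rw [zeroPoleDivisor_apply]; exact abs_nonneg _

lemma logCounting_zeroPoleDivisor (f : ℂ → ℂ) (r : ℝ) :
    (zeroPoleDivisor f).logCounting r = logCounting f 0 r + logCounting f ⊤ r := by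
  rw [zeroPoleDivisor, map_add, logCounting_zero, logCounting_top]; rfl

lemma divisor_closedBall {f : ℂ → ℂ} (hf : Meromorphic f) {R : ℝ} {u : ℂ}
    (hu : u ∈ closedBall (0 : ℂ) R) :
    MeromorphicOn.divisor f (closedBall 0 R) u = MeromorphicOn.divisor f univ u := by
  rw [MeromorphicOn.divisor_apply (fun z _ => hf z) hu,
    MeromorphicOn.divisor_apply (fun z _ => hf z) (mem_univ u)]

lemma zeroPoleCount_eq {f : ℂ → ℂ} (hf : Meromorphic f) (R : ℝ) :
    ∃ t : Finset ℂ, (∀ u ∈ t, ‖u‖ ≤ R) ∧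
      zeroPoleCount f R = ∑ u ∈ t, (zeroPoleDivisor f u : ℝ) := by
  have hsub : ∀ u ∈ ((MeromorphicOn.divisor f (closedBall 0 R)).finiteSupport
      (isCompact_closedBall 0 R)).toFinset, u ∈ closedBall (0 : ℂ) R := fun u hu =>
    (MeromorphicOn.divisor f (closedBall 0 R)).supportWithinDomain (by simpa using hu)
  refine ⟨_, fun u hu => by simpa using hsub u hu, ?_⟩
  rw [zeroPoleCount_eq_sum]
  refine Finset.sum_congr rfl fun u hu => ?_
  rw [zeroPoleDivisor_apply, divisor_closedBall hf (hsub u hu), Int.cast_abs]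

lemma zeroPoleCount_mul_log_le {f : ℂ → ℂ} (hf : Meromorphic f) {r R : ℝ} (hr : 1 ≤ r)
    (hrR : r ≤ R) :
    zeroPoleCount f r * Real.log (R / r) ≤ logCounting f 0 R + logCounting f ⊤ R := by
  obtain ⟨t, ht, he⟩ := zeroPoleCount_eq hf r
  rw [he, ← logCounting_zeroPoleDivisor]
  exact sum_mul_log_div_le_logCounting (zeroPoleDivisor_nonneg f) hr hrR ht

/-- Once more than `K` zeros and poles lie in a fixed disc, the integrated counting functions grow
at least like K log r. So either the number of zeros and poles is bounded, or log r can be absorbed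
into the characteristic with an arbitrarily small factor. -/
lemma zeroPoleCount_dichotomy {f : ℂ → ℂ} (hf : Meromorphic f) :
    (∃ n₀, ∀ R, zeroPoleCount f R ≤ n₀) ∨
      ∀ K : ℝ, 0 < K → ∃ C, ∀ r, 1 ≤ r →
        K * Real.log r ≤ logCounting f 0 r + logCounting f ⊤ r + C := by
  by_cases h : ∃ n₀, ∀ R, zeroPoleCount f R ≤ n₀
  · exact Or.inl h
  refine Or.inr fun K hK => ?_
  push Not at h
  obtain ⟨R, hR⟩ := h K
  obtain ⟨t, ht, he⟩ := zeroPoleCount_eq hf R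
  set ρ := max R 1 with hρ
  have hρ1 : 1 ≤ ρ := le_max_right _ _
  have hlρ := Real.log_nonneg hρ1
  refine ⟨K * Real.log ρ, fun r hr => ?_⟩
  have hN : 0 ≤ logCounting f 0 r + logCounting f ⊤ r :=
    add_nonneg (logCounting_nonneg hr) (logCounting_nonneg hr)
  rcases le_total ρ r with hρr | hρr
  · have := sum_mul_log_div_le_logCounting (zeroPoleDivisor_nonneg f) hρ1 hρr
      (t := t) fun u hu => (ht u hu).trans (le_max_left _ _)
    rw [← he, logCounting_zeroPoleDivisor, Real.log_div (by linarith) (by linarith)] at this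
    have hl : 0 ≤ Real.log r - Real.log ρ :=
      sub_nonneg.2 (Real.log_le_log (by linarith) hρr)
    nlinarith [mul_le_mul_of_nonneg_right hR.le hl]
  · have := mul_le_mul_of_nonneg_left (Real.log_le_log (by linarith) hρr) hK.le
    linarith

/-- Borel's growth lemma. -/
lemma volume_growth_lt_top {A : ℝ → ℝ} (hA : MonotoneOn A (Ici 1)) (hA1 : ∀ r, 1 ≤ r → 1 ≤ A r) :
    volume {r | 1 ≤ r ∧ 2 * A r < A (r + (A r)⁻¹)} < ⊤ := by
  -- Dyadic slices of the exceptional set. If r, r' lie in slice k and r' > r + 2^(-k), then A(r') ≥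
  -- A(r + 1/A(r)) > 2^(k+1) by monotonicity, which is impossible. So slice k has diameter at most
  -- 2^(-k).
  set B : ℕ → Set ℝ := fun k => {r | 1 ≤ r ∧ 2 * A r < A (r + (A r)⁻¹) ∧ 2 ^ k ≤ A r ∧
    A r < 2 ^ (k + 1)} with hB
  have hsub : {r | 1 ≤ r ∧ 2 * A r < A (r + (A r)⁻¹)} ⊆ ⋃ k, B k := by
    rintro r ⟨hr, h⟩
    obtain ⟨k, hk1, hk2⟩ := exists_nat_pow_near (hA1 r hr) (by norm_num : (1 : ℝ) < 2)
    exact mem_iUnion.2 ⟨k, hr, h, hk1, hk2⟩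
  have hdist : ∀ k, ∀ r ∈ B k, ∀ r' ∈ B k, r' - r ≤ (2⁻¹ : ℝ) ^ k := by
    rintro k r ⟨hr, h, hk1, hk2⟩ r' ⟨hr', -, -, hk2'⟩
    by_contra! hcon
    have hAr := hA1 r hr
    have h1 : (A r)⁻¹ ≤ (2⁻¹ : ℝ) ^ k := by
      rw [inv_pow]; exact inv_anti₀ (by positivity) hk1
    have h2 : (0 : ℝ) ≤ (A r)⁻¹ := by positivity
    have h3 : A (r + (A r)⁻¹) ≤ A r' :=
      hA (mem_Ici.2 (by linarith)) (mem_Ici.2 hr') (by linarith)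
    rw [pow_succ] at hk2'
    linarith
  have hvol : ∀ k, volume (B k) ≤ (2⁻¹ : ENNReal) ^ k := by
    intro k
    refine (Real.volume_le_diam _).trans ?_
    refine ediam_le fun r hr r' hr' => ?_
    rw [edist_dist, Real.dist_eq]
    have : |r - r'| ≤ (2⁻¹ : ℝ) ^ k :=
      abs_le.2 ⟨by linarith [hdist k r hr r' hr'], hdist k r' hr' r hr⟩
    refine (ENNReal.ofReal_le_ofReal this).trans (le_of_eq ?_)
    rw [ENNReal.ofReal_pow (by norm_num), ENNReal.ofReal_inv_of_pos (by norm_num)]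
    norm_num
  calc _ ≤ volume (⋃ k, B k) := measure_mono hsub
    _ ≤ ∑' k, volume (B k) := measure_iUnion_le _
    _ ≤ ∑' k : ℕ, (2⁻¹ : ENNReal) ^ k := ENNReal.tsum_le_tsum hvol
    _ < ⊤ := by
      rw [ENNReal.tsum_geometric, ENNReal.one_sub_inv_two, inv_inv]
      exact ENNReal.ofNat_lt_top

/-- `φ ≤ o(T) + O(log)` in the weak sense needed for error terms: up to an arbitrarily small
multiple of `T + log`, outside a set of finite measure. -/
def IsSmallError (T φ : ℝ → ℝ) : Prop :=
  ∀ ε : ℝ, 0 < ε → ∃ (E : Set ℝ) (C : ℝ), MeasurableSet E ∧ volume E < ⊤ ∧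
    ∀ r : ℝ, 1 ≤ r → r ∉ E → φ r ≤ ε * (T r + Real.log r) + C

namespace IsSmallError

variable {T φ ψ : ℝ → ℝ}

lemma mono (h : IsSmallError T ψ) (hle : ∀ r, 1 ≤ r → φ r ≤ ψ r) : IsSmallError T φ :=
  fun ε hε => by
    obtain ⟨E, C, hE, hv, h⟩ := h ε hε
    exact ⟨E, C, hE, hv, fun r hr hrE => (hle r hr).trans (h r hr hrE)⟩

lemma const (hT : ∀ r, 1 ≤ r → 0 ≤ T r) (c : ℝ) : IsSmallError T fun _ => c :=
  fun ε hε => ⟨∅, c, MeasurableSet.empty, by simp, fun r hr _ =>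
    le_add_of_nonneg_left (mul_nonneg hε.le (add_nonneg (hT r hr) (Real.log_nonneg hr)))⟩

lemma add (h₁ : IsSmallError T φ) (h₂ : IsSmallError T ψ) : IsSmallError T fun r => φ r + ψ r :=
  fun ε hε => by
    obtain ⟨E₁, C₁, hE₁, hv₁, h₁⟩ := h₁ (ε / 2) (half_pos hε)
    obtain ⟨E₂, C₂, hE₂, hv₂, h₂⟩ := h₂ (ε / 2) (half_pos hε)
    refine ⟨E₁ ∪ E₂, C₁ + C₂, hE₁.union hE₂,
      (measure_union_le _ _).trans_lt (ENNReal.add_lt_top.2 ⟨hv₁, hv₂⟩), fun r hr hrE => ?_⟩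
    have a := h₁ r hr fun h => hrE (Or.inl h)
    have b := h₂ r hr fun h => hrE (Or.inr h)
    linarith

lemma sum {ι : Type*} (s : Finset ι) {φ : ι → ℝ → ℝ} (hT : ∀ r, 1 ≤ r → 0 ≤ T r)
    (h : ∀ i ∈ s, IsSmallError T (φ i)) : IsSmallError T fun r => ∑ i ∈ s, φ i r := by
  classical
  induction s using Finset.induction_on with
  | empty => simpa using const hT 0
  | insert a s ha ih =>
    simp only [Finset.sum_insert ha]
    exact (h a (Finset.mem_insert_self a s)).add
      (ih fun i hi => h i (Finset.mem_insert_of_mem hi))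

lemma of_le {T' : ℝ → ℝ} {a b : ℝ} (ha : 0 ≤ a) (hT' : ∀ r, 1 ≤ r → 0 ≤ T' r)
    (hle : ∀ r, 1 ≤ r → T r ≤ a * T' r + b) (h : IsSmallError T φ) : IsSmallError T' φ :=
  fun ε hε => by
    obtain ⟨E, C, hE, hv, h⟩ := h (ε / (a + 1)) (by positivity)
    refine ⟨E, C + ε / (a + 1) * b, hE, hv, fun r hr hrE => (h r hr hrE).trans ?_⟩
    have h1 : ε / (a + 1) * (T r + Real.log r) ≤
        ε / (a + 1) * ((a + 1) * (T' r + Real.log r) + b) := by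
      refine mul_le_mul_of_nonneg_left ?_ (by positivity)
      nlinarith [hle r hr, hT' r hr, mul_nonneg ha (Real.log_nonneg hr)]
    have h2 : ε / (a + 1) * ((a + 1) * (T' r + Real.log r) + b) =
        ε * (T' r + Real.log r) + ε / (a + 1) * b := by
      field_simp
    linarith

end IsSmallError

end Nevanlinna

end

/-! ### The lemma on the logarithmic derivative -/

noncomputable section

namespace Nevanlinna

open Complex Metric Set Filter Topology MeasureTheory ValueDistribution Real

/-- The first main theorem: `f` and 1/f have the same characteristic up to a constant, and |log|f||
is log⁺|f| + log⁺|1/f|. -/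
lemma exists_proximity_add_le {f : ℂ → ℂ} (hf : Meromorphic f) :
    ∃ C, 0 ≤ C ∧ ∀ r, 1 ≤ r →
      logCounting f 0 r + logCounting f ⊤ r ≤ 2 * ValueDistribution.characteristic f ⊤ r + C ∧
      Real.circleAverage (fun z => |Real.log ‖f z‖|) 0 r ≤
        2 * ValueDistribution.characteristic f ⊤ r + C := by
  set C := max |Real.log ‖f 0‖| |Real.log ‖meromorphicTrailingCoeffAt f 0‖| with hC
  refine ⟨C, le_max_of_le_left (abs_nonneg _), fun r hr => ?_⟩
  have h1 := characteristic_sub_characteristic_inv_le hf (R := r)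
  have h2 : ValueDistribution.characteristic f⁻¹ ⊤ r ≤ ValueDistribution.characteristic f ⊤ r + C := by
    have := (abs_le.1 h1).1
    linarith
  have h3 : ValueDistribution.characteristic f⁻¹ ⊤ r = proximity f⁻¹ ⊤ r + logCounting f 0 r := by
    rw [← logCounting_inv]; rfl
  have h4 : ValueDistribution.characteristic f ⊤ r = proximity f ⊤ r + logCounting f ⊤ r := rfl
  have p1 : 0 ≤ proximity f⁻¹ ⊤ r := proximity_nonneg r
  have p2 : 0 ≤ proximity f ⊤ r := proximity_nonneg r
  have p3 : 0 ≤ logCounting f 0 r := logCounting_nonneg hr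
  have p4 : 0 ≤ logCounting f ⊤ r := logCounting_nonneg hr
  refine ⟨by linarith, ?_⟩
  have h5 : Real.circleAverage (fun z => |Real.log ‖f z‖|) 0 r =
      proximity f ⊤ r + proximity f⁻¹ ⊤ r := by
    rw [proximity_top, proximity_top, ← Real.circleAverage_fun_add
      (MeromorphicOn.circleIntegrable_posLog_norm fun z _ => hf z)
      (MeromorphicOn.circleIntegrable_posLog_norm fun z _ => hf.inv z)]
    congr 1
    ext z
    have := Real.posLog_sub_posLog_inv (x := ‖f z‖)
    rw [abs_log_eq, Pi.inv_apply, norm_inv]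
    linarith
  linarith

lemma log_le_mul_add {A η : ℝ} (hA : 0 < A) (hη : 0 < η) :
    Real.log A ≤ η * A + Real.log η⁻¹ := by
  have := Real.log_le_sub_one_of_pos (mul_pos hη hA)
  rw [Real.log_mul hη.ne' hA.ne'] at this
  rw [Real.log_inv]
  linarith

/-- The growth function to which Borel's lemma is applied. -/
def growth (f : ℂ → ℂ) (r : ℝ) : ℝ := ValueDistribution.characteristic f ⊤ r + Real.log r + 1

lemma growth_monotoneOn {f : ℂ → ℂ} (hf : Meromorphic f) : MonotoneOn (growth f) (Ici 1) := by
  intro a ha b hb hab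
  have ha' : 0 < a := lt_of_lt_of_le one_pos ha
  have := characteristic_monotoneOn hf (mem_Ioi.2 ha') (mem_Ioi.2 (ha'.trans_le hab)) hab
  have := Real.log_le_log ha' hab
  unfold growth
  linarith

lemma one_le_growth (f : ℂ → ℂ) {r : ℝ} (hr : 1 ≤ r) : 1 ≤ growth f r := by
  have := characteristic_nonneg (f := f) (a := ⊤) hr
  have := Real.log_nonneg hr
  unfold growth
  linarith

/-- The set of radii at which the growth function jumps. -/
def badRadii (f : ℂ → ℂ) : Set ℝ :=
  {r | 1 ≤ r ∧ 2 * growth f r < growth f (r + (growth f r)⁻¹)}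

/-- The estimate on two circles is used with R = r + 1/(2A), where A is the growth function at `r`.
At a good radius the growth at R is at most 2A, so the arguments of the logarithms are bounded by
polynomials in A and the zero count. Only half of Borel's step 1/A is spent, leaving room to bound
that count by Jensen's formula. -/
lemma exists_proximity_le_log {f : ℂ → ℂ} (hf : Meromorphic f)
    (h : ∀ z, meromorphicOrderAt f z ≠ ⊤) (i : ℕ) :
    ∃ a C, 0 ≤ a ∧ ∀ r, 1 ≤ r → r ∉ badRadii f →
      proximity (iteratedDeriv i (logDeriv f)) ⊤ r ≤
        a * Real.log (1 + zeroPoleCount f (r + (growth f r)⁻¹ / 2)) + a * Real.log (growth f r)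
          + C := by
  obtain ⟨C₀, hC₀, hC⟩ := exists_proximity_add_le hf
  set K := kernelBound with hK
  have hK0 : 0 ≤ K := kernelBound_nonneg
  set c := (i.factorial : ℝ) * 16 * 4 ^ i * (7 + C₀) with hc
  have hc0 : 0 ≤ c := by positivity
  refine ⟨2 * i + 4, Real.log (1 + i.factorial) + 2 * (i + 1) * Real.log (1 + K) +
    Real.log (1 + c), by positivity, fun r hr hbad => ?_⟩
  set A := growth f r with hA
  have hA1 : 1 ≤ A := one_le_growth f hr
  have hA0 : 0 < A := by linarith
  set R := r + A⁻¹ / 2 with hR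
  set R' := r + A⁻¹ with hR'
  have hAi : 0 < A⁻¹ := inv_pos.2 hA0
  have hAi1 : A⁻¹ ≤ 1 := inv_le_one_of_one_le₀ hA1
  have hgood : growth f R' ≤ 2 * A := by
    by_contra! hcon
    exact hbad ⟨hr, hcon⟩
  have hrR : r < R := by rw [hR]; linarith
  have hR1 : 1 ≤ R := by linarith
  have hmono : growth f R ≤ 2 * A :=
    (growth_monotoneOn hf (mem_Ici.2 hR1) (mem_Ici.2 (by linarith)) (by rw [hR, hR']; linarith)).trans
      hgood
  have hlogR : Real.log R + ValueDistribution.characteristic f ⊤ R ≤ 2 * A - 1 := by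
    have : growth f R = ValueDistribution.characteristic f ⊤ R + Real.log R + 1 := rfl
    linarith
  have hTR := characteristic_nonneg (f := f) (a := ⊤) hR1
  have hlR := Real.log_nonneg hR1
  set n := zeroPoleCount f R with hn
  have hn0 : 0 ≤ n := zeroPoleCount_nonneg f R
  have hav := (hC R hR1).2
  have hmain := proximity_iteratedDeriv_logDeriv_le hf h hr hrR i
  rw [← hn] at hmain
  have hlA : 0 ≤ Real.log A := Real.log_nonneg hA1
  have hln : 0 ≤ Real.log (1 + n) := Real.log_nonneg (by linarith)
  have t1 : Real.log (1 + n * i.factorial) ≤ Real.log (1 + n) + Real.log (1 + i.factorial) := by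
    rw [← Real.log_mul (by positivity) (by positivity)]
    refine Real.log_le_log (by positivity) ?_
    have : (0 : ℝ) ≤ i.factorial := by positivity
    nlinarith
  have t2 : Real.log (1 + K * n) ≤ Real.log (1 + n) + Real.log (1 + K) := by
    rw [← Real.log_mul (by positivity) (by positivity)]
    refine Real.log_le_log (by positivity) ?_
    nlinarith
  have t3 : Real.log (1 + i.factorial * (8 / (R - r)) / ((R - r) / 2) ^ i *
      (Real.circleAverage (fun z => |Real.log ‖f z‖|) 0 R + n * (Real.log R + 2))) ≤
      Real.log (1 + c) + (i + 2) * Real.log A + Real.log (1 + n) := by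
    have e1 : R - r = A⁻¹ / 2 := by rw [hR]; ring
    have e2 : (i.factorial : ℝ) * (8 / (R - r)) / ((R - r) / 2) ^ i =
        i.factorial * 16 * 4 ^ i * A ^ (i + 1) := by
      rw [e1]
      have : A⁻¹ / 2 / 2 = (4 * A)⁻¹ := by field_simp; norm_num
      rw [this, inv_pow, div_inv_eq_mul, mul_pow]
      field_simp; ring
    have e3 : ((i : ℝ) + 2) * Real.log A = Real.log (A ^ (i + 2)) := by
      rw [Real.log_pow]; push_cast; ring
    rw [e2, e3, ← Real.log_mul (by positivity) (by positivity),
      ← Real.log_mul (by positivity) (by positivity)]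
    have hX : Real.circleAverage (fun z => |Real.log ‖f z‖|) 0 R + n * (Real.log R + 2) ≤
        (7 + C₀) * A * (1 + n) := by
      have h1 : Real.circleAverage (fun z => |Real.log ‖f z‖|) 0 R ≤ 4 * A + C₀ := by linarith
      have h2 : n * (Real.log R + 2) ≤ n * (2 * A + 1) :=
        mul_le_mul_of_nonneg_left (by linarith) hn0
      have h3 : 0 ≤ C₀ * (A - 1) := mul_nonneg hC₀ (by linarith)
      have h4 : 0 ≤ n * (A - 1) := mul_nonneg hn0 (by linarith)
      have h5 : 0 ≤ C₀ * A * n := by positivity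
      nlinarith
    have hX0 : 0 ≤ Real.circleAverage (fun z => |Real.log ‖f z‖|) 0 R + n * (Real.log R + 2) := by
      refine add_nonneg ?_ (by positivity)
      exact Real.circleAverage_nonneg_of_nonneg fun z hz => abs_nonneg _
    refine Real.log_le_log (by positivity) ?_
    have h1 : (i.factorial : ℝ) * 16 * 4 ^ i * A ^ (i + 1) *
        (Real.circleAverage (fun z => |Real.log ‖f z‖|) 0 R + n * (Real.log R + 2)) ≤
        c * A ^ (i + 2) * (1 + n) := by
      refine (mul_le_mul_of_nonneg_left hX (by positivity)).trans (le_of_eq ?_)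
      rw [hc]; ring
    have h2 : 1 ≤ A ^ (i + 2) := one_le_pow₀ hA1
    nlinarith
  have t2' := mul_le_mul_of_nonneg_left t2 (by positivity : 0 ≤ 2 * ((i : ℝ) + 1))
  have hi : (0 : ℝ) ≤ i := Nat.cast_nonneg i
  linarith [mul_nonneg hi hlA, mul_nonneg hi hln]

/-- With R = r + 1/(2A) and R' = r + 1/A, the count at R times log(R'/R) ≥ 1/(4Ar) is bounded by the
counting functions at R', hence by O(A). This costs 2 log A + log r. If the count is unbounded, log
r is absorbed by the dichotomy; otherwise the claim is immediate. -/
lemma exists_log_zeroPoleCount_le {f : ℂ → ℂ} (hf : Meromorphic f) {η : ℝ} (hη : 0 < η) :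
    ∃ C, ∀ r, 1 ≤ r → r ∉ badRadii f →
      Real.log (1 + zeroPoleCount f (r + (growth f r)⁻¹ / 2)) ≤
        2 * Real.log (growth f r) + η * ValueDistribution.characteristic f ⊤ r + C := by
  rcases zeroPoleCount_dichotomy hf with ⟨n₀, hn₀⟩ | hinf
  · refine ⟨Real.log (1 + n₀), fun r hr _ => ?_⟩
    have h1 : Real.log (1 + zeroPoleCount f (r + (growth f r)⁻¹ / 2)) ≤ Real.log (1 + n₀) :=
      Real.log_le_log (by linarith [zeroPoleCount_nonneg f (r + (growth f r)⁻¹ / 2)])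
        (by linarith [hn₀ (r + (growth f r)⁻¹ / 2)])
    have h2 := Real.log_nonneg (one_le_growth f hr)
    have h3 := mul_nonneg hη.le (characteristic_nonneg (f := f) (a := ⊤) hr)
    linarith
  · obtain ⟨C₀, hC₀, hC⟩ := exists_proximity_add_le hf
    obtain ⟨C₁, hC₁⟩ := hinf (2 / η) (by positivity)
    refine ⟨Real.log (17 + 4 * C₀) + η / 2 * (C₀ + C₁), fun r hr hbad => ?_⟩
    set A := growth f r with hA
    have hA1 : 1 ≤ A := one_le_growth f hr
    have hA0 : 0 < A := by linarith
    have hAi : 0 < A⁻¹ := inv_pos.2 hA0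
    have hAi1 : A⁻¹ ≤ 1 := inv_le_one_of_one_le₀ hA1
    set R := r + A⁻¹ / 2 with hR
    set R' := r + A⁻¹ with hR'
    have hgood : growth f R' ≤ 2 * A := by
      by_contra! hcon
      exact hbad ⟨hr, hcon⟩
    have hR1 : 1 ≤ R := by linarith
    have hRR : R ≤ R' := by linarith
    have hTR' : ValueDistribution.characteristic f ⊤ R' ≤ 2 * A := by
      have h1 : growth f R' = ValueDistribution.characteristic f ⊤ R' + Real.log R' + 1 := rfl
      have h2 := Real.log_nonneg (hR1.trans hRR)
      linarith
    have hn := zeroPoleCount_mul_log_le hf hR1 hRR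
    have hN := (hC R' (hR1.trans hRR)).1
    set n := zeroPoleCount f R with hndef
    have hn0 : 0 ≤ n := zeroPoleCount_nonneg f R
    have hlog : (4 * A * r)⁻¹ ≤ Real.log (R' / R) := by
      have h1 := Real.one_sub_inv_le_log_of_pos (div_pos (by linarith : 0 < R') (by linarith : 0 < R))
      refine le_trans ?_ h1
      have e : 1 - (R' / R)⁻¹ = (A⁻¹ / 2) / R' := by
        rw [inv_div]
        have : R' ≠ 0 := by linarith
        field_simp
        rw [hR, hR']
        field_simp
        ring
      have h2 : R' ≤ 2 * r := by linarith
      rw [e, show (4 * A * r)⁻¹ = A⁻¹ / 2 / (2 * r) by field_simp; norm_num]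
      gcongr
    have hn1 : n ≤ (4 * A + C₀) * (4 * A * r) := by
      have h1 : n * (4 * A * r)⁻¹ ≤ 4 * A + C₀ := by
        have := mul_le_mul_of_nonneg_left hlog hn0
        linarith
      have hp : 0 < 4 * A * r := by positivity
      rwa [← div_eq_mul_inv, div_le_iff₀ hp] at h1
    have hn2 : 1 + n ≤ (17 + 4 * C₀) * A ^ 2 * r := by
      have h1 : 1 ≤ A ^ 2 * r := by nlinarith
      have h2 : 0 ≤ C₀ * A * r * (A - 1) := mul_nonneg (by positivity) (by linarith)
      nlinarith
    have h1 : Real.log (1 + n) ≤ Real.log (17 + 4 * C₀) + 2 * Real.log A + Real.log r := by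
      refine (Real.log_le_log (by linarith) hn2).trans (le_of_eq ?_)
      rw [Real.log_mul (by positivity) (by positivity), Real.log_mul (by positivity)
        (by positivity), Real.log_pow]
      norm_num
    have h2 : Real.log r ≤
        η * ValueDistribution.characteristic f ⊤ r + η / 2 * (C₀ + C₁) := by
      have h3 := hC₁ r hr
      have h4 := (hC r hr).1
      have h5 : 2 / η * Real.log r ≤ 2 * ValueDistribution.characteristic f ⊤ r + C₀ + C₁ := by
        linarith
      rw [div_mul_eq_mul_div, div_le_iff₀ hη] at h5
      linarith
    linarith

/-- The lemma on the logarithmic derivative, for the derivatives of the logarithmic derivative. -/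
theorem isSmallError_proximity_iteratedDeriv_logDeriv {f : ℂ → ℂ} (hf : Meromorphic f)
    (h : ∀ z, meromorphicOrderAt f z ≠ ⊤) (i : ℕ) :
    IsSmallError (ValueDistribution.characteristic f ⊤)
      (proximity (iteratedDeriv i (logDeriv f)) ⊤) := by
  intro ε hε
  obtain ⟨a, C, ha, hprox⟩ := exists_proximity_le_log hf h i
  -- The term log A occurs with total weight 3a and is replaced by ηA + log(1/η); the zero count
  -- adds a·η times the characteristic.
  set η := ε / (4 * a + 4) with hη
  have hη0 : 0 < η := by positivity
  obtain ⟨C', hcount⟩ := exists_log_zeroPoleCount_le hf hη0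
  have hvol : volume (badRadii f) < ⊤ :=
    volume_growth_lt_top (growth_monotoneOn hf) fun r hr => one_le_growth f hr
  refine ⟨toMeasurable volume (badRadii f), a * C' + 3 * a * (η + Real.log η⁻¹) + C,
    measurableSet_toMeasurable _ _, by rwa [measure_toMeasurable], fun r hr hrE => ?_⟩
  have hbad : r ∉ badRadii f := fun hb => hrE (subset_toMeasurable _ _ hb)
  have h1 := hprox r hr hbad
  have h2 := hcount r hr hbad
  have h3 := log_le_mul_add (lt_of_lt_of_le one_pos (one_le_growth f hr)) hη0
  have hg : growth f r = ValueDistribution.characteristic f ⊤ r + Real.log r + 1 := rfl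
  have hT := characteristic_nonneg (f := f) (a := ⊤) hr
  have hl := Real.log_nonneg hr
  have h4 := mul_le_mul_of_nonneg_left h2 ha
  have h5 := mul_le_mul_of_nonneg_left h3 (by positivity : 0 ≤ 3 * a)
  have h6 : (4 * a + 4) * η = ε := by rw [hη]; field_simp
  rw [hg] at h1 h3 h4 h5
  have h7 := mul_nonneg hη0.le hl
  have h8 := mul_nonneg hη0.le hT
  have h9 := mul_nonneg ha h7
  rw [← h6]
  nlinarith

lemma meromorphic_iteratedDeriv {f : ℂ → ℂ} (hf : Meromorphic f) (k : ℕ) :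
    Meromorphic (iteratedDeriv k f) := by
  rw [iteratedDeriv_eq_iterate]
  exact hf.iterated_deriv

/-- The lemma on the logarithmic derivative for higher derivatives. -/
theorem isSmallError_proximity_iteratedDeriv_div {f : ℂ → ℂ} (hf : Meromorphic f)
    (h : ∀ z, meromorphicOrderAt f z ≠ ⊤) (k : ℕ) :
    IsSmallError (ValueDistribution.characteristic f ⊤)
      (proximity (iteratedDeriv k f / f) ⊤) := by
  have hT : ∀ r, 1 ≤ r → 0 ≤ ValueDistribution.characteristic f ⊤ r := fun r hr =>
    characteristic_nonneg hr
  have hlog : Meromorphic (logDeriv f) := hf.deriv.div hf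
  induction k using Nat.strong_induction_on with
  | _ k ih =>
  rcases k with _ | k
  · refine (IsSmallError.const hT 0).mono fun r hr => ?_
    rw [proximity_top]
    refine Real.circleAverage_mono_on_of_le_circle
      (MeromorphicOn.circleIntegrable_posLog_norm fun z _ => hf.div hf z) fun z _ => ?_
    have : ‖(f / f) z‖ ≤ 1 := by
      by_cases hz : f z = 0 <;> simp [hz]
    simp only [iteratedDeriv_zero]
    rw [(Real.posLog_eq_zero_iff _).2 (by rwa [abs_of_nonneg (norm_nonneg _)])]
  -- Leibniz's rule for f' = f·(f'/f) expresses f^(k+1)/f through lower quotients f^(i)/f and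
  -- derivatives of f'/f, off a discrete set.
  · set G : ℕ → ℂ → ℂ := fun i => (fun _ => (k.choose i : ℂ)) *
      ((iteratedDeriv i f / f) * iteratedDeriv (k - i) (logDeriv f)) with hG
    have hGm : ∀ i ∈ Finset.range (k + 1), Meromorphic (G i) := fun i _ =>
      Meromorphic.mul (fun z => MeromorphicAt.const _ z)
        (((meromorphic_iteratedDeriv hf i).div hf).mul (meromorphic_iteratedDeriv hlog _))
    have hcod : (iteratedDeriv (k + 1) f / f) =ᶠ[codiscrete ℂ]
        ∑ i ∈ Finset.range (k + 1), G i := by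
      have h1 := (meromorphicOn_univ.2 hf).analyticAt_mem_codiscreteWithin
      have h2 := (meromorphicOn_univ.2 hf).eventually_codiscreteWithin_apply_ne_zero
        fun z _ => h z
      filter_upwards [h1, h2] with z hz hz0
      have hd : deriv f =ᶠ[𝓝 z] f * logDeriv f := by
        filter_upwards [hz.continuousAt.eventually_ne hz0] with w hw
        simp only [Pi.mul_apply, logDeriv_apply]
        field_simp
      have hlz : AnalyticAt ℂ (logDeriv f) z := hz.deriv.div hz hz0
      rw [Pi.div_apply, iteratedDeriv_succ', hd.iteratedDeriv_eq,
        iteratedDeriv_mul hz.contDiffAt hlz.contDiffAt, Finset.sum_div, Finset.sum_apply]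
      refine Finset.sum_congr rfl fun i _ => ?_
      simp only [hG, Pi.mul_apply, Pi.div_apply]
      ring
    have hsum := IsSmallError.sum (Finset.range (k + 1)) (φ := fun i => fun r =>
      proximity (fun _ : ℂ => (k.choose i : ℂ)) ⊤ r + (proximity (iteratedDeriv i f / f) ⊤ r +
        proximity (iteratedDeriv (k - i) (logDeriv f)) ⊤ r)) hT fun i hi => by
      refine IsSmallError.add ?_ ((ih i (by simpa using hi)).add
        (isSmallError_proximity_iteratedDeriv_logDeriv hf h (k - i)))
      exact (IsSmallError.const hT (log⁺ ‖(k.choose i : ℂ)‖)).mono fun r _ => proximity_const.le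
    refine (hsum.add (IsSmallError.const hT (Real.log (Finset.range (k + 1)).card))).mono
      fun r hr => ?_
    rw [proximity_congr_codiscrete hcod (by linarith)]
    refine (proximity_sum_top_le _ _ hGm r).trans ?_
    simp only [Pi.add_apply, Finset.sum_apply]
    refine add_le_add (Finset.sum_le_sum fun i hi => ?_) le_rfl
    have hc : Meromorphic fun _ : ℂ => (k.choose i : ℂ) := fun z => MeromorphicAt.const _ z
    have hm := (meromorphic_iteratedDeriv hf i).div hf
    have hm' := meromorphic_iteratedDeriv hlog (k - i)
    exact (proximity_mul_top_le hc (hm.mul hm') r).trans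
      (add_le_add le_rfl (proximity_mul_top_le hm hm' r))

end Nevanlinna

end

/-! ### Wronskians -/

noncomputable section

namespace Nevanlinna

open Metric Set Filter Topology

/-- The Wronskian of a family of functions. -/
def wronskian {k : ℕ} (b : Fin k → ℂ → ℂ) (z : ℂ) : ℂ :=
  (Matrix.of fun i j : Fin k => iteratedDeriv i (b j) z).det

lemma analyticAt_iteratedDeriv {f : ℂ → ℂ} {z : ℂ} (hf : AnalyticAt ℂ f z) (i : ℕ) :
    AnalyticAt ℂ (iteratedDeriv i f) z := by
  rw [iteratedDeriv_eq_iterate]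
  exact hf.iterated_deriv i

lemma analyticAt_det {k : ℕ} {m : ℂ → Matrix (Fin k) (Fin k) ℂ} {z : ℂ}
    (hm : ∀ i j, AnalyticAt ℂ (fun z => m z i j) z) : AnalyticAt ℂ (fun z => (m z).det) z := by
  simp only [Matrix.det_apply]
  refine Finset.analyticAt_fun_sum _ fun σ _ => ?_
  simp only [Units.smul_def, zsmul_eq_mul]
  exact analyticAt_const.mul (Finset.analyticAt_fun_prod _ fun i _ => hm _ _)

lemma analyticAt_wronskian {k : ℕ} {b : Fin k → ℂ → ℂ} {z : ℂ} (hb : ∀ j, AnalyticAt ℂ (b j) z) :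
    AnalyticAt ℂ (wronskian b) z :=
  analyticAt_det fun i j => analyticAt_iteratedDeriv (hb j) i

lemma wronskian_congr {k : ℕ} {b b' : Fin k → ℂ → ℂ} {z : ℂ} (h : ∀ j, b j =ᶠ[𝓝 z] b' j) :
    wronskian b z = wronskian b' z := by
  unfold wronskian
  congr 1
  ext i j
  exact (h j).iteratedDeriv_eq i

/-- The Wronskian is multiplied by a determinant under linear combinations. -/
lemma wronskian_linear {k : ℕ} {b : Fin k → ℂ → ℂ} {z : ℂ} (hb : ∀ j, AnalyticAt ℂ (b j) z)
    (c : Matrix (Fin k) (Fin k) ℂ) :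
    wronskian (fun j => ∑ i, c i j • b i) z = wronskian b z * c.det := by
  unfold wronskian
  rw [← Matrix.det_mul]
  congr 1
  ext i j
  have e : (∑ l, c l j • b l) = fun z => ∑ l, c l j * b l z := by ext z; simp
  rw [Matrix.of_apply, Matrix.mul_apply]
  beta_reduce
  rw [e, iteratedDeriv_fun_sum fun l _ =>
    contDiffAt_const.mul (hb l).contDiffAt]
  refine Finset.sum_congr rfl fun l _ => ?_
  rw [iteratedDeriv_const_mul_field, Matrix.of_apply, mul_comm]

/-- The Wronskian of a family of multiples of one function. -/
lemma wronskian_mul {k : ℕ} {h : ℂ → ℂ} {b : Fin k → ℂ → ℂ} {z : ℂ} (hh : AnalyticAt ℂ h z)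
    (hb : ∀ j, AnalyticAt ℂ (b j) z) :
    wronskian (fun j => h * b j) z = h z ^ k * wronskian b z := by
  -- Leibniz's rule as a lower triangular matrix with `h z` on the diagonal.
  set A : Matrix (Fin k) (Fin k) ℂ := Matrix.of fun i l =>
    if l ≤ i then ((i : ℕ).choose l : ℂ) * iteratedDeriv ((i : ℕ) - l) h z else 0 with hA
  have hdet : A.det = h z ^ k := by
    rw [Matrix.det_of_isLowerTriangular]
    · simp [hA]
    · intro i j hij
      have : ¬ j ≤ i := not_le.2 (OrderDual.toDual_lt_toDual.1 hij)
      simp [hA, this]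
  unfold wronskian
  rw [← hdet, ← Matrix.det_mul]
  congr 1
  ext i j
  rw [Matrix.of_apply, Matrix.mul_apply]
  beta_reduce
  rw [mul_comm h, iteratedDeriv_mul (hb j).contDiffAt
    hh.contDiffAt]
  have h1 : ∀ l : Fin k, A i l * (Matrix.of fun i j : Fin k => iteratedDeriv i (b j) z) l j =
      (fun l : ℕ => if l ≤ i then ((i : ℕ).choose l : ℂ) * iteratedDeriv l (b j) z *
        iteratedDeriv ((i : ℕ) - l) h z else 0) l := by
    intro l
    simp only [hA, Matrix.of_apply, Fin.le_def]
    split_ifs <;> ring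
  simp only [h1]
  rw [Fin.sum_univ_eq_sum_range (fun l : ℕ => if l ≤ i then ((i : ℕ).choose l : ℂ) *
    iteratedDeriv l (b j) z * iteratedDeriv ((i : ℕ) - l) h z else 0), ← Finset.sum_filter]
  refine Finset.sum_congr ?_ fun _ _ => rfl
  ext l
  have := i.isLt
  simp only [Finset.mem_range, Finset.mem_filter]
  omega

lemma wronskian_cons_one {k : ℕ} (g : Fin k → ℂ → ℂ) (z : ℂ) :
    wronskian (Fin.cons 1 g : Fin (k + 1) → ℂ → ℂ) z = wronskian (fun j => deriv (g j)) z := by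
  unfold wronskian
  rw [Matrix.det_succ_column_zero, Finset.sum_eq_single 0]
  · have h0 : (Matrix.of fun i j : Fin (k + 1) =>
        iteratedDeriv i ((Fin.cons 1 g : Fin (k + 1) → ℂ → ℂ) j) z) 0 0 = 1 := by simp
    rw [h0]
    simp only [Fin.val_zero, pow_zero, one_mul]
    congr 1
    ext i j
    simp [iteratedDeriv_succ']
  · intro i _ hi
    obtain ⟨i', rfl⟩ := Fin.exists_succ_eq.2 hi
    have : iteratedDeriv (i' + 1) (1 : ℂ → ℂ) z = 0 := by
      rw [show (1 : ℂ → ℂ) = fun _ => 1 from rfl, iteratedDeriv_const]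
      simp
    simp [this]
  · simp

/-- Analytic functions on a disc with vanishing Wronskian are linearly dependent. -/
lemma exists_sum_eq_zero_of_wronskian_eq_zero {k : ℕ} {b : Fin k → ℂ → ℂ} {z₀ : ℂ} {ρ : ℝ}
    (hρ : 0 < ρ) (hb : ∀ j, AnalyticOnNhd ℂ (b j) (ball z₀ ρ))
    (hW : ∀ z ∈ ball z₀ ρ, wronskian b z = 0) :
    ∃ c : Fin k → ℂ, c ≠ 0 ∧ ∀ z ∈ ball z₀ ρ, ∑ j, c j * b j z = 0 := by
  induction k generalizing z₀ ρ with
  | zero => simpa [wronskian] using hW z₀ (mem_ball_self hρ)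
  | succ k ih =>
    by_cases h0 : ∀ z ∈ ball z₀ ρ, b 0 z = 0
    · refine ⟨Pi.single 0 1, by simp, fun z hz => ?_⟩
      simp [Fin.sum_univ_succ, h0 z hz]
    push Not at h0
    obtain ⟨z₁, hz₁, hb1⟩ := h0
    have hev : ∀ᶠ z in 𝓝 z₁, b 0 z ≠ 0 ∧ z ∈ ball z₀ ρ :=
      ((hb 0 z₁ hz₁).continuousAt.eventually_ne hb1).and (isOpen_ball.eventually_mem hz₁)
    obtain ⟨σ, hσ, hball⟩ := Metric.eventually_nhds_iff_ball.1 hev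
    -- On a smaller disc where `b 0` has no zeros, division by it reduces to the Wronskian of the
    -- derivatives of the quotients. A relation among these integrates to one with an additive
    -- constant, the coefficient of `b 0`; the identity theorem extends it to the whole disc.
    set g : Fin k → ℂ → ℂ := fun j => b j.succ / b 0 with hg
    have hga : ∀ j, AnalyticOnNhd ℂ (g j) (ball z₁ σ) := fun j z hz =>
      (hb _ z (hball z hz).2).div (hb 0 z (hball z hz).2) (hball z hz).1
    have hbg : ∀ z ∈ ball z₁ σ, ∀ j, b j z =
        (b 0 * (Fin.cons 1 g : Fin (k + 1) → ℂ → ℂ) j) z := by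
      intro z hz j
      refine Fin.cases ?_ (fun j => ?_) j
      · simp
      · simp only [Fin.cons_succ, hg, Pi.mul_apply, Pi.div_apply]
        field_simp [(hball z hz).1]
    have hWg : ∀ z ∈ ball z₁ σ, wronskian (fun j => deriv (g j)) z = 0 := by
      intro z hz
      have h1 : wronskian b z = wronskian (fun j =>
          b 0 * (Fin.cons 1 g : Fin (k + 1) → ℂ → ℂ) j) z :=
        wronskian_congr fun j => (isOpen_ball.eventually_mem hz).mono fun w hw => hbg w hw j
      rw [hW z (hball z hz).2, wronskian_mul (hb 0 z (hball z hz).2)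
        (fun j => Fin.cases analyticAt_const (fun j => hga j z hz) j), wronskian_cons_one] at h1
      exact (mul_eq_zero.1 h1.symm).resolve_left (pow_ne_zero _ (hball z hz).1)
    obtain ⟨c, hc0, hc⟩ := ih hσ (fun j => (hga j).deriv) hWg
    have hder : EqOn (deriv fun z => ∑ j, c j * g j z) 0 (ball z₁ σ) := by
      intro z hz
      rw [deriv_fun_sum fun j _ => ((hga j z hz).differentiableAt.const_mul _)]
      simp only [Pi.zero_apply]
      rw [← hc z hz]
      exact Finset.sum_congr rfl fun j _ => deriv_const_mul_field _
    obtain ⟨a, ha⟩ := isOpen_ball.exists_is_const_of_deriv_eq_zero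
      (convex_ball z₁ σ).isPreconnected (fun z hz => (DifferentiableAt.fun_sum fun j _ =>
        ((hga j z hz).differentiableAt.const_mul (c j))).differentiableWithinAt) hder
    refine ⟨Fin.cons (-a) c, fun h => hc0 ?_, ?_⟩
    · ext j
      simpa using congrFun h j.succ
    · have hana : AnalyticOnNhd ℂ (fun z => ∑ j, (Fin.cons (-a) c : Fin (k + 1) → ℂ) j * b j z)
          (ball z₀ ρ) := fun z hz =>
        Finset.analyticAt_fun_sum _ fun j _ => analyticAt_const.mul (hb j z hz)
      refine hana.eqOn_zero_of_preconnected_of_eventuallyEq_zero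
        (convex_ball z₀ ρ).isPreconnected hz₁ ?_
      filter_upwards [isOpen_ball.eventually_mem (mem_ball_self hσ)] with z hz
      have h1 := ha z hz
      have h2 : ∀ j : Fin k, b j.succ z = b 0 z * g j z := fun j => by
        simpa using hbg z hz j.succ
      rw [Fin.sum_univ_succ]
      simp only [Fin.cons_zero, Fin.cons_succ, h2, Pi.zero_apply]
      rw [← h1, neg_mul, Finset.sum_mul, neg_add_eq_zero]
      exact Finset.sum_congr rfl fun j _ => by ring

lemma exists_wronskian_ne_zero {k : ℕ} {b : Fin k → ℂ → ℂ} (hb : ∀ j, Differentiable ℂ (b j))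
    (hli : LinearIndependent ℂ b) : ∃ z, wronskian b z ≠ 0 := by
  by_contra! hW
  have hba : ∀ j z, AnalyticAt ℂ (b j) z := fun j z => (hb j).analyticAt z
  obtain ⟨c, hc0, hc⟩ := exists_sum_eq_zero_of_wronskian_eq_zero one_pos
    (fun j z (_ : z ∈ ball (0 : ℂ) 1) => hba j z) fun z _ => hW z
  have hana : AnalyticOnNhd ℂ (fun z => ∑ j, c j * b j z) univ := fun z _ =>
    Finset.analyticAt_fun_sum _ fun j _ => analyticAt_const.mul (hba j z)
  have h := hana.eqOn_zero_of_preconnected_of_eventuallyEq_zero isPreconnected_univ (mem_univ 0)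
    ((isOpen_ball.eventually_mem (mem_ball_self (x := (0 : ℂ)) one_pos)).mono hc)
  refine hc0 (funext fun j => Fintype.linearIndependent_iff.1 hli c ?_ j)
  ext z
  simpa using h (mem_univ z)

/-- The vanishing order of the Wronskian. -/
lemma sum_tsub_le_analyticOrderAt_wronskian {k M : ℕ} (hk : k ≤ M + 1) {b : Fin k → ℂ → ℂ} {u : ℂ}
    (hb : ∀ j, AnalyticAt ℂ (b j) u) {ν : Fin k → ℕ}
    (hν : ∀ j, (ν j : ℕ∞) ≤ analyticOrderAt (b j) u) :
    ((∑ j, (ν j - M) : ℕ) : ℕ∞) ≤ analyticOrderAt (wronskian b) u := by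
  have hent : ∀ i j : Fin k, ∃ h : ℂ → ℂ, AnalyticAt ℂ h u ∧
      ∀ᶠ z in 𝓝 u, iteratedDeriv i (b j) z = (z - u) ^ (ν j - M) * h z := by
    intro i j
    -- Rows are differentiated at most k - 1 ≤ M times, so every entry of column `j` keeps at least
    -- ν_j - M zeros. This is the source of the truncation level.
    have h1 : ((ν j - M : ℕ) : ℕ∞) ≤ analyticOrderAt (iteratedDeriv i (b j)) u := by
      rw [natCast_le_analyticOrderAt_iff_iteratedDeriv_eq_zero (analyticAt_iteratedDeriv (hb j) i)]
      intro l hl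
      have h2 := (natCast_le_analyticOrderAt_iff_iteratedDeriv_eq_zero (hb j)).1 (hν j) (l + i)
        (by have := i.isLt; omega)
      rw [iteratedDeriv_eq_iterate, iteratedDeriv_eq_iterate, ← Function.iterate_add_apply,
        ← iteratedDeriv_eq_iterate, h2]
    simpa using (natCast_le_analyticOrderAt (analyticAt_iteratedDeriv (hb j) i)).1 h1
  choose h hh hhe using hent
  rw [natCast_le_analyticOrderAt (analyticAt_wronskian hb)]
  refine ⟨fun z => (Matrix.of fun i j => h i j z).det, analyticAt_det fun i j => hh i j, ?_⟩
  have hall : ∀ᶠ z in 𝓝 u, ∀ i j : Fin k,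
      iteratedDeriv i (b j) z = (z - u) ^ (ν j - M) * h i j z :=
    eventually_all.2 fun i => eventually_all.2 fun j => hhe i j
  filter_upwards [hall] with z hz
  have : (Matrix.of fun i j : Fin k => iteratedDeriv i (b j) z) =
      Matrix.of fun i j => (fun j => (z - u) ^ (ν j - M)) j * (Matrix.of fun i j => h i j z) i j := by
    ext i j
    exact hz i j
  rw [wronskian, this, Matrix.det_mul_row, Finset.prod_pow_eq_pow_sum, smul_eq_mul]

/-- The quotient of the Wronskian by the product of the functions, in terms of the quotients by
one of them. -/
lemma wronskian_div_prod {k : ℕ} {b : Fin k → ℂ → ℂ} {h : ℂ → ℂ} {z : ℂ} (hh : AnalyticAt ℂ h z)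
    (hh0 : h z ≠ 0) (hb : ∀ j, AnalyticAt ℂ (b j) z) :
    wronskian b z / ∏ j, b j z =
      (Matrix.of fun i j : Fin k => iteratedDeriv i (b j / h) z / (b j / h) z).det := by
  have hg : ∀ j, AnalyticAt ℂ (b j / h) z := fun j => (hb j).div hh hh0
  have h1 : wronskian b z = h z ^ k * wronskian (fun j => b j / h) z := by
    rw [← wronskian_mul hh hg]
    refine wronskian_congr fun j => ?_
    filter_upwards [hh.continuousAt.eventually_ne hh0] with w hw
    simp only [Pi.mul_apply, Pi.div_apply]
    field_simp
  have h2 : ∏ j, b j z = h z ^ k * ∏ j, (b j / h) z := by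
    rw [← Fin.prod_const, ← Finset.prod_mul_distrib]
    refine Finset.prod_congr rfl fun j _ => ?_
    simp only [Pi.div_apply]
    field_simp
  rw [h1, h2, mul_div_mul_left _ _ (pow_ne_zero _ hh0)]
  have h3 : (Matrix.of fun i j : Fin k => iteratedDeriv i (b j / h) z / (b j / h) z) =
      Matrix.of fun i j => (fun j => ((b j / h) z)⁻¹) j *
        (Matrix.of fun i j : Fin k => iteratedDeriv i (b j / h) z) i j := by
    ext i j
    simp only [Matrix.of_apply]
    rw [div_eq_inv_mul]
  rw [h3, Matrix.det_mul_row, Finset.prod_inv_distrib, wronskian, div_eq_inv_mul]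

end Nevanlinna

end

/-! ### The lemma on the logarithmic derivative for Wronskians -/

noncomputable section

namespace Nevanlinna

open Metric Set Filter Topology ValueDistribution Real

/-- Circles may pass through zeros of the functions involved, where the pointwise estimates fail. -/
lemma circleAverage_mono_codiscrete {f₁ f₂ : ℂ → ℝ} {r : ℝ} (hr : r ≠ 0)
    (h₁ : CircleIntegrable f₁ 0 r) (h₂ : CircleIntegrable f₂ 0 r)
    (h : ∀ᶠ z in codiscrete ℂ, f₁ z ≤ f₂ z) :
    Real.circleAverage f₁ 0 r ≤ Real.circleAverage f₂ 0 r := by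
  have he : f₁ =ᶠ[codiscreteWithin (sphere 0 |r|)] fun z => min (f₁ z) (f₂ z) := by
    filter_upwards [Filter.codiscreteWithin_mono (subset_univ _) h] with z hz
    exact (min_eq_left hz).symm
  rw [Real.circleAverage_congr_codiscreteWithin he hr]
  exact Real.circleAverage_mono (h₁.congr_codiscreteWithin he) h₂ fun z _ => min_le_right _ _

lemma _root_.Differentiable.meromorphic {h : ℂ → ℂ} (hh : Differentiable ℂ h) : Meromorphic h :=
  fun z => (hh.analyticAt z).meromorphicAt

lemma analyticOrderAt_ne_top_of_ne_zero {h : ℂ → ℂ} (hh : Differentiable ℂ h) (h0 : h ≠ 0) (z : ℂ) :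
    analyticOrderAt h z ≠ ⊤ := fun ht =>
  h0 ((AnalyticOnNhd.analyticOrderAt_eq_top_iff_eq_zero z fun w => hh.analyticAt w).1 ht)

lemma meromorphicOrderAt_ne_top_of_ne_zero {h : ℂ → ℂ} (hh : Differentiable ℂ h) (h0 : h ≠ 0)
    (z : ℂ) : meromorphicOrderAt h z ≠ ⊤ := by
  rw [(hh.analyticAt z).meromorphicOrderAt_eq, Ne, ENat.map_eq_top_iff]
  exact analyticOrderAt_ne_top_of_ne_zero hh h0 z

lemma eventually_codiscrete_ne_zero {h : ℂ → ℂ} (hh : Differentiable ℂ h) (h0 : h ≠ 0) :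
    ∀ᶠ z in codiscrete ℂ, h z ≠ 0 := by
  obtain ⟨x, hx⟩ := Function.ne_iff.1 h0
  exact AnalyticOnNhd.preimage_zero_mem_codiscrete (fun z _ => hh.analyticAt z) hx

lemma divisor_apply_eq {h : ℂ → ℂ} (hh : Differentiable ℂ h) (z : ℂ) :
    MeromorphicOn.divisor h univ z = (analyticOrderNatAt h z : ℤ) := by
  rw [MeromorphicOn.divisor_apply (fun z _ => hh.meromorphic z) (mem_univ z),
    (hh.analyticAt z).meromorphicOrderAt_eq, analyticOrderNatAt]
  cases analyticOrderAt h z <;> rfl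

lemma divisor_nonneg {h : ℂ → ℂ} (hh : Differentiable ℂ h) :
    0 ≤ MeromorphicOn.divisor h univ := fun z => by
  rw [divisor_apply_eq hh]
  exact Int.natCast_nonneg _

lemma logCounting_top_eq_zero {h : ℂ → ℂ} (hh : Differentiable ℂ h) : logCounting h ⊤ = 0 := by
  rw [logCounting_top, negPart_eq_zero.2 (divisor_nonneg hh), map_zero]

lemma logCounting_zero_eq {h : ℂ → ℂ} (hh : Differentiable ℂ h) {r : ℝ} (hr : r ≠ 0) :
    logCounting h 0 r = Real.circleAverage (fun z => Real.log ‖h z‖) 0 r -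
      Real.log ‖meromorphicTrailingCoeffAt h 0‖ := by
  have := logCounting_zero_sub_logCounting_top_eq_circleAverage_sub_const hh.meromorphic hr
  rwa [logCounting_top_eq_zero hh, sub_zero] at this

lemma circleIntegrable_log_of_pos {Φ : ℂ → ℝ} (hΦ : Continuous Φ) (hΦ0 : ∀ z, 0 < Φ z) (r : ℝ) :
    CircleIntegrable (fun z => Real.log (Φ z)) 0 r :=
  ((hΦ.log fun z => (hΦ0 z).ne').continuousOn).circleIntegrable'

/-- The growth of a quotient of entire functions is bounded by that of a common majorant. -/
lemma exists_characteristic_div_le {b h : ℂ → ℂ} {Φ : ℂ → ℝ} (hΦ : Continuous Φ)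
    (hΦ0 : ∀ z, 0 < Φ z) (hb : Differentiable ℂ b) (hh : Differentiable ℂ h) (hb0 : b ≠ 0)
    (hh0 : h ≠ 0) (hbΦ : ∀ z, ‖b z‖ ≤ Φ z) (hhΦ : ∀ z, ‖h z‖ ≤ Φ z) :
    ∃ C, ∀ r, 1 ≤ r → ValueDistribution.characteristic (b / h) ⊤ r ≤
      Real.circleAverage (fun z => Real.log (Φ z)) 0 r + C := by
  refine ⟨- Real.log ‖meromorphicTrailingCoeffAt h 0‖, fun r hr => ?_⟩
  have hr0 : r ≠ 0 := by positivity
  have hN : logCounting (b / h) ⊤ r ≤ logCounting h 0 r := by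
    have := logCounting_mul_top_le hr hb.meromorphic
      (fun z => meromorphicOrderAt_ne_top_of_ne_zero hb hb0 z) hh.meromorphic.inv
      (fun z => by
        rw [meromorphicOrderAt_inv]
        simpa using meromorphicOrderAt_ne_top_of_ne_zero hh hh0 z)
    rw [div_eq_mul_inv]
    simpa [logCounting_top_eq_zero hb, logCounting_inv] using this
  rw [logCounting_zero_eq hh hr0] at hN
  have hbh : Meromorphic (b / h) := hb.meromorphic.div hh.meromorphic
  have hi1 : CircleIntegrable (fun z => log⁺ ‖(b / h) z‖) 0 r :=
    MeromorphicOn.circleIntegrable_posLog_norm fun z _ => hbh z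
  have hi2 : CircleIntegrable (fun z => Real.log ‖h z‖) 0 r :=
    MeromorphicOn.circleIntegrable_log_norm fun z _ => hh.meromorphic z
  -- Off the zeros of `h` the integrand is log max(|b|, |h|).
  have hP : Real.circleAverage (fun z => log⁺ ‖(b / h) z‖ + Real.log ‖h z‖) 0 r ≤
      Real.circleAverage (fun z => Real.log (Φ z)) 0 r := by
    refine circleAverage_mono_codiscrete hr0 (hi1.add hi2)
      (circleIntegrable_log_of_pos hΦ hΦ0 r) ?_
    filter_upwards [eventually_codiscrete_ne_zero hh hh0] with z hz
    have hz' : 0 < ‖h z‖ := norm_pos_iff.2 hz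
    rw [Real.posLog_eq_log_max_one (norm_nonneg _), ← Real.log_mul (by positivity) hz'.ne']
    refine Real.log_le_log (by positivity) ?_
    rw [Pi.div_apply, norm_div, max_mul_of_nonneg _ _ hz'.le, one_mul, div_mul_cancel₀ _ hz'.ne']
    exact max_le (hhΦ z) (hbΦ z)
  rw [Real.circleAverage_fun_add hi1 hi2] at hP
  have : ValueDistribution.characteristic (b / h) ⊤ r =
    proximity (b / h) ⊤ r + logCounting (b / h) ⊤ r := rfl
  rw [this, proximity_top]
  linarith

/-- The mean of log Φ may be negative, while the calculus of small errors needs a nonnegative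
comparison function; a constant shift suffices. -/
lemma exists_neg_le_circleAverage_log {h : ℂ → ℂ} {Φ : ℂ → ℝ} (hΦ : Continuous Φ)
    (hΦ0 : ∀ z, 0 < Φ z) (hh : Differentiable ℂ h) (hh0 : h ≠ 0) (hhΦ : ∀ z, ‖h z‖ ≤ Φ z) :
    ∃ c, ∀ r, 1 ≤ r → 0 ≤ Real.circleAverage (fun z => Real.log (Φ z)) 0 r + c := by
  obtain ⟨C, hC⟩ := exists_characteristic_div_le hΦ hΦ0 hh hh hh0 hh0 hhΦ hhΦ
  exact ⟨C, fun r hr => (characteristic_nonneg hr).trans (hC r hr)⟩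

lemma proximity_prod_top_le {ι : Type*} (s : Finset ι) {f : ι → ℂ → ℂ}
    (hf : ∀ i ∈ s, Meromorphic (f i)) (r : ℝ) :
    proximity (∏ i ∈ s, f i) ⊤ r ≤ ∑ i ∈ s, proximity (f i) ⊤ r := by
  classical
  induction s using Finset.induction_on with
  | empty =>
    have : (∏ i ∈ (∅ : Finset ι), f i) = fun _ => (1 : ℂ) := rfl
    rw [this, proximity_const]
    simp
  | insert a s ha ih =>
    rw [Finset.prod_insert ha, Finset.sum_insert ha]
    have hs : ∀ i ∈ s, Meromorphic (f i) := fun i hi => hf i (Finset.mem_insert_of_mem hi)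
    refine (proximity_mul_top_le (hf a (Finset.mem_insert_self a s)) ?_ r).trans
      (add_le_add le_rfl (ih hs))
    exact Meromorphic.prod hs

/-- The logarithmic derivative lemma for Wronskians. -/
theorem isSmallError_proximity_wronskian_div {M : ℕ} {b : Fin (M + 1) → ℂ → ℂ} {Φ : ℂ → ℝ} {c : ℝ}
    (hΦ : Continuous Φ) (hΦ0 : ∀ z, 0 < Φ z) (hb : ∀ j, Differentiable ℂ (b j))
    (hb0 : ∀ j, b j ≠ 0) (hbΦ : ∀ j z, ‖b j z‖ ≤ Φ z)
    (hc : ∀ r, 1 ≤ r → 0 ≤ Real.circleAverage (fun z => Real.log (Φ z)) 0 r + c) :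
    IsSmallError (fun r => Real.circleAverage (fun z => Real.log (Φ z)) 0 r + c)
      (proximity (fun z => wronskian b z / ∏ j, b j z) ⊤) := by
  -- Division by a common function does not change the ratio of the Wronskian to the product, and
  -- the characteristics of the quotients are bounded by the mean of log Φ.
  set g : Fin (M + 1) → ℂ → ℂ := fun j => b j / b 0 with hg
  have hgm : ∀ j, Meromorphic (g j) := fun j => (hb j).meromorphic.div (hb 0).meromorphic
  have hgo : ∀ j z, meromorphicOrderAt (g j) z ≠ ⊤ := fun j z => by
    rw [hg]
    simp only
    rw [div_eq_mul_inv, meromorphicOrderAt_mul ((hb j).meromorphic z) ((hb 0).meromorphic z).inv,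
      meromorphicOrderAt_inv]
    simpa using ⟨meromorphicOrderAt_ne_top_of_ne_zero (hb j) (hb0 j) z,
      meromorphicOrderAt_ne_top_of_ne_zero (hb 0) (hb0 0) z⟩
  have hent : ∀ i j : Fin (M + 1), IsSmallError
      (fun r => Real.circleAverage (fun z => Real.log (Φ z)) 0 r + c)
      (proximity (iteratedDeriv i (g j) / g j) ⊤) := by
    intro i j
    obtain ⟨C, hC⟩ := exists_characteristic_div_le hΦ hΦ0 (hb j) (hb 0) (hb0 j) (hb0 0) (hbΦ j)
      (hbΦ 0)
    exact (isSmallError_proximity_iteratedDeriv_div (hgm j) (hgo j) i).of_le (a := 1) (b := C - c)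
      zero_le_one hc fun r hr => by linarith [hC r hr]
  have hmq : ∀ i j : Fin (M + 1), Meromorphic (iteratedDeriv i (g j) / g j) := fun i j =>
    (meromorphic_iteratedDeriv (hgm j) i).div (hgm j)
  set P : Equiv.Perm (Fin (M + 1)) → ℂ → ℂ := fun σ =>
    (fun _ => ((σ.sign : ℤ) : ℂ)) * ∏ j, (iteratedDeriv (σ j) (g j) / g j) with hP
  have hPm : ∀ σ ∈ Finset.univ, Meromorphic (P σ) := fun σ _ =>
    Meromorphic.mul (fun z => MeromorphicAt.const _ z) (Meromorphic.prod fun j _ => hmq (σ j) j)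
  have hcod : (fun z => wronskian b z / ∏ j, b j z) =ᶠ[codiscrete ℂ] ∑ σ, P σ := by
    filter_upwards [eventually_codiscrete_ne_zero (hb 0) (hb0 0)] with z hz
    rw [wronskian_div_prod ((hb 0).analyticAt z) hz fun j => (hb j).analyticAt z, Matrix.det_apply,
      Finset.sum_apply]
    refine Finset.sum_congr rfl fun σ _ => ?_
    simp only [hP, Pi.mul_apply, Finset.prod_apply, Pi.div_apply, Matrix.of_apply, hg,
      Units.smul_def, zsmul_eq_mul]
  have hsum := IsSmallError.sum Finset.univ (φ := fun σ : Equiv.Perm (Fin (M + 1)) => fun r =>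
    log⁺ ‖((σ.sign : ℤ) : ℂ)‖ + ∑ j, proximity (iteratedDeriv (σ j) (g j) / g j) ⊤ r) hc
    fun σ _ => (IsSmallError.const hc _).add (IsSmallError.sum _ hc fun j _ => hent (σ j) j)
  refine (hsum.add (IsSmallError.const hc
    (Real.log (Finset.univ : Finset (Equiv.Perm (Fin (M + 1)))).card))).mono fun r hr => ?_
  rw [proximity_congr_codiscrete hcod (by linarith)]
  refine (proximity_sum_top_le _ _ hPm r).trans ?_
  simp only [Pi.add_apply, Finset.sum_apply]
  refine add_le_add (Finset.sum_le_sum fun σ _ => ?_) le_rfl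
  refine (proximity_mul_top_le (fun z => MeromorphicAt.const _ z)
    (Meromorphic.prod fun j _ => hmq (σ j) j) r).trans (add_le_add proximity_const.le ?_)
  exact proximity_prod_top_le _ (fun j _ => hmq (σ j) j) r

end Nevanlinna

end

/-! ### Truncated counting functions -/

noncomputable section

namespace Nevanlinna

open Metric Set Filter Topology ValueDistribution Real MeasureTheory

lemma finite_zeros {g : ℂ → ℂ} (hg : Differentiable ℂ g) (hg0 : g ≠ 0) (R : ℝ) :
    {u | ‖u‖ ≤ R ∧ g u = 0}.Finite := by
  refine (((MeromorphicOn.divisor g univ).toClosedBall R).finiteSupport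
    (isCompact_closedBall 0 |R|)).subset ?_
  rintro u ⟨huR, hu⟩
  have hmem : u ∈ closedBall (0 : ℂ) |R| := by
    simpa using huR.trans (le_abs_self R)
  rw [Function.mem_support,
    Function.locallyFinsuppWithin.toClosedBall_eval_within _ hmem, divisor_apply_eq hg]
  have h1 := analyticOrderAt_ne_top_of_ne_zero hg hg0 u
  have h2 := (hg.analyticAt u).analyticOrderAt_ne_zero.2 hu
  rw [← Nat.cast_analyticOrderNatAt h1] at h2
  exact_mod_cast h2

lemma logCounting_zero_eq_sum {g : ℂ → ℂ} (hg : Differentiable ℂ g) {r : ℝ} (hr : 0 ≤ r)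
    {t : Finset ℂ} (ht : ∀ u, ‖u‖ ≤ r → g u = 0 → u ∈ t) (htr : ∀ u ∈ t, ‖u‖ ≤ r) :
    logCounting g 0 r = ∑ u ∈ t, (analyticOrderNatAt g u : ℝ) * radialWeight r u := by
  rw [logCounting_zero, posPart_eq_self.2 (divisor_nonneg hg), logCounting_eq_sum _ hr (t := t)
    _ htr]
  · exact Finset.sum_congr rfl fun u _ => by rw [divisor_apply_eq hg]; norm_cast
  · intro u hu hD
    rw [divisor_apply_eq hg] at hD
    exact ht u hu (apply_eq_zero_of_analyticOrderNatAt_ne_zero (by exact_mod_cast hD))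

lemma truncatedOrder_eq {g : ℂ → ℂ} {M : ℕ} {u : ℂ} (h : analyticOrderAt g u ≠ ⊤) :
    truncatedOrder g M u = min M (analyticOrderNatAt g u) := by
  rw [truncatedOrder, ← Nat.cast_analyticOrderNatAt h]
  rcases le_total M (analyticOrderNatAt g u) with h | h
  · rw [min_eq_left h, min_eq_left (by exact_mod_cast h), ENat.toNat_natCast]
  · rw [min_eq_right h, min_eq_right (by exact_mod_cast h), ENat.toNat_natCast]

lemma apply_eq_zero_of_truncatedOrder_ne_zero {g : ℂ → ℂ} {M : ℕ} {u : ℂ}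
    (h : truncatedOrder g M u ≠ 0) : g u = 0 := by
  by_contra hu
  apply h
  have : analyticOrderAt g u = 0 := analyticOrderAt_eq_zero.2 (Or.inr hu)
  simp [truncatedOrder, this]

lemma intervalIntegrable_ite_one_div {a r : ℝ} (hr : 1 ≤ r) (har : a ≤ r) :
    IntervalIntegrable (fun t => if a < t then 1 / t else 0) volume 1 r ∧
      ∫ t in (1 : ℝ)..r, (if a < t then 1 / t else 0) = Real.log (r / max 1 a) := by
  set ρ := max 1 a with hρ
  have hρ1 : 1 ≤ ρ := le_max_left _ _
  have hρr : ρ ≤ r := max_le hr har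
  have e1 : EqOn (fun _ : ℝ => (0 : ℝ)) (fun t => if a < t then 1 / t else 0) (uIoc 1 ρ) := by
    intro t ht
    rw [uIoc_of_le hρ1] at ht
    rcases le_total a 1 with h | h
    · rw [hρ, max_eq_left h] at ht
      exact absurd ht.1 (not_lt.2 ht.2)
    · rw [hρ, max_eq_right h] at ht
      simp [not_lt.2 ht.2]
  have e2 : EqOn (fun t : ℝ => 1 / t) (fun t => if a < t then 1 / t else 0) (uIoc ρ r) := by
    intro t ht
    rw [uIoc_of_le hρr] at ht
    simp [(le_max_right 1 a).trans_lt ht.1]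
  have i0 : IntervalIntegrable (fun t : ℝ => 1 / t) volume ρ r := by
    refine intervalIntegral.intervalIntegrable_one_div (fun t ht => ?_) continuousOn_id
    rw [uIcc_of_le hρr] at ht
    have : 0 < t := by linarith [ht.1]
    exact this.ne'
  have i1 : IntervalIntegrable (fun t => if a < t then 1 / t else 0) volume 1 ρ :=
    (intervalIntegrable_const (c := (0 : ℝ))).congr e1
  have i2 : IntervalIntegrable (fun t => if a < t then 1 / t else 0) volume ρ r := i0.congr e2
  refine ⟨i1.trans i2, ?_⟩
  rw [← intervalIntegral.integral_add_adjacent_intervals i1 i2,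
    ← intervalIntegral.integral_congr_ae (Eventually.of_forall fun x hx => e1 hx),
    ← intervalIntegral.integral_congr_ae (Eventually.of_forall fun x hx => e2 hx),
    intervalIntegral.integral_const, smul_zero, zero_add, integral_one_div]
  rw [uIcc_of_le hρr]
  exact fun h => by linarith [h.1]

/-- The truncated counting function as a sum over zeros. -/
lemma truncatedCounting_eq_sum {g : ℂ → ℂ} {M : ℕ} {r : ℝ} (hr : 1 ≤ r) {t : Finset ℂ}
    (ht : ∀ u, ‖u‖ ≤ r → g u = 0 → u ∈ t) (htr : ∀ u ∈ t, ‖u‖ ≤ r) :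
    truncatedCounting g M r =
      ∑ u ∈ t.erase 0, (truncatedOrder g M u : ℝ) * Real.log (r / max 1 ‖u‖) +
        truncatedOrder g M 0 * Real.log r := by
  classical
  have hsupp : ∀ u, truncatedOrder g M u ≠ 0 → ‖u‖ ≤ r → u ∈ t := fun u hu hur =>
    ht u hur (apply_eq_zero_of_truncatedOrder_ne_zero hu)
  set s := t.erase 0 with hs
  have hcount : ∀ x, 1 < x → x ≤ r → (truncatedCount g M x - truncatedOrder g M 0) / x =
      ∑ u ∈ s, (truncatedOrder g M u : ℝ) * (if ‖u‖ < x then 1 / x else 0) := by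
    intro x hx1 hxr
    have h1 : ∑ᶠ z ∈ ball (0 : ℂ) x, truncatedOrder g M z =
        ∑ u ∈ insert 0 (s.filter fun u => ‖u‖ < x), truncatedOrder g M u := by
      refine finsum_mem_eq_sum_of_inter_support_eq _ ?_
      ext u
      simp only [mem_inter_iff, mem_ball, dist_zero_right, Function.mem_support, Finset.coe_insert,
        Finset.coe_filter, mem_insert_iff, mem_ofPred_eq, and_congr_left_iff, hs, Finset.mem_erase]
      intro hu
      constructor
      · intro hux
        by_cases h0 : u = 0
        · exact Or.inl h0
        · exact Or.inr ⟨⟨h0, hsupp u hu (hux.le.trans hxr)⟩, hux⟩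
      · rintro (rfl | h)
        · simpa using (by linarith : 0 < x)
        · exact h.2
    rw [truncatedCount, h1, Finset.sum_insert (by simp [hs])]
    push_cast
    rw [add_sub_cancel_left, Finset.sum_filter, Finset.sum_div]
    refine Finset.sum_congr rfl fun u _ => ?_
    split_ifs <;> ring
  have hint : ∫ x in (1 : ℝ)..r, (truncatedCount g M x - truncatedOrder g M 0) / x =
      ∑ u ∈ s, (truncatedOrder g M u : ℝ) * Real.log (r / max 1 ‖u‖) := by
    rw [intervalIntegral.integral_congr_ae (g := fun x =>
      ∑ u ∈ s, (truncatedOrder g M u : ℝ) * (if ‖u‖ < x then 1 / x else 0))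
      (Eventually.of_forall fun x hx => by
        rw [uIoc_of_le hr] at hx
        exact hcount x hx.1 hx.2)]
    have hi : ∀ u ∈ s, _ := fun u hu =>
      intervalIntegrable_ite_one_div (a := ‖u‖) hr (htr u (Finset.mem_of_mem_erase hu))
    rw [intervalIntegral.integral_finsetSum fun u hu => (hi u hu).1.const_mul _]
    refine Finset.sum_congr rfl fun u hu => ?_
    rw [intervalIntegral.integral_const_mul, (hi u hu).2]
  rw [truncatedCounting, hint]

/-- The integral from 1 gives a zero u ≠ 0 the weight log(r/max(1, |u|)), Jensen's formula
log(r/|u|). They differ only at the finitely many zeros in the unit disc, by amounts independent of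
`r`. -/
lemma exists_sum_truncatedOrder_le {g : ℂ → ℂ} (hg : Differentiable ℂ g) (hg0 : g ≠ 0) (M : ℕ) :
    ∃ C, ∀ r, 1 ≤ r → ∀ t : Finset ℂ, (∀ u, ‖u‖ ≤ r → g u = 0 → u ∈ t) → (∀ u ∈ t, ‖u‖ ≤ r) →
      ∑ u ∈ t, (truncatedOrder g M u : ℝ) * radialWeight r u ≤ truncatedCounting g M r + C := by
  classical
  set t₁ := (finite_zeros hg hg0 1).toFinset with ht₁
  refine ⟨∑ u ∈ t₁, (truncatedOrder g M u : ℝ) * |Real.log ‖u‖|, fun r hr t ht htr => ?_⟩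
  have hr0 : 0 < r := by linarith
  have hsupp : ∀ u, truncatedOrder g M u ≠ 0 → ‖u‖ ≤ r → u ∈ t := fun u hu hur =>
    ht u hur (apply_eq_zero_of_truncatedOrder_ne_zero hu)
  have hT := truncatedCounting_eq_sum (M := M) hr ht htr
  set s := t.erase 0 with hs
  have hw : ∀ u ∈ s, radialWeight r u ≤
      Real.log (r / max 1 ‖u‖) + (if ‖u‖ ≤ 1 then |Real.log ‖u‖| else 0) := by
    intro u hu
    have hu0 : u ≠ 0 := (Finset.mem_erase.1 hu).1
    have hup : 0 < ‖u‖ := norm_pos_iff.2 hu0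
    rw [radialWeight, if_neg hu0]
    split_ifs with h
    · rw [max_eq_left h, div_one, Real.log_mul hr0.ne' (inv_pos.2 hup).ne', Real.log_inv]
      linarith [neg_abs_le (Real.log ‖u‖)]
    · rw [max_eq_right (not_le.1 h).le, div_eq_mul_inv, add_zero]
  have hsum : ∑ u ∈ t, (truncatedOrder g M u : ℝ) * radialWeight r u =
      ∑ u ∈ s, (truncatedOrder g M u : ℝ) * radialWeight r u +
        truncatedOrder g M 0 * Real.log r := by
    by_cases h0 : (0 : ℂ) ∈ t
    · rw [hs, ← Finset.sum_erase_add _ _ h0]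
      simp [radialWeight]
    · have : truncatedOrder g M 0 = 0 := by
        by_contra h
        exact h0 (hsupp 0 h (by simpa using hr0.le))
      rw [hs, Finset.erase_eq_of_notMem h0, this]
      simp
  have hbound : ∑ u ∈ s, (truncatedOrder g M u : ℝ) * (if ‖u‖ ≤ 1 then |Real.log ‖u‖| else 0) ≤
      ∑ u ∈ t₁, (truncatedOrder g M u : ℝ) * |Real.log ‖u‖| := by
    have e : ∀ u, (truncatedOrder g M u : ℝ) * (if ‖u‖ ≤ 1 then |Real.log ‖u‖| else 0) =
        if ‖u‖ ≤ 1 then (truncatedOrder g M u : ℝ) * |Real.log ‖u‖| else 0 := fun u => by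
      split_ifs <;> ring
    simp only [e]
    rw [← Finset.sum_filter, ← Finset.sum_filter_ne_zero]
    refine Finset.sum_le_sum_of_subset_of_nonneg (fun u hu => ?_) fun u _ _ => by positivity
    obtain ⟨hu, hne⟩ := Finset.mem_filter.1 hu
    have : truncatedOrder g M u ≠ 0 := fun h => hne (by simp [h])
    rw [ht₁, Set.Finite.mem_toFinset]
    exact ⟨(Finset.mem_filter.1 hu).2, apply_eq_zero_of_truncatedOrder_ne_zero this⟩
  rw [hsum, hT]
  have h2 : ∑ u ∈ s, (truncatedOrder g M u : ℝ) * radialWeight r u ≤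
      ∑ u ∈ s, (truncatedOrder g M u : ℝ) * Real.log (r / max 1 ‖u‖) +
      ∑ u ∈ s, (truncatedOrder g M u : ℝ) * (if ‖u‖ ≤ 1 then |Real.log ‖u‖| else 0) := by
    rw [← Finset.sum_add_distrib]
    refine Finset.sum_le_sum fun u hu => ?_
    rw [← mul_add]
    exact mul_le_mul_of_nonneg_left (hw u hu) (Nat.cast_nonneg _)
  linarith

lemma truncatedOrder_pow_le {h : ℂ → ℂ} (hh : Differentiable ℂ h) (h0 : h ≠ 0) {m : ℕ}
    (hm : 0 < m) (M : ℕ) (u : ℂ) : truncatedOrder (h ^ m) M u ≤ m * truncatedOrder h M u := by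
  have e := analyticOrderAt_ne_top_of_ne_zero hh h0 u
  have h1 : analyticOrderAt (h ^ m) u = ((m * analyticOrderNatAt h u : ℕ) : ℕ∞) := by
    rw [analyticOrderAt_pow (hh.analyticAt u), ← Nat.cast_analyticOrderNatAt e]
    simp
  have h2 : analyticOrderNatAt (h ^ m) u = m * analyticOrderNatAt h u := by
    rw [analyticOrderNatAt, h1, ENat.toNat_natCast]
  rw [truncatedOrder_eq (by rw [h1]; exact ENat.natCast_ne_top _), truncatedOrder_eq e, h2]
  rcases le_total M (analyticOrderNatAt h u) with h | h
  · rw [min_eq_left h]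
    exact (min_le_left _ _).trans (Nat.le_mul_of_pos_left M hm)
  · rw [min_eq_right h]
    exact min_le_right _ _

lemma truncatedCounting_pow_le {h : ℂ → ℂ} (hh : Differentiable ℂ h) (h0 : h ≠ 0) {m : ℕ}
    (hm : 0 < m) (M : ℕ) {r : ℝ} (hr : 1 ≤ r) :
    truncatedCounting (h ^ m) M r ≤ m * truncatedCounting h M r := by
  have ht : ∀ u, ‖u‖ ≤ r → h u = 0 → u ∈ (finite_zeros hh h0 r).toFinset := fun u h1 h2 => by
    simpa using ⟨h1, h2⟩
  have htr : ∀ u ∈ (finite_zeros hh h0 r).toFinset, ‖u‖ ≤ r := fun u hu => by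
    simp only [Set.Finite.mem_toFinset] at hu
    exact hu.1
  rw [truncatedCounting_eq_sum hr ht htr, truncatedCounting_eq_sum (g := h ^ m) hr
    (fun u h1 h2 => ht u h1 (pow_eq_zero_iff hm.ne' |>.1 h2)) htr, mul_add, Finset.mul_sum]
  have hle : ∀ u, (truncatedOrder (h ^ m) M u : ℝ) ≤ m * truncatedOrder h M u := fun u => by
    exact_mod_cast truncatedOrder_pow_le hh h0 hm M u
  refine add_le_add (Finset.sum_le_sum fun u hu => ?_) ?_
  · rw [← mul_assoc]
    refine mul_le_mul_of_nonneg_right (hle u) (Real.log_nonneg ?_)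
    rw [one_le_div (by positivity)]
    exact max_le hr (htr u (Finset.mem_of_mem_erase hu))
  · rw [← mul_assoc]
    exact mul_le_mul_of_nonneg_right (hle 0) (Real.log_nonneg hr)

end Nevanlinna

end

/-! ### Cartan's inequality for a finite family of entire functions -/

noncomputable section

namespace Nevanlinna

open Metric Set Filter Topology ValueDistribution Real MeasureTheory

section Bases

variable {ι L : Type*} [Fintype ι] [AddCommGroup L] [Module ℂ L] {v : ι → L} {M : ℕ}

lemma exists_basis_extending (hspan : Module.finrank ℂ (Submodule.span ℂ (range v)) = M + 1)
    {J : Finset ι} (hJ : LinearIndepOn ℂ v (J : Set ι)) :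
    ∃ b : Fin (M + 1) → ι, LinearIndependent ℂ (fun j => v (b j)) ∧ ∀ i ∈ J, ∃ j, b j = i := by
  classical
  obtain ⟨B, -, hJB, hspanB, hB⟩ := exists_linearIndepOn_extension hJ (subset_univ _)
  set B' : Finset ι := (toFinite B).toFinset with hB'
  have hcoe : (B' : Set ι) = B := by simp [hB']
  rw [← hcoe] at hB hspanB hJB
  have hsp : Submodule.span ℂ (v '' B') = Submodule.span ℂ (range v) := by
    refine le_antisymm (Submodule.span_mono (image_subset_range _ _)) (Submodule.span_le.2 ?_)
    rwa [image_univ] at hspanB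
  have hcard : B'.card = M + 1 := by
    rw [← finrank_span_image_eq_card hB, hsp, hspan]
  let e := B'.equivFinOfCardEq hcard
  refine ⟨fun j => (e.symm j : ι), ?_, fun i hi => ⟨e ⟨i, by exact_mod_cast hJB hi⟩, by simp⟩⟩
  have h1 : LinearIndependent ℂ fun x : (B' : Set ι) => v x := hB
  exact h1.comp (fun j => e.symm j) e.symm.injective

lemma exists_matrix_of_basis (hspan : Module.finrank ℂ (Submodule.span ℂ (range v)) = M + 1)
    {b₀ : Fin (M + 1) → ι} (hb₀ : LinearIndependent ℂ fun j => v (b₀ j)) (b : Fin (M + 1) → ι) :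
    ∃ c : Matrix (Fin (M + 1)) (Fin (M + 1)) ℂ, ∀ j, v (b j) = ∑ i, c i j • v (b₀ i) := by
  have : FiniteDimensional ℂ (Submodule.span ℂ (range v)) :=
    FiniteDimensional.span_of_finite ℂ (finite_range v)
  have hle : Submodule.span ℂ (range fun j => v (b₀ j)) ≤ Submodule.span ℂ (range v) :=
    Submodule.span_mono (by rintro _ ⟨j, rfl⟩; exact ⟨_, rfl⟩)
  have heq := Submodule.eq_of_le_of_finrank_eq hle (by
    rw [hspan, finrank_span_eq_card hb₀, Fintype.card_fin])
  have hmem : ∀ j, ∃ c : Fin (M + 1) → ℂ, ∑ i, c i • v (b₀ i) = v (b j) := fun j => by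
    have : v (b j) ∈ Submodule.span ℂ (range fun j => v (b₀ j)) := by
      rw [heq]; exact Submodule.subset_span ⟨_, rfl⟩
    exact (Submodule.mem_span_range_iff_exists_fun ℂ).1 this
  choose c hc using hmem
  exact ⟨fun i j => c j i, fun j => (hc j).symm⟩

/-- The sum of nonnegative weights, bounded by the sum over a basis. -/
lemma exists_basis_sum_le (hspan : Module.finrank ℂ (Submodule.span ℂ (range v)) = M + 1)
    {Δ : ℝ} (hΔ : 0 ≤ Δ) {S : Finset ι}
    (hS : ∀ Γ ⊆ S, (Γ.card : ℝ) ≤ Δ * Module.finrank ℂ (Submodule.span ℂ (v '' Γ)))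
    {a : ι → ℝ} (ha : ∀ i, 0 ≤ a i) :
    ∃ b : Fin (M + 1) → ι, LinearIndependent ℂ (fun j => v (b j)) ∧
      ∑ i ∈ S, a i ≤ Δ * ∑ j, a (b j) := by
  classical
  obtain ⟨J, -, hJ, hle⟩ := exists_linearIndepOn_sum_le v a S hS fun j _ => ha j
  obtain ⟨b, hb, hJb⟩ := exists_basis_extending hspan hJ
  refine ⟨b, hb, hle.trans (mul_le_mul_of_nonneg_left ?_ hΔ)⟩
  have hinj : Function.Injective b := fun i j hij => hb.injective (by simp only [hij])
  calc ∑ i ∈ J, a i ≤ ∑ i ∈ Finset.univ.image b, a i :=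
        Finset.sum_le_sum_of_subset_of_nonneg (fun i hi => by
          obtain ⟨j, rfl⟩ := hJb i hi
          exact Finset.mem_image_of_mem _ (Finset.mem_univ _)) fun i _ _ => ha i
    _ = ∑ j, a (b j) := Finset.sum_image fun i _ j _ h => hinj h

end Bases

/-- The tuples of indices at which a family restricts to a basis of its span. -/
structure BasisTuple {ι L : Type*} [AddCommGroup L] [Module ℂ L] (v : ι → L) (M : ℕ) where
  /-- The indices. -/
  val : Fin (M + 1) → ι
  linearIndependent : LinearIndependent ℂ fun j => v (val j)

instance {ι L : Type*} [Fintype ι] [AddCommGroup L] [Module ℂ L] (v : ι → L) (M : ℕ) :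
    Fintype (BasisTuple v M) :=
  open Classical in Fintype.ofInjective BasisTuple.val fun a b h => by
    cases a; cases b; congr

/-- The quotient of the Wronskian by the product of the functions. -/
def wronskianQuot {ι : Type*} {k : ℕ} (g : ι → ℂ → ℂ) (b : Fin k → ι) (z : ℂ) : ℂ :=
  wronskian (fun j => g (b j)) z / ∏ j, g (b j) z

section Family

variable {ι : Type*} [Fintype ι] {g : ι → ℂ → ℂ} {M : ℕ}

/-- A change of basis multiplies the Wronskian by a constant determinant, so one function `W` serves
all bases drawn from the family. -/
lemma exists_wronskian_eq_mul (hg : ∀ i, Differentiable ℂ (g i))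
    (hspan : Module.finrank ℂ (Submodule.span ℂ (range g)) = M + 1) :
    ∃ W : ℂ → ℂ, Differentiable ℂ W ∧ W ≠ 0 ∧ ∃ κ : BasisTuple g M → ℂ, (∀ b, κ b ≠ 0) ∧
      ∀ b z, wronskian (fun j => g (b.1 j)) z = W z * κ b := by
  obtain ⟨b₀, hb₀, -⟩ := exists_basis_extending hspan (J := ∅) (by simp)
  have hconst : ∀ b : BasisTuple g M, ∃ a : ℂ, a ≠ 0 ∧
      ∀ z, wronskian (fun j => g (b.1 j)) z = wronskian (fun j => g (b₀ j)) z * a := by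
    rintro ⟨b, hb⟩
    obtain ⟨m, hm⟩ := exists_matrix_of_basis hspan hb₀ b
    have h1 : ∀ z, wronskian (fun j => g (b j)) z =
        wronskian (fun j => g (b₀ j)) z * m.det := fun z => by
      rw [← wronskian_linear (fun j => (hg (b₀ j)).analyticAt z) m]
      simp only [hm]
    refine ⟨m.det, fun h0 => ?_, h1⟩
    obtain ⟨z, hz⟩ := exists_wronskian_ne_zero (fun j => hg (b j)) hb
    exact hz (by rw [h1, h0, mul_zero])
  choose κ hκ0 hκ using hconst
  refine ⟨wronskian fun j => g (b₀ j), fun z =>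
    (analyticAt_wronskian fun j => (hg (b₀ j)).analyticAt z).differentiableAt, fun h => ?_,
    κ, hκ0, hκ⟩
  obtain ⟨z, hz⟩ := exists_wronskian_ne_zero (fun j => hg (b₀ j)) hb₀
  exact hz (congrFun h z)

lemma le_sum_univ_of_nonneg {α : Type*} [Fintype α] (f : α → ℝ) (hf : ∀ a, 0 ≤ f a) (a : α) :
    f a ≤ ∑ x, f x :=
  Finset.single_le_sum (fun x _ => hf x) (Finset.mem_univ a)

/-- Functions not small at `z` cost at most |log c| each; the small ones are dominated by a greedily
chosen basis, and the product over the basis is compared with its Wronskian. The basis depends on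
`z`, so the bound sums over all bases. -/
lemma sum_log_sub_log_le (hspan : Module.finrank ℂ (Submodule.span ℂ (range g)) = M + 1)
    {Δ c ϕ : ℝ} (hΔ : 0 ≤ Δ) (hc : 0 < c) (hϕ : 0 < ϕ) (s : Finset ι) {z : ℂ}
    (hgϕ : ∀ i, ‖g i z‖ ≤ ϕ)
    (hS : ∀ S ⊆ s, (∀ j ∈ S, ‖g j z‖ < c * ϕ) →
      (S.card : ℝ) ≤ Δ * Module.finrank ℂ (Submodule.span ℂ (g '' S)))
    {W : ℂ → ℂ} {κ : BasisTuple g M → ℂ} (hκ0 : ∀ b, κ b ≠ 0)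
    (hκ : ∀ b z, wronskian (fun j => g (b.1 j)) z = W z * κ b)
    (hz : ∀ i, g i z ≠ 0) (hWz : W z ≠ 0) :
    ∑ j ∈ s, (Real.log ϕ - Real.log ‖g j z‖) ≤
      Δ * ((M + 1) * Real.log ϕ - Real.log ‖W z‖ +
        ∑ b : BasisTuple g M, log⁺ ‖wronskianQuot g b.1 z‖ + ∑ b, |Real.log ‖κ b‖|) +
          s.card * |Real.log c| := by
  classical
  set a : ι → ℝ := fun i => Real.log ϕ - Real.log ‖g i z‖ with ha
  have ha0 : ∀ i, 0 ≤ a i := fun i =>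
    sub_nonneg.2 (Real.log_le_log (norm_pos_iff.2 (hz i)) (hgϕ i))
  obtain ⟨b, hb, hle⟩ := exists_basis_sum_le hspan hΔ
    (S := s.filter fun j => ‖g j z‖ < c * ϕ) (fun Γ hΓ => hS Γ
      (hΓ.trans (Finset.filter_subset _ _)) fun j hj => (Finset.mem_filter.1 (hΓ hj)).2) ha0
  have hfar : ∑ j ∈ s.filter (fun j => ¬ ‖g j z‖ < c * ϕ), a j ≤ s.card * |Real.log c| := by
    refine (Finset.sum_le_card_nsmul _ _ (|Real.log c|) fun j hj => ?_).trans ?_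
    · have h1 := not_lt.1 (Finset.mem_filter.1 hj).2
      have h2 := Real.log_le_log (mul_pos hc hϕ) h1
      rw [Real.log_mul hc.ne' hϕ.ne'] at h2
      simp only [ha]
      linarith [neg_abs_le (Real.log c)]
    · rw [nsmul_eq_mul]
      refine mul_le_mul_of_nonneg_right ?_ (abs_nonneg _)
      exact_mod_cast Finset.card_filter_le _ _
  have hbsum : ∑ j, a (b j) ≤ (M + 1) * Real.log ϕ - Real.log ‖W z‖ +
        ∑ b : BasisTuple g M, log⁺ ‖wronskianQuot g b.1 z‖ + ∑ b, |Real.log ‖κ b‖| := by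
    have h1 : ∑ j, a (b j) = (M + 1) * Real.log ϕ - Real.log ‖∏ j, g (b j) z‖ := by
      simp only [ha]
      rw [Finset.sum_sub_distrib, norm_prod, Real.log_prod fun j _ => norm_ne_zero_iff.2 (hz _)]
      simp
    have hP : ∏ j, g (b j) z ≠ 0 := Finset.prod_ne_zero_iff.2 fun j _ => hz _
    have h2 := hκ ⟨b, hb⟩ z
    have hWb : wronskian (fun j => g (b j)) z ≠ 0 := by
      rw [h2]; exact mul_ne_zero hWz (hκ0 _)
    have h3 : Real.log ‖wronskian (fun j => g (b j)) z‖ =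
        Real.log ‖W z‖ + Real.log ‖κ ⟨b, hb⟩‖ := by
      rw [h2, norm_mul, Real.log_mul (norm_ne_zero_iff.2 hWz) (norm_ne_zero_iff.2 (hκ0 _))]
    have h4 : Real.log ‖wronskian (fun j => g (b j)) z‖ - Real.log ‖∏ j, g (b j) z‖ ≤
        log⁺ ‖wronskianQuot g b z‖ := by
      rw [← Real.log_div (norm_ne_zero_iff.2 hWb) (norm_ne_zero_iff.2 hP), ← norm_div]
      exact le_max_right 0 _
    have h5 : log⁺ ‖wronskianQuot g b z‖ ≤
        ∑ b : BasisTuple g M, log⁺ ‖wronskianQuot g b.1 z‖ :=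
      le_sum_univ_of_nonneg (fun b : BasisTuple g M => log⁺ ‖wronskianQuot g b.1 z‖)
        (fun _ => Real.posLog_nonneg) ⟨b, hb⟩
    have h6 : |Real.log ‖κ ⟨b, hb⟩‖| ≤ ∑ b, |Real.log ‖κ b‖| :=
      le_sum_univ_of_nonneg (fun b => |Real.log ‖κ b‖|) (fun _ => abs_nonneg _) ⟨b, hb⟩
    have h7 := neg_abs_le (Real.log ‖κ ⟨b, hb⟩‖)
    linarith
  rw [← Finset.sum_filter_add_sum_filter_not s fun j => ‖g j z‖ < c * ϕ]
  exact add_le_add (hle.trans (mul_le_mul_of_nonneg_left hbsum hΔ)) hfar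

/-- The same choice of basis, with multiplicities in excess of `M` as weights; the Wronskian of the
basis vanishes at least to the sum of these excesses. -/
lemma sum_order_tsub_le (hg : ∀ i, Differentiable ℂ (g i)) (hg0 : ∀ i, g i ≠ 0)
    (hspan : Module.finrank ℂ (Submodule.span ℂ (range g)) = M + 1) {Δ : ℝ} (hΔ : 0 ≤ Δ)
    (s : Finset ι) {u : ℂ}
    (hS : ∀ S ⊆ s, (∀ j ∈ S, g j u = 0) →
      (S.card : ℝ) ≤ Δ * Module.finrank ℂ (Submodule.span ℂ (g '' S)))
    {W : ℂ → ℂ} (hWd : Differentiable ℂ W) (hW0 : W ≠ 0) {κ : BasisTuple g M → ℂ}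
    (hκ0 : ∀ b, κ b ≠ 0) (hκ : ∀ b z, wronskian (fun j => g (b.1 j)) z = W z * κ b) :
    ∑ j ∈ s, ((analyticOrderNatAt (g j) u - M : ℕ) : ℝ) ≤ Δ * analyticOrderNatAt W u := by
  classical
  obtain ⟨b, hb, hle⟩ := exists_basis_sum_le hspan hΔ
    (S := s.filter fun j => g j u = 0) (fun Γ hΓ => hS Γ
      (hΓ.trans (Finset.filter_subset _ _)) fun j hj => (Finset.mem_filter.1 (hΓ hj)).2)
    (a := fun i => ((analyticOrderNatAt (g i) u - M : ℕ) : ℝ)) fun i => Nat.cast_nonneg _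
  have h1 : ∑ j ∈ s, ((analyticOrderNatAt (g j) u - M : ℕ) : ℝ) =
      ∑ j ∈ s.filter (fun j => g j u = 0), ((analyticOrderNatAt (g j) u - M : ℕ) : ℝ) := by
    rw [Finset.sum_filter_of_ne]
    intro j _ hj
    refine apply_eq_zero_of_analyticOrderNatAt_ne_zero fun h => hj ?_
    simp [h]
  rw [h1]
  refine hle.trans (mul_le_mul_of_nonneg_left ?_ hΔ)
  have h2 := sum_tsub_le_analyticOrderAt_wronskian (k := M + 1) (M := M) le_rfl (u := u)
    (b := fun j => g (b j)) (fun j => (hg _).analyticAt u)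
    (ν := fun j => analyticOrderNatAt (g (b j)) u) fun j => by
      rw [Nat.cast_analyticOrderNatAt (analyticOrderAt_ne_top_of_ne_zero (hg _) (hg0 _) u)]
  have h3 : analyticOrderAt (wronskian fun j => g (b j)) u = analyticOrderAt W u := by
    have e : (wronskian fun j => g (b j)) = W * fun _ => κ ⟨b, hb⟩ :=
      funext fun z => hκ ⟨b, hb⟩ z
    have h4 : analyticOrderAt (fun _ : ℂ => κ ⟨b, hb⟩) u = 0 :=
      analyticOrderAt_eq_zero.2 (Or.inr (hκ0 ⟨b, hb⟩))
    rw [e, analyticOrderAt_mul (hWd.analyticAt u) analyticAt_const, h4, add_zero]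
  rw [h3, ← Nat.cast_analyticOrderNatAt (analyticOrderAt_ne_top_of_ne_zero hWd hW0 u)] at h2
  exact_mod_cast h2

end Family

/-- The second main theorem for a finite family of entire functions. -/
theorem exists_second_main_inequality {ι : Type*} [Fintype ι] {g : ι → ℂ → ℂ}
    (hg : ∀ i, Differentiable ℂ (g i)) (hg0 : ∀ i, g i ≠ 0) {Φ : ℂ → ℝ} (hΦ : Continuous Φ)
    (hΦ0 : ∀ z, 0 < Φ z) (hgΦ : ∀ i z, ‖g i z‖ ≤ Φ z) {M : ℕ}
    (hspan : Module.finrank ℂ (Submodule.span ℂ (range g)) = M + 1) {Δ c : ℝ} (hΔ : 0 ≤ Δ)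
    (hc : 0 < c) (s : Finset ι)
    (hS : ∀ z, ∀ S ⊆ s, (∀ j ∈ S, ‖g j z‖ < c * Φ z) →
      (S.card : ℝ) ≤ Δ * Module.finrank ℂ (Submodule.span ℂ (g '' S))) :
    ∃ (c₀ C : ℝ) (φ : ℝ → ℝ),
      (∀ r, 1 ≤ r → 0 ≤ Real.circleAverage (fun z => Real.log (Φ z)) 0 r + c₀) ∧
      IsSmallError (fun r => Real.circleAverage (fun z => Real.log (Φ z)) 0 r + c₀) φ ∧
      ∀ r, 1 ≤ r →
        (s.card - Δ * (M + 1)) * Real.circleAverage (fun z => Real.log (Φ z)) 0 r ≤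
          ∑ j ∈ s, truncatedCounting (g j) M r + Δ * φ r + C := by
  classical
  obtain ⟨W, hWd, hW0, κ, hκ0, hκ⟩ := exists_wronskian_eq_mul hg hspan
  obtain ⟨b₀, -, -⟩ := exists_basis_extending hspan (J := ∅) (by simp)
  obtain ⟨c₀, hc₀⟩ := exists_neg_le_circleAverage_log hΦ hΦ0 (hg (b₀ 0)) (hg0 _) (hgΦ _)
  set φ : ℝ → ℝ := fun r => ∑ b : BasisTuple g M, proximity (wronskianQuot g b.1) ⊤ r with hφ
  have hφs : IsSmallError (fun r => Real.circleAverage (fun z => Real.log (Φ z)) 0 r + c₀) φ :=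
    IsSmallError.sum Finset.univ hc₀ fun b _ =>
      isSmallError_proximity_wronskian_div hΦ hΦ0 (fun j => hg _) (fun j => hg0 _)
        (fun j z => hgΦ _ z) hc₀
  set K : ℝ := ∑ b : BasisTuple g M, |Real.log ‖κ b‖| with hK
  have hpt := fun z h1 h2 => sum_log_sub_log_le hspan hΔ hc (hΦ0 z) s (fun i => hgΦ i z) (hS z)
    hκ0 hκ h1 h2
  have hzero := fun u => sum_order_tsub_le hg hg0 hspan hΔ s (u := u) (fun S hSs h => hS u S hSs
    fun j hj => by
      rw [h j hj, norm_zero]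
      exact mul_pos hc (hΦ0 u)) hWd hW0 hκ0 hκ
  choose Ct hCt using fun j => exists_sum_truncatedOrder_le (hg j) (hg0 j) M
  refine ⟨c₀, ∑ j ∈ s, Ct j + ∑ j ∈ s, Real.log ‖meromorphicTrailingCoeffAt (g j) 0‖ -
    Δ * Real.log ‖meromorphicTrailingCoeffAt W 0‖ + Δ * K + s.card * |Real.log c|, φ, hc₀, hφs,
    fun r hr => ?_⟩
  have hr0 : r ≠ 0 := by positivity
  -- integration of the pointwise estimate
  set U := Real.circleAverage (fun z => Real.log (Φ z)) 0 r with hU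
  have iΦ := circleIntegrable_log_of_pos hΦ hΦ0 r
  have ig : ∀ j, CircleIntegrable (fun z => Real.log ‖g j z‖) 0 r := fun j =>
    MeromorphicOn.circleIntegrable_log_norm fun z _ => (hg j).meromorphic z
  have iW : CircleIntegrable (fun z => Real.log ‖W z‖) 0 r :=
    MeromorphicOn.circleIntegrable_log_norm fun z _ => hWd.meromorphic z
  have hWbm : ∀ b : BasisTuple g M,
      Meromorphic (wronskianQuot g b.1) := fun b z => by
    refine MeromorphicAt.div ?_ ?_
    · exact (analyticAt_wronskian fun j => (hg _).analyticAt z).meromorphicAt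
    · exact (Finset.analyticAt_fun_prod _ fun j _ => (hg _).analyticAt z).meromorphicAt
  have ip : ∀ b : BasisTuple g M,
      CircleIntegrable (fun z => log⁺ ‖wronskianQuot g b.1 z‖) 0 r :=
    fun b => MeromorphicOn.circleIntegrable_posLog_norm fun z _ => hWbm b z
  have iL : CircleIntegrable (fun z => ∑ j ∈ s, (Real.log (Φ z) - Real.log ‖g j z‖)) 0 r := by
    convert CircleIntegrable.sum s (f := fun j z => Real.log (Φ z) - Real.log ‖g j z‖)
      (fun j _ => iΦ.sub (ig j)) using 1
    ext z; simp
  have iP : CircleIntegrable (fun z =>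
      ∑ b : BasisTuple g M, log⁺ ‖wronskianQuot g b.1 z‖) 0 r := by
    convert CircleIntegrable.sum Finset.univ (fun b _ => ip b) using 1
    ext z; simp
  have i1 : CircleIntegrable (fun z => ((M : ℝ) + 1) * Real.log (Φ z)) 0 r :=
    iΦ.const_smul (a := (M : ℝ) + 1)
  have i2 : CircleIntegrable (fun z => ((M : ℝ) + 1) * Real.log (Φ z) - Real.log ‖W z‖) 0 r :=
    i1.sub iW
  have i3 : CircleIntegrable (fun z => ((M : ℝ) + 1) * Real.log (Φ z) - Real.log ‖W z‖ +
      ∑ b : BasisTuple g M, log⁺ ‖wronskianQuot g b.1 z‖) 0 r := i2.add iP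
  have i4 := i3.add (circleIntegrable_const K 0 r)
  have i5 : CircleIntegrable (fun z => Δ * (((M : ℝ) + 1) * Real.log (Φ z) - Real.log ‖W z‖ +
          ∑ b : BasisTuple g M, log⁺ ‖wronskianQuot g b.1 z‖ + K)) 0 r :=
    i4.const_smul (a := Δ)
  have havg := circleAverage_mono_codiscrete hr0 iL
    (i5.add (circleIntegrable_const ((s.card : ℝ) * |Real.log c|) 0 r)) (by
      filter_upwards [eventually_codiscrete_ne_zero hWd hW0,
        eventually_all.2 fun i => eventually_codiscrete_ne_zero (hg i) (hg0 i)] with z h1 h2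
      exact hpt z h2 h1)
  have e5 := Real.circleAverage_fun_smul (a := Δ) (f := fun z =>
    ((M : ℝ) + 1) * Real.log (Φ z) - Real.log ‖W z‖ +
          ∑ b : BasisTuple g M, log⁺ ‖wronskianQuot g b.1 z‖ + K) (c := 0) (R := r)
  have e1 := Real.circleAverage_fun_smul (a := (M : ℝ) + 1) (f := fun z => Real.log (Φ z))
    (c := 0) (R := r)
  simp only [smul_eq_mul] at e5 e1
  rw [Real.circleAverage_fun_sum (f := fun j z => Real.log (Φ z) - Real.log ‖g j z‖)
      fun j _ => iΦ.sub (ig j),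
    Real.circleAverage_add i5 (circleIntegrable_const _ 0 r), Real.circleAverage_const, e5,
    Real.circleAverage_fun_add i3 (circleIntegrable_const K 0 r), Real.circleAverage_const,
    Real.circleAverage_fun_add i2 iP, Real.circleAverage_fun_sub i1 iW, e1,
    Real.circleAverage_fun_sum fun b _ => ip b] at havg
  have e6 : ∀ j, Real.circleAverage (fun z => Real.log (Φ z) - Real.log ‖g j z‖) 0 r =
      U - (logCounting (g j) 0 r + Real.log ‖meromorphicTrailingCoeffAt (g j) 0‖) := fun j => by
    rw [Real.circleAverage_fun_sub iΦ (ig j), logCounting_zero_eq (hg j) hr0]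
    ring
  have e7 : Real.circleAverage (fun z => Real.log ‖W z‖) 0 r =
      logCounting W 0 r + Real.log ‖meromorphicTrailingCoeffAt W 0‖ := by
    rw [logCounting_zero_eq hWd hr0]; ring
  have e8 : ∑ b : BasisTuple g M,
      Real.circleAverage (fun z =>
        log⁺ ‖wronskianQuot g b.1 z‖) 0 r = φ r := by
    simp only [hφ, proximity_top]
  simp only [e6] at havg
  rw [e7, e8, Finset.sum_sub_distrib, Finset.sum_const, nsmul_eq_mul, Finset.sum_add_distrib]
    at havg
  -- the zeros
  set t : Finset ℂ := (finite_zeros hWd hW0 r).toFinset ∪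
    s.biUnion fun j => (finite_zeros (hg j) (hg0 j) r).toFinset with ht
  have htr : ∀ u ∈ t, ‖u‖ ≤ r := by
    intro u hu
    simp only [ht, Finset.mem_union, Finset.mem_biUnion, Set.Finite.mem_toFinset] at hu
    rcases hu with h | ⟨j, -, h⟩ <;> exact h.1
  have htW : ∀ u, ‖u‖ ≤ r → W u = 0 → u ∈ t := fun u h1 h2 => by
    simp only [ht, Finset.mem_union, Set.Finite.mem_toFinset]
    exact Or.inl ⟨h1, h2⟩
  have htg : ∀ j ∈ s, ∀ u, ‖u‖ ≤ r → g j u = 0 → u ∈ t := fun j hj u h1 h2 => by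
    simp only [ht, Finset.mem_union, Finset.mem_biUnion, Set.Finite.mem_toFinset]
    exact Or.inr ⟨j, hj, h1, h2⟩
  -- Write ν = min(M, ν) + (ν - M)⁺. The second part is at most Δ times the counting function of
  -- `W`, which cancels the term that Jensen's formula produced from -log|W|.
  have hN : ∑ j ∈ s, logCounting (g j) 0 r ≤
      ∑ j ∈ s, (truncatedCounting (g j) M r + Ct j) + Δ * logCounting W 0 r := by
    have h1 : ∀ j ∈ s, logCounting (g j) 0 r ≤ (truncatedCounting (g j) M r + Ct j) +
        ∑ u ∈ t, ((analyticOrderNatAt (g j) u - M : ℕ) : ℝ) * radialWeight r u := by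
      intro j hj
      rw [logCounting_zero_eq_sum (hg j) (by linarith) (htg j hj) htr]
      have h2 := hCt j r hr t (htg j hj) htr
      refine le_trans (le_of_eq ?_) (add_le_add h2 le_rfl)
      rw [← Finset.sum_add_distrib]
      refine Finset.sum_congr rfl fun u _ => ?_
      rw [← add_mul, truncatedOrder_eq (analyticOrderAt_ne_top_of_ne_zero (hg j) (hg0 j) u)]
      congr 1
      norm_cast
      omega
    refine (Finset.sum_le_sum h1).trans ?_
    rw [Finset.sum_add_distrib (g := fun j => ∑ u ∈ t, _)]
    refine add_le_add le_rfl ?_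
    rw [Finset.sum_comm, logCounting_zero_eq_sum hWd (by linarith) htW htr, Finset.mul_sum]
    refine Finset.sum_le_sum fun u hu => ?_
    rw [← Finset.sum_mul, ← mul_assoc]
    exact mul_le_mul_of_nonneg_right (hzero u) (radialWeight_nonneg hr (htr u hu))
  rw [Finset.sum_add_distrib] at hN
  have hexp : (s.card - Δ * (M + 1)) * U = s.card * U - Δ * ((M + 1) * U) := by ring
  rw [hexp]
  linarith

end Nevanlinna

end

/-! ### Forms on V: compactness, evaluation along the curve, ranks -/

noncomputable section

namespace Nevanlinna

open Set MvPolynomial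

variable {n q : ℕ}

/-- The Euclidean norm of a vector of homogeneous coordinates. -/
def coordNorm (x : Fin (n + 1) → ℂ) : ℝ := √(∑ i, ‖x i‖ ^ 2)

lemma continuous_coordNorm : Continuous (coordNorm (n := n)) := by
  unfold coordNorm
  fun_prop

lemma norm_le_coordNorm (x : Fin (n + 1) → ℂ) : ‖x‖ ≤ coordNorm x :=
  (pi_norm_le_iff_of_nonneg (Real.sqrt_nonneg _)).2 fun i =>
    Real.le_sqrt_of_sq_le (Finset.single_le_sum (f := fun i => ‖x i‖ ^ 2)
      (fun _ _ => sq_nonneg _) (Finset.mem_univ i))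

lemma coordNorm_pos {x : Fin (n + 1) → ℂ} (hx : x ≠ 0) : 0 < coordNorm x :=
  (norm_pos_iff.2 hx).trans_le (norm_le_coordNorm x)

lemma coordNorm_smul (a : ℂ) (x : Fin (n + 1) → ℂ) :
    coordNorm (a • x) = ‖a‖ * coordNorm x := by
  simp only [coordNorm, Pi.smul_apply, smul_eq_mul, norm_mul, mul_pow]
  rw [← Finset.mul_sum, Real.sqrt_mul (sq_nonneg _), Real.sqrt_sq (norm_nonneg _)]

lemma isCompact_coordNorm_eq_one : IsCompact {x : Fin (n + 1) → ℂ | coordNorm x = 1} := by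
  refine (isCompact_closedBall (0 : Fin (n + 1) → ℂ) 1).of_isClosed_subset
    (isClosed_eq continuous_coordNorm continuous_const) fun x hx => ?_
  rw [mem_closedBall_zero_iff]
  exact (norm_le_coordNorm x).trans_eq hx

/-- The point of the unit sphere on the ray through `x`. -/
lemma coordNorm_normalize {x : Fin (n + 1) → ℂ} (hx : x ≠ 0) :
    coordNorm (((coordNorm x)⁻¹ : ℂ) • x) = 1 := by
  rw [coordNorm_smul, norm_inv, Complex.norm_real, Real.norm_eq_abs,
    abs_of_pos (coordNorm_pos hx), inv_mul_cancel₀ (coordNorm_pos hx).ne']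

lemma norm_eval_eq {P : Poly n} {m : ℕ} (hP : P.IsHomogeneous m) {x : Fin (n + 1) → ℂ}
    (hx : x ≠ 0) : ‖eval x P‖ = ‖eval (((coordNorm x)⁻¹ : ℂ) • x) P‖ * coordNorm x ^ m := by
  have h := coordNorm_pos hx
  rw [eval_smul_of_isHomogeneous hP, norm_mul, norm_pow, norm_inv, Complex.norm_real,
    Real.norm_eq_abs, abs_of_pos h, mul_right_comm, ← mul_pow, inv_mul_cancel₀ h.ne', one_pow,
    one_mul]

lemma continuous_eval_poly (P : Poly n) : Continuous fun x => eval x P :=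
  MvPolynomial.continuous_eval P

lemma exists_norm_eval_le {P : Poly n} {m : ℕ} (hP : P.IsHomogeneous m) :
    ∃ C, ∀ x : Fin (n + 1) → ℂ, x ≠ 0 → ‖eval x P‖ ≤ C * coordNorm x ^ m := by
  obtain ⟨C, hC⟩ := isCompact_coordNorm_eq_one.exists_bound_of_continuousOn
    (continuous_eval_poly P).continuousOn
  refine ⟨C, fun x hx => ?_⟩
  rw [norm_eval_eq hP hx]
  exact mul_le_mul_of_nonneg_right (hC _ (coordNorm_normalize hx))
    (pow_nonneg (coordNorm_pos hx).le _)

/-- By homogeneity only the unit vectors in the cone over `V` matter. They form a compact set on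
which the sum of the absolute values has a positive lower bound. -/
lemma exists_le_norm_eval {V : Set (PSpace n)} (hV : IsProjectiveAlgebraic V) {ι : Type*}
    (Γ : Finset ι) {P : ι → Poly n} {m : ℕ} (hP : ∀ j, (P j).IsHomogeneous m)
    (hempty : ∀ (x : Fin (n + 1) → ℂ) (hx : x ≠ 0), Projectivization.mk ℂ x hx ∈ V →
      ∃ j ∈ Γ, eval x (P j) ≠ 0) :
    ∃ c, 0 < c ∧ ∀ (x : Fin (n + 1) → ℂ) (hx : x ≠ 0), Projectivization.mk ℂ x hx ∈ V →
      ∃ j ∈ Γ, c * coordNorm x ^ m ≤ ‖eval x (P j)‖ := by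
  set K : Set (Fin (n + 1) → ℂ) := {x | coordNorm x = 1} ∩ {x | ∀ R ∈ idealOf V, eval x R = 0}
  have hKc : IsCompact K := by
    refine isCompact_coordNorm_eq_one.inter_right ?_
    simp only [ofPred_forall]
    exact isClosed_biInter fun R _ => isClosed_eq (continuous_eval_poly R) continuous_const
  have hne : ∀ x ∈ K, x ≠ 0 := by
    rintro x ⟨hx, -⟩ rfl
    have : coordNorm (0 : Fin (n + 1) → ℂ) = 1 := hx
    simp [coordNorm] at this
  obtain ⟨c, hc, hle⟩ := hKc.exists_forall_le' (f := fun x => ∑ j ∈ Γ, ‖eval x (P j)‖) (a := 0)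
    (continuous_finsetSum _ fun j _ => (continuous_eval_poly (P j)).norm).continuousOn
    fun x hx => by
      obtain ⟨j, hj, hjx⟩ := hempty x (hne x hx) (hV.mk_mem _ hx.2)
      exact Finset.sum_pos' (fun _ _ => norm_nonneg _) ⟨j, hj, norm_pos_iff.2 hjx⟩
  -- The summand 1 covers empty `Γ` and makes the final contradiction strict.
  refine ⟨c / (Γ.card + 1), by positivity, fun x hx hxV => ?_⟩
  set y := ((coordNorm x)⁻¹ : ℂ) • x with hy
  have ha : ((coordNorm x)⁻¹ : ℂ) ≠ 0 := by
    have := coordNorm_pos hx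
    exact inv_ne_zero (by exact_mod_cast this.ne')
  have hyK : y ∈ K := ⟨coordNorm_normalize hx, fun R hR =>
    mem_idealOf.1 hR _ (smul_ne_zero ha hx) (mk_smul_mem hx hxV ha)⟩
  by_contra! h
  have h1 : ∀ j ∈ Γ, ‖eval y (P j)‖ ≤ c / (Γ.card + 1) := fun j hj => by
    have h2 := h j hj
    rw [norm_eval_eq (hP j) hx] at h2
    exact (lt_of_mul_lt_mul_right h2 (pow_nonneg (coordNorm_pos hx).le _)).le
  have h3 := (hle y hyK).trans (Finset.sum_le_card_nsmul _ _ _ h1)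
  rw [nsmul_eq_mul, ← mul_div_assoc, le_div_iff₀ (by positivity)] at h3
  linarith

/-- On `V`, those of finitely many forms that are small at a point have a common zero. -/
lemma exists_pos_forall_nonempty {V : Set (PSpace n)} (hV : IsProjectiveAlgebraic V)
    {Q : Fin q → Poly n} {deg : Fin q → ℕ} (hQ : ∀ j, (Q j).IsHomogeneous (deg j))
    {P : Fin q → Poly n} {m : ℕ} (hP : ∀ j, (P j).IsHomogeneous m)
    (hPQ : ∀ j x, eval x (P j) = 0 ↔ eval x (Q j) = 0) :
    ∃ c, 0 < c ∧ ∀ (x : Fin (n + 1) → ℂ) (hx : x ≠ 0), Projectivization.mk ℂ x hx ∈ V →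
      ∀ Γ : Finset (Fin q), (∀ j ∈ Γ, ‖eval x (P j)‖ < c * coordNorm x ^ m) →
        ((⋂ j ∈ Γ, zeroSet (Q j)) ∩ V).Nonempty := by
  have h : ∀ Γ : Finset (Fin q), ∃ c, 0 < c ∧ ∀ (x : Fin (n + 1) → ℂ) (hx : x ≠ 0),
      Projectivization.mk ℂ x hx ∈ V → (∀ j ∈ Γ, ‖eval x (P j)‖ < c * coordNorm x ^ m) →
        ((⋂ j ∈ Γ, zeroSet (Q j)) ∩ V).Nonempty := fun Γ => by
    by_cases hne : ((⋂ j ∈ Γ, zeroSet (Q j)) ∩ V).Nonempty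
    · exact ⟨1, one_pos, fun _ _ _ _ => hne⟩
    obtain ⟨c, hc, hle⟩ := exists_le_norm_eval hV Γ hP fun x hx hxV => by
      by_contra! h0
      refine hne ⟨_, mem_iInter₂.2 fun j hj => ?_, hxV⟩
      exact (mk_mem_zeroSet (hQ j) hx).2 ((hPQ j x).1 (h0 j hj))
    refine ⟨c, hc, fun x hx hxV hlt => ?_⟩
    obtain ⟨j, hj, h1⟩ := hle x hx hxV
    exact absurd (hlt j hj) (not_lt.2 h1)
  choose c hc hlt using h
  refine ⟨Finset.univ.inf' Finset.univ_nonempty c, (Finset.lt_inf'_iff _).2 fun Γ _ => hc Γ,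
    fun x hx hxV Γ h => hlt Γ x hx hxV fun j hj => (h j hj).trans_le ?_⟩
  exact mul_le_mul_of_nonneg_right (Finset.inf'_le _ (Finset.mem_univ Γ))
    (pow_nonneg (coordNorm_pos hx).le _)

/-- The evaluation of forms of degree `d` along a curve. -/
def evalAlong (F : ℂ → Fin (n + 1) → ℂ) (d : ℕ) :
    homogeneousSubmodule (Fin (n + 1)) ℂ d →ₗ[ℂ] ℂ → ℂ where
  toFun P z := eval (F z) (P : Poly n)
  map_add' P R := by ext z; simp
  map_smul' a P := by ext z; simp

lemma evalAlong_apply (F : ℂ → Fin (n + 1) → ℂ) (d : ℕ)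
    (P : homogeneousSubmodule (Fin (n + 1)) ℂ d) (z : ℂ) :
    evalAlong F d P z = eval (F z) (P : Poly n) := rfl

lemma mem_idealPart {V : Set (PSpace n)} {d : ℕ} {P : homogeneousSubmodule (Fin (n + 1)) ℂ d} :
    P ∈ idealPart V d ↔ (P : Poly n) ∈ idealOf V := Iff.rfl

lemma ker_evalAlong {V : Set (PSpace n)} {d : ℕ} {f : ℂ → PSpace n} (hfV : ∀ z, f z ∈ V)
    {F : ℂ → Fin (n + 1) → ℂ} (hF : IsReducedRepresentation F f) (hnd : NondegenerateOver V d F) :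
    LinearMap.ker (evalAlong F d) = idealPart V d := by
  ext P
  rw [LinearMap.mem_ker]
  refine ⟨fun h => ?_, fun h => ?_⟩
  · by_contra hP
    exact hnd ⟨P, fun h0 => hP ((Submodule.Quotient.mk_eq_zero _).1 h0), fun z => congrFun h z⟩
  · ext z
    obtain ⟨hz, hfz⟩ := hF.2 z
    exact mem_idealOf.1 (mem_idealPart.1 h) _ hz (hfz ▸ hfV z)

lemma finrank_range_evalAlong {V : Set (PSpace n)} {d : ℕ} {F : ℂ → Fin (n + 1) → ℂ}
    (hker : LinearMap.ker (evalAlong F d) = idealPart V d) :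
    Module.finrank ℂ (LinearMap.range (evalAlong F d)) = hilbertFun V d := by
  rw [hilbertFun, ← (evalAlong F d).quotKerEquivRange.finrank_eq, hker]

/-- The power x_i^d of a coordinate with F_i(0) ≠ 0 survives. This makes M + 1 = H_V(d) valid
despite truncated subtraction. -/
lemma hilbertFun_pos {V : Set (PSpace n)} {d : ℕ} {F : ℂ → Fin (n + 1) → ℂ} (hF0 : F 0 ≠ 0)
    (hker : LinearMap.ker (evalAlong F d) = idealPart V d) : 0 < hilbertFun V d := by
  rw [← finrank_range_evalAlong hker]
  have : Module.Finite ℂ (homogeneousSubmodule (Fin (n + 1)) ℂ d) :=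
    Module.Finite.iff_fg.2 (homogeneousSubmodule_fg _ _ _)
  obtain ⟨i, hi⟩ := Function.ne_iff.1 hF0
  rw [Module.finrank_pos_iff_exists_ne_zero]
  refine ⟨⟨_, LinearMap.mem_range_self _ ⟨X i ^ d, by
    simpa using (isHomogeneous_X ℂ i).pow d⟩⟩, fun h => ?_⟩
  have h1 := congrFun (congrArg Subtype.val h) 0
  change eval (F 0) (X i ^ d) = 0 at h1
  rw [map_pow, eval_X] at h1
  exact hi (eq_zero_of_pow_eq_zero h1)

/-- Let `B` index a basis of the span. Each other form is a combination of those in `B` modulo I(V),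
so it vanishes on `V` wherever they do, and the dimension count applies with #B equal to the rank.
-/
lemma card_le_mul_finrank_span {V : Set (PSpace n)} (hV : IsProjectiveAlgebraic V)
    {Q : Fin q → Poly n} {deg : Fin q → ℕ} (hdeg : ∀ j, 0 < deg j)
    (hQ : ∀ j, (Q j).IsHomogeneous (deg j))
    (hVQ : ∀ j, projDim (zeroSet (Q j) ∩ V) < projDim V) {d : ℕ} {F : ℂ → Fin (n + 1) → ℂ}
    (hker : LinearMap.ker (evalAlong F d) = idealPart V d)
    {P : Fin q → homogeneousSubmodule (Fin (n + 1)) ℂ d}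
    (hPQ : ∀ j x, eval x (P j : Poly n) = 0 ↔ eval x (Q j) = 0) (Γ : Finset (Fin q))
    (hne : ((⋂ j ∈ Γ, zeroSet (Q j)) ∩ V).Nonempty) :
    (Γ.card : ℝ) ≤ distributiveConstant V Q *
      Module.finrank ℂ (Submodule.span ℂ ((fun j => evalAlong F d (P j)) '' Γ)) := by
  obtain ⟨B, hBΓ, hspan, hB⟩ : ∃ B ⊆ Γ,
      Submodule.span ℂ ((fun j => evalAlong F d (P j)) '' (B : Set (Fin q))) =
        Submodule.span ℂ ((fun j => evalAlong F d (P j)) '' (Γ : Set (Fin q))) ∧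
      LinearIndepOn ℂ (fun j => evalAlong F d (P j)) (B : Set (Fin q)) := by
    obtain ⟨b, hb, -, hsp, hli⟩ := exists_linearIndepOn_extension
      (linearIndepOn_empty ℂ fun j => evalAlong F d (P j)) (empty_subset (Γ : Set (Fin q)))
    refine ⟨(toFinite b).toFinset, by simpa using hb, ?_, by simpa using hli⟩
    rw [Finite.coe_toFinset]
    exact le_antisymm (Submodule.span_mono (image_mono hb)) (Submodule.span_le.2 hsp)
  rw [← hspan, finrank_span_image_eq_card hB]
  refine card_le_distributiveConstant_mul hV hdeg hQ hVQ Γ B hne (Subset.antisymm ?_ ?_)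
  · rintro p ⟨hp, hpV⟩
    refine ⟨mem_iInter₂.2 fun i hi => ?_, hpV⟩
    have hv := p.rep_nonzero
    have h1 : evalAlong F d (P i) ∈
        Submodule.span ℂ ((fun j => evalAlong F d (P j)) '' (B : Set (Fin q))) := by
      rw [hspan]; exact Submodule.subset_span ⟨i, hi, rfl⟩
    rw [← image_image (evalAlong F d) P, ← Submodule.map_span] at h1
    obtain ⟨R, hR, hRi⟩ := h1
    have h2 : P i - R ∈ idealPart V d := by
      rw [← hker, LinearMap.mem_ker, map_sub, hRi, sub_self]
    have h3 := mem_idealOf.1 (mem_idealPart.1 h2) p.rep hv (by rwa [p.mk_rep])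
    have h4 : Submodule.span ℂ (P '' (B : Set (Fin q))) ≤
        LinearMap.ker ((MvPolynomial.aeval (R := ℂ) p.rep).toLinearMap.comp
          (homogeneousSubmodule (Fin (n + 1)) ℂ d).subtype) := by
      rw [Submodule.span_le]
      rintro _ ⟨j, hj, rfl⟩
      have : eval p.rep (Q j) = 0 := mem_iInter₂.1 hp j hj
      simpa [aeval_eq_eval] using (hPQ j _).2 this
    have h5 : eval p.rep (R : Poly n) = 0 := by simpa [aeval_eq_eval] using h4 hR
    refine (hPQ i p.rep).1 ?_
    simpa [h5] using h3
  · exact inter_subset_inter_left _ (biInter_subset_biInter_left hBΓ)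

end Nevanlinna

end

/-! ### The inequality for hypersurfaces, with an abstract error term -/

noncomputable section

namespace Nevanlinna

open Set MvPolynomial

variable {n q : ℕ}

lemma circleAverage_log_const_mul_pow {Ψ : ℂ → ℝ} (hΨ : Continuous Ψ) (hΨ0 : ∀ z, 0 < Ψ z)
    {C : ℝ} (hC : 0 < C) (d : ℕ) (r : ℝ) :
    Real.circleAverage (fun z => Real.log (C * Ψ z ^ d)) 0 r =
      Real.log C + d * Real.circleAverage (fun z => Real.log (Ψ z)) 0 r := by
  have h : (fun z => Real.log (C * Ψ z ^ d)) =
      (fun _ => Real.log C) + (d : ℝ) • fun z => Real.log (Ψ z) := by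
    ext z
    rw [Real.log_mul hC.ne' (pow_ne_zero _ (hΨ0 z).ne'), Real.log_pow]
    rfl
  rw [h, Real.circleAverage_add (circleIntegrable_const _ _ _)
    ((circleIntegrable_log_of_pos hΨ hΨ0 r).const_smul), Real.circleAverage_const,
    Real.circleAverage_smul, smul_eq_mul]

/-- Finitely many spanning nonzero members of a finite-dimensional space. -/
lemma exists_spanning_of_finrank {L H : Type*} [AddCommGroup L] [Module ℂ L] [AddCommGroup H]
    [Module ℂ H] (φ : H →ₗ[ℂ] L) [FiniteDimensional ℂ (LinearMap.range φ)] :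
    ∃ P : Fin (Module.finrank ℂ (LinearMap.range φ)) → H, (∀ i, φ (P i) ≠ 0) ∧
      Submodule.span ℂ (range fun i => φ (P i)) = LinearMap.range φ := by
  set b := Module.finBasis ℂ (LinearMap.range φ)
  choose P hP using fun i => (b i).2
  refine ⟨P, fun i h => b.ne_zero i (Subtype.ext ((hP i).symm.trans h)), ?_⟩
  have h1 : (range fun i => φ (P i)) = (LinearMap.range φ).subtype '' range b := by
    rw [← range_comp]
    exact congrArg range (funext hP)
  rw [h1, ← Submodule.map_span, b.span_eq, Submodule.map_subtype_top]

/-- The inequality for the powers of degree `d` of the forms `Q j`, with its error term. -/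
lemma exists_inequality_of_dvd {V : Set (PSpace n)} (hV : IsProjectiveAlgebraic V)
    {Q : Fin q → Poly n} {deg : Fin q → ℕ}
    (hdeg : ∀ j, 0 < deg j) (hQ : ∀ j, (Q j).IsHomogeneous (deg j))
    (hVQ : ∀ j, projDim (zeroSet (Q j) ∩ V) < projDim V)
    {d M : ℕ} (hd0 : 0 < d) (hdvd : ∀ j, deg j ∣ d) (hM : M = hilbertFun V d - 1)
    {f : ℂ → PSpace n} (hfV : ∀ z, f z ∈ V)
    {F : ℂ → Fin (n + 1) → ℂ} (hF : IsReducedRepresentation F f)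
    (hnd : NondegenerateOver V d F) :
    ∃ (c₀ C : ℝ) (φ : ℝ → ℝ), (∀ r, 1 ≤ r → 0 ≤ d * characteristic F r + c₀) ∧
      IsSmallError (fun r => d * characteristic F r + c₀) φ ∧
      ∀ r, 1 ≤ r → (q - distributiveConstant V Q * (M + 1)) * (d * characteristic F r) ≤
        ∑ j, ((d / deg j : ℕ) : ℝ) * countingFunction F (Q j) M r +
          distributiveConstant V Q * φ r + C := by
  classical
  have hF0 : ∀ z, F z ≠ 0 := fun z => (hF.2 z).1
  have hmem : ∀ z, Projectivization.mk ℂ (F z) (hF0 z) ∈ V := fun z => by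
    obtain ⟨hz, hfz⟩ := hF.2 z
    exact hfz ▸ hfV z
  have hFd : Differentiable ℂ F := differentiable_pi.2 hF.1
  have hker := ker_evalAlong hfV hF hnd
  have hm : ∀ j, 0 < d / deg j := fun j => Nat.div_pos (Nat.le_of_dvd hd0 (hdvd j)) (hdeg j)
  set P₁ : Fin q → homogeneousSubmodule (Fin (n + 1)) ℂ d := fun j =>
    ⟨Q j ^ (d / deg j), by
      have := (hQ j).pow (d / deg j)
      rwa [Nat.mul_div_cancel' (hdvd j)] at this⟩ with hP₁
  have hP₁Q : ∀ j x, eval x (P₁ j : Poly n) = 0 ↔ eval x (Q j) = 0 := fun j x => by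
    simp only [hP₁, map_pow]
    exact pow_eq_zero_iff (hm j).ne'
  have hP₁e : ∀ j, evalAlong F d (P₁ j) = (fun z => eval (F z) (Q j)) ^ (d / deg j) := fun j => by
    ext z
    simp [evalAlong_apply, hP₁]
  -- Otherwise nondegeneracy would put the form into I(V), so that V ⊆ D_j, against the drop in
  -- dimension.
  have hP₁0 : ∀ j, evalAlong F d (P₁ j) ≠ 0 := fun j h => by
    rw [← LinearMap.mem_ker, hker, mem_idealPart, mem_idealOf] at h
    refine (hVQ j).ne (congrArg projDim (inter_eq_right.2 fun p hp => ?_))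
    exact (hP₁Q j _).1 (h p.rep p.rep_nonzero (by rwa [p.mk_rep]))
  have : Module.Finite ℂ (homogeneousSubmodule (Fin (n + 1)) ℂ d) :=
    Module.Finite.iff_fg.2 (homogeneousSubmodule_fg _ _ _)
  -- The given forms need not span the image. Auxiliary forms raise the rank to M + 1, but only the
  -- given ones enter the sum.
  obtain ⟨P₂, hP₂0, hP₂⟩ := exists_spanning_of_finrank (evalAlong F d)
  set P := Sum.elim P₁ P₂ with hP
  set g : _ → ℂ → ℂ := fun i => evalAlong F d (P i) with hg
  have hspan : Submodule.span ℂ (range g) = LinearMap.range (evalAlong F d) := by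
    refine le_antisymm (Submodule.span_le.2 ?_) (hP₂.symm.le.trans (Submodule.span_mono ?_))
    · rintro _ ⟨i, rfl⟩
      exact LinearMap.mem_range_self _ _
    · rintro _ ⟨i, rfl⟩
      exact ⟨Sum.inr i, rfl⟩
  have hfr : Module.finrank ℂ (Submodule.span ℂ (range g)) = M + 1 := by
    rw [hspan, finrank_range_evalAlong hker, hM, Nat.sub_add_cancel (hilbertFun_pos (hF0 0) hker)]
  choose C hC using fun i => exists_norm_eval_le (P := (P i : Poly n)) (P i).2
  set C' : ℝ := 1 + ∑ i, |C i| with hC'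
  have hC'0 : 0 < C' := by positivity
  have hN : Continuous fun z => coordNorm (F z) := continuous_coordNorm.comp hFd.continuous
  have hN0 : ∀ z, 0 < coordNorm (F z) := fun z => coordNorm_pos (hF0 z)
  have hPd : ∀ R : Poly n, Differentiable ℂ fun z => eval (F z) R := fun R z => by
    have := (AnalyticAt.aeval_mvPolynomial (𝕜 := ℂ) (z := z) (f := F)
      (fun i => (hF.1 i).analyticAt z) R).differentiableAt
    simpa [aeval_eq_eval] using this
  obtain ⟨c, hc, hsmall⟩ := exists_pos_forall_nonempty hV hQ (fun j => (P₁ j).2) hP₁Q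
  obtain ⟨c₀, C₁, φ, hT, hφ, hmain⟩ := exists_second_main_inequality (g := g)
    (fun i => hPd _) (by rintro (j | j); exacts [hP₁0 j, hP₂0 j])
    (Φ := fun z => C' * coordNorm (F z) ^ d) (by fun_prop)
    (fun z => mul_pos hC'0 (pow_pos (hN0 z) _))
    (fun i z => (hC i _ (hF0 z)).trans (mul_le_mul_of_nonneg_right
      (((le_abs_self _).trans (le_sum_univ_of_nonneg (fun i => |C i|) (fun _ => abs_nonneg _) i)).trans
        (le_add_of_nonneg_left zero_le_one)) (pow_nonneg (hN0 z).le _)))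
    hfr (distributiveConstant_nonneg V Q) (div_pos hc hC'0)
    (Finset.univ.map Function.Embedding.inl) fun z S hS hlt => by
      obtain ⟨Γ, -, rfl⟩ := Finset.subset_map_iff.1 hS
      rw [Finset.card_map, Finset.coe_map, image_image]
      refine card_le_mul_finrank_span hV hdeg hQ hVQ hker hP₁Q Γ
        (hsmall (F z) (hF0 z) (hmem z) Γ fun j hj => ?_)
      have := hlt _ (Finset.mem_map_of_mem _ hj)
      rw [← mul_assoc, div_mul_cancel₀ _ hC'0.ne'] at this
      exact this
  have hU : ∀ r, Real.circleAverage (fun z => Real.log (C' * coordNorm (F z) ^ d)) 0 r =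
      Real.log C' + d * characteristic F r :=
    circleAverage_log_const_mul_pow hN hN0 hC'0 d
  have hU' : ∀ r, Real.circleAverage (fun z => Real.log (C' * coordNorm (F z) ^ d)) 0 r + c₀ =
      d * characteristic F r + (Real.log C' + c₀) := fun r => by rw [hU]; ring
  simp only [hU'] at hT hφ
  refine ⟨Real.log C' + c₀, C₁ - (q - distributiveConstant V Q * (M + 1)) * Real.log C', φ, hT, hφ,
    fun r hr => ?_⟩
  have h1 := hmain r hr
  rw [hU, Finset.card_map, Finset.card_univ, Fintype.card_fin, Finset.sum_map] at h1
  have h2 : ∑ j, truncatedCounting (g (Function.Embedding.inl j)) M r ≤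
      ∑ j, ((d / deg j : ℕ) : ℝ) * countingFunction F (Q j) M r := by
    refine Finset.sum_le_sum fun j _ => ?_
    have h3 : g (Function.Embedding.inl j) = _ := hP₁e j
    rw [h3]
    refine truncatedCounting_pow_le (hPd _) (fun h0 => hP₁0 j ?_) (hm j) M hr
    rw [hP₁e, h0, zero_pow (hm j).ne']
  linarith

end Nevanlinna

end

/-! ### The main theorem -/

open Nevanlinna in
theorem theorem1p1 {n q : ℕ} (V : Set (PSpace n)) (hV : IsProjectiveAlgebraic V)
    (Q : Fin q → Poly n) (deg : Fin q → ℕ)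
    (hdeg : ∀ j, 0 < deg j) (hQ : ∀ j, (Q j).IsHomogeneous (deg j))
    (hVQ : ∀ j, projDim (zeroSet (Q j) ∩ V) < projDim V)
    (d M : ℕ) (hd : d = Finset.univ.lcm deg) (hM : M = hilbertFun V d - 1)
    (f : ℂ → PSpace n) (hfV : ∀ z, f z ∈ V)
    (F : ℂ → Fin (n + 1) → ℂ) (hF : IsReducedRepresentation F f)
    (hnd : NondegenerateOver V d F)
    (ε δ : ℝ) (hε : 0 < ε) (hδ : 0 < δ) :
    ∃ (E : Set ℝ) (C : ℝ), MeasurableSet E ∧ MeasureTheory.volume E < ⊤ ∧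
      ∀ r : ℝ, 0 < r → r ∉ E →
        ((q : ℝ) - distributiveConstant V Q * ((M : ℝ) + 1 + ε)) * characteristic F r ≤
          (∑ j, (1 / (deg j : ℝ)) * countingFunction F (Q j) M r)
            + distributiveConstant V Q * δ * Real.log r + C := by
  have hd0 : 0 < d := by
    rw [hd, Nat.pos_iff_ne_zero, Ne, Finset.lcm_eq_zero_iff]
    simpa using fun j => (hdeg j).ne'
  have hdvd : ∀ j, deg j ∣ d := fun j => hd ▸ Finset.dvd_lcm (Finset.mem_univ j)
  obtain ⟨c₀, C₁, φ, hT, hφ, hmain⟩ := exists_inequality_of_dvd hV hdeg hQ hVQ hd0 hdvd hM hfV hF hnd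
  set Δ := distributiveConstant V Q with hΔ
  have hΔ0 : 0 ≤ Δ := distributiveConstant_nonneg V Q
  have hd1 : (1 : ℝ) ≤ d := by exact_mod_cast hd0
  -- One small parameter controls both the multiple of the characteristic and that of log r.
  obtain ⟨E, C₂, hE, hEv, hEφ⟩ := hφ (min ε δ) (lt_min hε hδ)
  -- The estimates hold for r ≥ 1, so the radii below 1 join the exceptional set; the constant
  -- reflects the final division by d.
  refine ⟨Set.Ioo 0 1 ∪ E, (Δ * ε * c₀ + Δ * C₂ + C₁) / d, measurableSet_Ioo.union hE,
    (MeasureTheory.measure_union_le _ _).trans_lt (ENNReal.add_lt_top.2 ⟨by simp, hEv⟩),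
    fun r hr hrE => ?_⟩
  have hr1 : 1 ≤ r := not_lt.1 fun h => hrE (Or.inl ⟨hr, h⟩)
  have h1 := hmain r hr1
  have h2 := hEφ r hr1 fun h => hrE (Or.inr h)
  have h3 := hT r hr1
  have hlog := Real.log_nonneg hr1
  have h4 : min ε δ * (d * characteristic F r + c₀ + Real.log r) ≤
      ε * (d * characteristic F r + c₀) + d * (δ * Real.log r) := by
    rw [mul_add]
    refine add_le_add (mul_le_mul_of_nonneg_right (min_le_left _ _) h3) ?_
    refine (mul_le_mul_of_nonneg_right (min_le_right _ _) hlog).trans ?_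
    exact le_mul_of_one_le_left (mul_nonneg hδ.le hlog) hd1
  have h5 := mul_le_mul_of_nonneg_left (h2.trans (add_le_add_left h4 C₂)) hΔ0
  have h6 : ∑ j, ((d / deg j : ℕ) : ℝ) * countingFunction F (Q j) M r =
      d * ∑ j, (1 / (deg j : ℝ)) * countingFunction F (Q j) M r := by
    rw [Finset.mul_sum]
    refine Finset.sum_congr rfl fun j _ => ?_
    rw [Nat.cast_div (hdvd j) (by exact_mod_cast (hdeg j).ne')]
    ring
  have hdpos : (0 : ℝ) < d := by linarith
  rw [h6] at h1
  rw [← sub_le_iff_le_add', le_div_iff₀ hdpos]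
  linarith
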